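/- Let $d\ge 2$ be an integer and $\rho\ge 1$ a real number. For a finite family $F=(o_1,\dots,o_n)$ of nonempty bounded sets (objects) in $\mathbb{R}^d$, call $F$ \emph{similarly sized} (with ratio $\rho$) if $\operatorname{diam}(o_i)\le\rho\cdot\operatorname{diam}(o_j)$ for all $i,j$, and, for a real $\alpha\ge 1$, call $F$ \emph{$\alpha$-stabbed} if for every real $r$ and every open ball $B$ of radius $r$ there is a set of at most $\alpha^d$ points that meets every object $o_i\subseteq B$ with $\operatorname{diam}(o_i)\in[r/2,r)$. The intersection graph of $F$ has the indices $1,\dots,n$ as vertices, and two distinct vertices are adjacent if and only if the corresponding objects intersect. There are a constant $C>0$ and an algorithm $A$, both depending only on $d$ and $\rho$, such that the following holds for every real $\alpha\ge 1$ and every similarly sized (with ratio $\rho$) $\alpha$-stabbed family $F$ of $n$ objects in $\mathbb{R}^d$: given the intersection graph of $F$ (its adjacency matrix), $A$ outputs a maximum independent set of this graph after at most $$C\cdot n^{\,C\,k^{1-1/d}\,\alpha}$$ steps of a random-access machine, where $k$ is the size of a maximum independent set. In other words, Independent Set on intersection graphs of similarly sized $\alpha$-stabbed objects in $\mathbb{R}^d$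 can be solved in time $n^{O(k^{1-1/d}\alpha)}$. -/

import Mathlib

/-! ### A random-access machine with unit-cost instructions

Registers and memory cells hold natural numbers. The arithmetic is limited to constants, addition
and truncated subtraction; there is no multiplication, so that the unit-cost running time is
polynomially related to the running time of a Turing machine. -/

/-- The store of the machine: registers and a directly addressable memory. -/
structure RamState where
  reg : ℕ → ℕ
  mem : ℕ → ℕ

/-- Assign the value `v` to register `r`. -/
def RamState.setReg (s : RamState) (r v : ℕ) : RamState :=
  { s with reg := Function.update s.reg r v }

/-- Write the value `v` into memory cell `a`. -/
def RamState.setMem (s : RamState) (a v : ℕ) : RamState :=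
  { s with mem := Function.update s.mem a v }

/-- Programs of the random-access machine (finite syntax trees). The numbers `r`, `a`, `b` are names
of registers. -/
inductive RamProg : Type
  /-- `r := c` for a constant `c`. -/
  | const (r c : ℕ) : RamProg
  /-- `r := a + b`. -/
  | add (r a b : ℕ) : RamProg
  /-- `r := a - b`, truncated at zero. -/
  | sub (r a b : ℕ) : RamProg
  /-- `r := mem[a]` (indirect addressing). -/
  | load (r a : ℕ) : RamProg
  /-- `mem[a] := b` (indirect addressing). -/
  | store (a b : ℕ) : RamProg
  /-- Run `p`, then `q`. -/
  | seq (p q : RamProg) : RamProg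
  /-- If register `r` is nonzero run `p`, otherwise run `q`. -/
  | ite (r : ℕ) (p q : RamProg) : RamProg
  /-- As long as register `r` is nonzero run `p`. -/
  | while (r : ℕ) (p : RamProg) : RamProg

/-- `RamRuns p s s' t`: started in state `s`, the program `p` halts in state `s'` after exactly `t`
steps. Every elementary instruction and every test of a conditional or a loop counts one step. -/
inductive RamRuns : RamProg → RamState → RamState → ℕ → Prop
  | const (r c : ℕ) (s : RamState) : RamRuns (.const r c) s (s.setReg r c) 1
  | add (r a b : ℕ) (s : RamState) :
      RamRuns (.add r a b) s (s.setReg r (s.reg a + s.reg b)) 1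
  | sub (r a b : ℕ) (s : RamState) :
      RamRuns (.sub r a b) s (s.setReg r (s.reg a - s.reg b)) 1
  | load (r a : ℕ) (s : RamState) :
      RamRuns (.load r a) s (s.setReg r (s.mem (s.reg a))) 1
  | store (a b : ℕ) (s : RamState) :
      RamRuns (.store a b) s (s.setMem (s.reg a) (s.reg b)) 1
  | seq {p q : RamProg} {s₁ s₂ s₃ : RamState} {t₁ t₂ : ℕ} :
      RamRuns p s₁ s₂ t₁ → RamRuns q s₂ s₃ t₂ → RamRuns (.seq p q) s₁ s₃ (t₁ + t₂)
  | iteTrue {r : ℕ} {p q : RamProg} {s₁ s₂ : RamState} {t : ℕ} :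
      s₁.reg r ≠ 0 → RamRuns p s₁ s₂ t → RamRuns (.ite r p q) s₁ s₂ (t + 1)
  | iteFalse {r : ℕ} {p q : RamProg} {s₁ s₂ : RamState} {t : ℕ} :
      s₁.reg r = 0 → RamRuns q s₁ s₂ t → RamRuns (.ite r p q) s₁ s₂ (t + 1)
  | whileStop {r : ℕ} {p : RamProg} {s : RamState} :
      s.reg r = 0 → RamRuns (.while r p) s s 1
  | whileStep {r : ℕ} {p : RamProg} {s₁ s₂ s₃ : RamState} {t₁ t₂ : ℕ} :
      s₁.reg r ≠ 0 → RamRuns p s₁ s₂ t₁ → RamRuns (.while r p) s₂ s₃ t₂ →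
      RamRuns (.while r p) s₁ s₃ (t₁ + t₂ + 1)

open Classical in
/-- The initial state of the machine for an input graph `G` on the vertices `0, …, n - 1`: memory
cell `0` holds `n`, the cells `1, …, n * n` hold the adjacency matrix of `G` row by row, and all other
cells and all registers are zero. -/
noncomputable def ramInput {n : ℕ} (G : SimpleGraph (Fin n)) : RamState where
  reg := fun _ => 0
  mem := fun a =>
    if a = 0 then n
    else if ∃ i j : Fin n, G.Adj i j ∧ a = 1 + i.val * n + j.val then 1 else 0

/-- The vertex set that is written in the first `n` memory cells of a final state. -/
def ramOutput (n : ℕ) (s : RamState) : Finset (Fin n) :=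
  Finset.univ.filter fun i => s.mem i.val ≠ 0

/-! ### Families of objects in Euclidean space -/

/-- The intersection graph of a family of objects: two different members of the family are adjacent
if and only if they have a point in common. -/
def intersectionGraph {ι X : Type*} (o : ι → Set X) : SimpleGraph ι where
  Adj i j := i ≠ j ∧ (o i ∩ o j).Nonempty
  symm := ⟨fun i j h => ⟨h.1.symm, by rw [Set.inter_comm]; exact h.2⟩⟩
  loopless := ⟨fun _ h => h.1 rfl⟩

/-- The objects are nonempty and bounded, and no diameter exceeds `ρ` times another. -/
structure SimilarlySized {ι X : Type*} [PseudoMetricSpace X] (ρ : ℝ) (o : ι → Set X) : Prop where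
  nonempty : ∀ i, (o i).Nonempty
  bounded : ∀ i, Bornology.IsBounded (o i)
  diam_le : ∀ i j, Metric.diam (o i) ≤ ρ * Metric.diam (o j)

/-- A family of objects in `ℝ^d` is `α`-stabbed if, for every ball of radius `r`, the members of the
family that lie in this ball and have a diameter in `[r/2, r)` can be stabbed by at most `α ^ d`
points. -/
def IsStabbed {ι : Type*} {d : ℕ} (α : ℝ) (o : ι → Set (EuclideanSpace ℝ (Fin d))) : Prop :=
  ∀ (r : ℝ) (c : EuclideanSpace ℝ (Fin d)),
    ∃ P : Finset (EuclideanSpace ℝ (Fin d)), (P.card : ℝ) ≤ α ^ d ∧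
      ∀ i, Metric.diam (o i) ∈ Set.Ico (r / 2) r → o i ⊆ Metric.ball c r → ∃ p ∈ P, p ∈ o i

/-!
The algorithm is a branching that knows nothing about geometry. To solve a connected component `K` of
a subproblem `G[W]`, it takes some vertex `y` of `K`. Every maximum independent set of `K` contains a
vertex `x` of the closed neighbourhood of `y`, since otherwise `y` could be added. So it suffices to
solve the graphs `K` minus the closed neighbourhood of `x`, for these `x`, and to keep the best result
(`IsPartialSolution.update`). `Resolvable G s W` says that pivots `y` can be chosen such that this
terminates at depth `s`.

Geometry bounds the depth. Similarly sized objects can be replaced by points such that edges have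
length at most `1`, and stabbing bounds the independent sets in small cubes by `O(α ^ d)`. If `k` is
the independence number, then some cube splits the graph in a balanced way, and the vertices near its
boundary have an independence number of at most `t = O(k ^ (1 - 1 / d) * α)` (`exists_separator`). As
long as a component contains vertices of the separator, one branches at such a vertex. The vertices
`x` that are selected on the way are independent and close to the separator, so there are at most `t`
of them (`resolvable_of_separator`). Afterwards every component lies on one side, where the
independence number has dropped by a constant factor. Since `1 - 1 / d ≥ 1 / 2`, the depths of all
these rounds sum up to `O(k ^ (1 - 1 / d) * α)` (`resolvable_of_points`, `resolvable_of_isStabbed`).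

The machine knows neither `k` nor `α` nor the pivots. It enumerates the nodes `W` of the `n`-ary tree
in which the `x`-th child of `W` is `W` minus the closed neighbourhood of `x`, in the order of their
depth, and stores a partial solution for each node. Whenever a node has been expanded, it passes over
all expanded nodes from the last one to the root and solves every component for which the solutions of
the children at some pivot are known. At the latest when all nodes of depth less than `s` have been
expanded, the root is solved (`SolverInvariant`). As there are at most `(n + 1) ^ s` of these, the
running time is `(n + 1) ^ (O(1) + 2 * s)` (`solver_correct`).

The program is written in a small language of expressions and `for`-loops, whose compilation into
machine programs is verified once (`LoopProg.ramRuns_compile`); only the outer loop is a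
`while`-loop.
-/

/-! ### A loop language and its compilation -/

/-- Expressions of the loop language. `size` is the fixed number `n` of vertices, `mulSize a` is the
product of `a` and `n`. -/
inductive LoopExpr : Type
  | size : LoopExpr
  | var (r : ℕ) : LoopExpr
  | const (c : ℕ) : LoopExpr
  | add (a b : LoopExpr) : LoopExpr
  | sub (a b : LoopExpr) : LoopExpr
  | mulSize (a : LoopExpr) : LoopExpr
  | load (a : LoopExpr) : LoopExpr

/-- Programs of the loop language. All loops are `for`-loops over `0, …, n - 1`, so every program
terminates in time polynomial in `n`. -/
inductive LoopProg : Type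
  | skip : LoopProg
  | set (x : ℕ) (e : LoopExpr) : LoopProg
  | store (a b : LoopExpr) : LoopProg
  | seq (p q : LoopProg) : LoopProg
  | ite (e : LoopExpr) (p q : LoopProg) : LoopProg
  | forN (x : ℕ) (p : LoopProg) : LoopProg

namespace RamState

@[simp] lemma setReg_reg (s : RamState) (r v q : ℕ) :
    (s.setReg r v).reg q = if q = r then v else s.reg q := by
  simp [setReg, Function.update_apply]

@[simp] lemma setReg_mem (s : RamState) (r v : ℕ) : (s.setReg r v).mem = s.mem := rfl

@[simp] lemma setMem_reg (s : RamState) (a v : ℕ) : (s.setMem a v).reg = s.reg := rfl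

@[simp] lemma setMem_mem (s : RamState) (a v b : ℕ) :
    (s.setMem a v).mem b = if b = a then v else s.mem b := by
  simp [setMem, Function.update_apply]

end RamState

/-- Apply `f 0`, `f 1`, …, `f (i - 1)` in this order. -/
def loopUpTo (f : ℕ → RamState → RamState) : ℕ → RamState → RamState
  | 0, h => h
  | i + 1, h => f i (loopUpTo f i h)

namespace LoopExpr

/-- The value of an expression; the registers of `h` are the variables of the loop language. -/
def eval (n : ℕ) (h : RamState) : LoopExpr → ℕ
  | size => n
  | var r => h.reg r
  | const c => c
  | add a b => a.eval n h + b.eval n h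
  | sub a b => a.eval n h - b.eval n h
  | mulSize a => a.eval n h * n
  | load a => h.mem (a.eval n h)

/-- The number of machine steps of the compiled expression. -/
def cost (n : ℕ) : LoopExpr → ℕ
  | size => 2
  | var _ => 2
  | const _ => 1
  | add a b => a.cost n + b.cost n + 1
  | sub a b => a.cost n + b.cost n + 1
  | mulSize a => a.cost n + 3 * n + 7
  | load a => a.cost n + 1

/-- Compilation of an expression. Register `0` of the machine holds `n`, the variable `r` lives in
register `2 * r + 2`, and the odd registers hold intermediate results: the value is left in register
`2 * k + 1`, and the odd registers below it are not touched. -/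
def compile : LoopExpr → ℕ → RamProg
  | size, k => .seq (.const (2 * k + 1) 0) (.add (2 * k + 1) (2 * k + 1) 0)
  | var r, k => .seq (.const (2 * k + 1) 0) (.add (2 * k + 1) (2 * k + 1) (2 * r + 2))
  | const c, k => .const (2 * k + 1) c
  | add a b, k =>
      .seq (.seq (a.compile k) (b.compile (k + 1))) (.add (2 * k + 1) (2 * k + 1) (2 * k + 3))
  | sub a b, k =>
      .seq (.seq (a.compile k) (b.compile (k + 1))) (.sub (2 * k + 1) (2 * k + 1) (2 * k + 3))
  | mulSize a, k =>
      .seq (a.compile k) (.seq (.const (2 * k + 3) 0) (.seq (.const (2 * k + 5) 0)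
        (.seq (.add (2 * k + 5) (2 * k + 5) 0) (.seq (.const (2 * k + 7) 1)
          (.seq (.while (2 * k + 5) (.seq (.add (2 * k + 3) (2 * k + 3) (2 * k + 1))
              (.sub (2 * k + 5) (2 * k + 5) (2 * k + 7))))
            (.seq (.const (2 * k + 1) 0) (.add (2 * k + 1) (2 * k + 1) (2 * k + 3))))))))
  | load a, k => .seq (a.compile k) (.load (2 * k + 1) (2 * k + 1))

end LoopExpr

/-- The machine state `s` represents the state `h` of the loop language. -/
structure Represents (n : ℕ) (s h : RamState) : Prop where
  size : s.reg 0 = n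
  var : ∀ r, s.reg (2 * r + 2) = h.reg r
  mem : s.mem = h.mem

lemma Represents.congr {n : ℕ} {s s' h : RamState} (H : Represents n s h)
    (hr : ∀ q, q % 2 = 0 → s'.reg q = s.reg q) (hm : s'.mem = s.mem) : Represents n s' h :=
  ⟨by rw [hr 0 rfl, H.size], fun r => by rw [hr _ (by omega), H.var], hm.trans H.mem⟩

lemma Represents.setOdd {n : ℕ} {s h : RamState} (H : Represents n s h) (k v : ℕ) :
    Represents n (s.setReg (2 * k + 1) v) h :=
  H.congr (fun q hq => by simp; omega) rfl

lemma ramRuns_mul_loop (k : ℕ) : ∀ (c : ℕ) (s : RamState), s.reg (2 * k + 5) = c →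
    s.reg (2 * k + 7) = 1 →
    ∃ s', RamRuns (.while (2 * k + 5) (.seq (.add (2 * k + 3) (2 * k + 3) (2 * k + 1))
        (.sub (2 * k + 5) (2 * k + 5) (2 * k + 7)))) s s' (3 * c + 1) ∧
      s'.reg (2 * k + 3) = s.reg (2 * k + 3) + c * s.reg (2 * k + 1) ∧ s'.mem = s.mem ∧
      ∀ q, q ≠ 2 * k + 3 → q ≠ 2 * k + 5 → s'.reg q = s.reg q
  | 0, s, h0, _ => ⟨s, .whileStop h0, by simp, rfl, fun _ _ _ => rfl⟩
  | c + 1, s, h0, h1 => by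
      obtain ⟨s', hs', hv, hm, hq⟩ := ramRuns_mul_loop k c
        ((s.setReg (2 * k + 3) (s.reg (2 * k + 3) + s.reg (2 * k + 1))).setReg (2 * k + 5) c)
        (by simp) (by simp [h1])
      refine ⟨s', ?_, ?_, hm, fun q h3 h5 => ?_⟩
      · have h2 := RamRuns.whileStep (r := 2 * k + 5) (by omega)
          (RamRuns.seq (RamRuns.add (2 * k + 3) (2 * k + 3) (2 * k + 1) s)
            (RamRuns.sub (2 * k + 5) (2 * k + 5) (2 * k + 7) _)) (s₃ := s') (t₂ := 3 * c + 1)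
          (by simpa [h0, h1] using hs')
        convert h2 using 1
        ring
      · rw [hv]; simp; ring
      · rw [hq q h3 h5]; simp [h3, h5]

theorem LoopExpr.ramRuns_compile (n : ℕ) (h : RamState) : ∀ (e : LoopExpr) (k : ℕ) (s : RamState),
    Represents n s h → ∃ s', RamRuns (e.compile k) s s' (e.cost n) ∧ Represents n s' h ∧
      s'.reg (2 * k + 1) = e.eval n h ∧ ∀ j < k, s'.reg (2 * j + 1) = s.reg (2 * j + 1)
  | size, k, s, H => by
      refine ⟨_, .seq (.const _ _ _) (.add _ _ _ _), (H.setOdd _ _).setOdd _ _, ?_, fun j hj => ?_⟩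
      · simp [eval, H.size]
      · rw [RamState.setReg_reg, if_neg (by omega), RamState.setReg_reg, if_neg (by omega)]
  | var r, k, s, H => by
      refine ⟨_, .seq (.const _ _ _) (.add _ _ _ _), (H.setOdd _ _).setOdd _ _, ?_, fun j hj => ?_⟩
      · have : ¬ (2 * r + 2 = 2 * k + 1) := by omega
        simp [eval, H.var, this]
      · rw [RamState.setReg_reg, if_neg (by omega), RamState.setReg_reg, if_neg (by omega)]
  | const c, k, s, H => by
      refine ⟨_, .const _ _ _, H.setOdd _ _, ?_, fun j hj => ?_⟩
      · simp [eval]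
      · simp; omega
  | add a b, k, s, H => by
      obtain ⟨s₁, r₁, H₁, v₁, o₁⟩ := ramRuns_compile n h a k s H
      obtain ⟨s₂, r₂, H₂, v₂, o₂⟩ := ramRuns_compile n h b (k + 1) s₁ H₁
      refine ⟨_, .seq (.seq r₁ r₂) (.add _ _ _ _), H₂.setOdd _ _, ?_, fun j hj => ?_⟩
      · have := o₂ k (by omega)
        simp [eval, this, v₁, ← v₂, mul_add]
      · rw [RamState.setReg_reg, if_neg (by omega), o₂ j (by omega), o₁ j hj]
  | sub a b, k, s, H => by
      obtain ⟨s₁, r₁, H₁, v₁, o₁⟩ := ramRuns_compile n h a k s H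
      obtain ⟨s₂, r₂, H₂, v₂, o₂⟩ := ramRuns_compile n h b (k + 1) s₁ H₁
      refine ⟨_, .seq (.seq r₁ r₂) (.sub _ _ _ _), H₂.setOdd _ _, ?_, fun j hj => ?_⟩
      · have := o₂ k (by omega)
        simp [eval, this, v₁, ← v₂, mul_add]
      · rw [RamState.setReg_reg, if_neg (by omega), o₂ j (by omega), o₁ j hj]
  | load a, k, s, H => by
      obtain ⟨s₁, r₁, H₁, v₁, o₁⟩ := ramRuns_compile n h a k s H
      refine ⟨_, .seq r₁ (.load _ _ _), H₁.setOdd _ _, ?_, fun j hj => ?_⟩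
      · simp [eval, v₁, H₁.mem]
      · rw [RamState.setReg_reg, if_neg (by omega), o₁ j hj]
  | mulSize a, k, s, H => by
      obtain ⟨s₁, r₁, H₁, v₁, o₁⟩ := ramRuns_compile n h a k s H
      set s₂ := (((s₁.setReg (2 * k + 3) 0).setReg (2 * k + 5) 0).setReg (2 * k + 5) n).setReg
        (2 * k + 7) 1 with hs₂
      have hsz : ((s₁.setReg (2 * k + 3) 0).setReg (2 * k + 5) 0).reg (2 * k + 5) +
          ((s₁.setReg (2 * k + 3) 0).setReg (2 * k + 5) 0).reg 0 = n := by simp [H₁.size]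
      obtain ⟨s₃, r₃, v₃, m₃, o₃⟩ := ramRuns_mul_loop k n s₂ (by simp [hs₂]) (by simp [hs₂])
      have hrun : RamRuns (.seq (.const (2 * k + 3) 0) (.seq (.const (2 * k + 5) 0)
          (.seq (.add (2 * k + 5) (2 * k + 5) 0) (.seq (.const (2 * k + 7) 1)
          (.seq (.while (2 * k + 5) (.seq (.add (2 * k + 3) (2 * k + 3) (2 * k + 1))
              (.sub (2 * k + 5) (2 * k + 5) (2 * k + 7))))
            (.seq (.const (2 * k + 1) 0) (.add (2 * k + 1) (2 * k + 1) (2 * k + 3))))))))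
          s₁ ((s₃.setReg (2 * k + 1) 0).setReg (2 * k + 1) (s₃.reg (2 * k + 3)))
          (1 + (1 + (1 + (1 + ((3 * n + 1) + (1 + 1)))))) := by
        refine .seq (.const _ _ _) (.seq (.const _ _ _) (.seq (.add _ _ _ _) ?_))
        rw [hsz]
        refine .seq (.const _ _ _) (.seq r₃ (.seq (.const _ _ _) ?_))
        convert RamRuns.add (2 * k + 1) (2 * k + 1) (2 * k + 3) (s₃.setReg (2 * k + 1) 0) using 2
        simp
      have hrun' := RamRuns.seq r₁ hrun
      have hodd : ∀ q, q < 2 * k + 3 → s₂.reg q = s₁.reg q := fun q hq => by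
        simp only [hs₂, RamState.setReg_reg]
        rw [if_neg (by omega), if_neg (by omega), if_neg (by omega), if_neg (by omega)]
      refine ⟨(s₃.setReg (2 * k + 1) 0).setReg (2 * k + 1) (s₃.reg (2 * k + 3)), ?_,
        ((H₁.congr (s' := s₃) (fun q hq => ?_) ?_).setOdd k _).setOdd k _, ?_, fun j hj => ?_⟩
      · have hc : cost n a.mulSize = cost n a + (1 + (1 + (1 + (1 + ((3 * n + 1) + (1 + 1)))))) := by
          simp only [cost]; ring
        rw [hc]; exact hrun'
      · rw [o₃ q (by omega) (by omega)]
        simp only [hs₂, RamState.setReg_reg]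
        rw [if_neg (by omega), if_neg (by omega), if_neg (by omega), if_neg (by omega)]
      · rw [m₃]; simp [hs₂]
      · rw [RamState.setReg_reg, if_pos rfl, v₃, hodd (2 * k + 1) (by omega), v₁]
        simp [hs₂, eval, mul_comm]
      · rw [RamState.setReg_reg, if_neg (by omega), RamState.setReg_reg, if_neg (by omega),
          o₃ _ (by omega) (by omega), hodd _ (by omega), o₁ j hj]

namespace LoopProg

/-- The effect of a program of the loop language. -/
def run (n : ℕ) : LoopProg → RamState → RamState
  | skip, h => h
  | set x e, h => h.setReg x (e.eval n h)
  | store a b, h => h.setMem (a.eval n h) (b.eval n h)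
  | seq p q, h => q.run n (p.run n h)
  | ite e p q, h => if e.eval n h ≠ 0 then p.run n h else q.run n h
  | forN x p, h => loopUpTo (fun i h' => p.run n (h'.setReg x i)) n h

/-- A bound on the number of machine steps of the compiled program. -/
def cost (n : ℕ) : LoopProg → ℕ
  | skip => 1
  | set _ e => e.cost n + 2
  | store a b => a.cost n + b.cost n + 1
  | seq p q => p.cost n + q.cost n
  | ite e p q => e.cost n + (p.cost n + q.cost n + 1)
  | forN _ p => n * (p.cost n + 4) + 3

/-- Compilation of a program; the odd registers below `2 * k + 1` are not touched. The counter of a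
loop is kept in the odd register `2 * k + 1` and runs downwards. -/
def compile : LoopProg → ℕ → RamProg
  | skip, k => .const (2 * k + 1) 0
  | set x e, k =>
      .seq (e.compile k) (.seq (.const (2 * x + 2) 0) (.add (2 * x + 2) (2 * x + 2) (2 * k + 1)))
  | store a b, k => .seq (.seq (a.compile k) (b.compile (k + 1))) (.store (2 * k + 1) (2 * k + 3))
  | seq p q, k => .seq (p.compile k) (q.compile k)
  | ite e p q, k => .seq (e.compile k) (.ite (2 * k + 1) (p.compile k) (q.compile k))
  | forN x p, k =>
      .seq (.seq (.const (2 * k + 1) 0) (.add (2 * k + 1) (2 * k + 1) 0))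
        (.while (2 * k + 1) (.seq (.sub (2 * x + 2) 0 (2 * k + 1)) (.seq (p.compile (k + 1))
          (.seq (.const (2 * k + 3) 1) (.sub (2 * k + 1) (2 * k + 1) (2 * k + 3))))))

end LoopProg

lemma Represents.setVar {n : ℕ} {s h : RamState} (H : Represents n s h) (x v : ℕ) :
    Represents n (s.setReg (2 * x + 2) v) (h.setReg x v) :=
  ⟨by simp [H.size], fun r => by simp [H.var], by simp [H.mem]⟩

theorem LoopProg.ramRuns_compile (n : ℕ) : ∀ (p : LoopProg) (k : ℕ) (s h : RamState),
    Represents n s h → ∃ s' t, RamRuns (p.compile k) s s' t ∧ t ≤ p.cost n ∧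
      Represents n s' (p.run n h) ∧ ∀ j < k, s'.reg (2 * j + 1) = s.reg (2 * j + 1)
  | skip, k, s, h, H => by
      refine ⟨_, _, .const _ _ _, le_rfl, H.setOdd _ _, fun j hj => ?_⟩
      simp; omega
  | set x e, k, s, h, H => by
      obtain ⟨s₁, r₁, H₁, v₁, o₁⟩ := e.ramRuns_compile n h k s H
      refine ⟨_, _, .seq r₁ (.seq (.const _ _ _) (.add _ _ _ _)), le_rfl, ?_, fun j hj => ?_⟩
      · have hne : ¬ (2 * k + 1 = 2 * x + 2) := by omega
        have := ((H₁.setVar x 0).setVar x (e.eval n h))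
        simp only [RamState.setReg_reg, if_true, if_neg hne, v₁, zero_add]
        convert this using 1
        simp [LoopProg.run, RamState.setReg]
      · rw [RamState.setReg_reg, if_neg (by omega), RamState.setReg_reg, if_neg (by omega), o₁ j hj]
  | store a b, k, s, h, H => by
      obtain ⟨s₁, r₁, H₁, v₁, o₁⟩ := a.ramRuns_compile n h k s H
      obtain ⟨s₂, r₂, H₂, v₂, o₂⟩ := b.ramRuns_compile n h (k + 1) s₁ H₁
      refine ⟨_, _, .seq (.seq r₁ r₂) (.store _ _ _), le_rfl, ?_, fun j hj => ?_⟩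
      · have h1 := o₂ k (by omega)
        have h2 : s₂.reg (2 * k + 3) = b.eval n h := v₂
        rw [h1, v₁, h2]
        exact ⟨H₂.size, H₂.var, by simp [LoopProg.run, RamState.setMem, H₂.mem]⟩
      · rw [RamState.setMem_reg, o₂ j (by omega), o₁ j hj]
  | seq p q, k, s, h, H => by
      obtain ⟨s₁, t₁, r₁, l₁, H₁, o₁⟩ := ramRuns_compile n p k s h H
      obtain ⟨s₂, t₂, r₂, l₂, H₂, o₂⟩ := ramRuns_compile n q k s₁ _ H₁
      exact ⟨s₂, _, .seq r₁ r₂, add_le_add l₁ l₂, H₂, fun j hj => (o₂ j hj).trans (o₁ j hj)⟩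
  | ite e p q, k, s, h, H => by
      obtain ⟨s₁, r₁, H₁, v₁, o₁⟩ := e.ramRuns_compile n h k s H
      by_cases he : e.eval n h = 0
      · obtain ⟨s₂, t₂, r₂, l₂, H₂, o₂⟩ := ramRuns_compile n q k s₁ h H₁
        refine ⟨s₂, _, .seq r₁ (.iteFalse (v₁.trans he) r₂), ?_, ?_,
          fun j hj => (o₂ j hj).trans (o₁ j hj)⟩
        · simp only [cost]; omega
        · simpa [LoopProg.run, he] using H₂
      · obtain ⟨s₂, t₂, r₂, l₂, H₂, o₂⟩ := ramRuns_compile n p k s₁ h H₁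
        refine ⟨s₂, _, .seq r₁ (.iteTrue (by rwa [v₁]) r₂), ?_, ?_,
          fun j hj => (o₂ j hj).trans (o₁ j hj)⟩
        · simp only [cost]; omega
        · simpa [LoopProg.run, he] using H₂
  | forN x p, k, s, h, H => by
      have loop : ∀ c ≤ n, ∀ s, s.reg (2 * k + 1) = c →
          Represents n s (loopUpTo (fun i h' => p.run n (h'.setReg x i)) (n - c) h) →
          ∃ s' t, RamRuns (.while (2 * k + 1) (.seq (.sub (2 * x + 2) 0 (2 * k + 1))
              (.seq (p.compile (k + 1)) (.seq (.const (2 * k + 3) 1)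
                (.sub (2 * k + 1) (2 * k + 1) (2 * k + 3)))))) s s' t ∧
            t ≤ c * (p.cost n + 4) + 1 ∧
            Represents n s' (loopUpTo (fun i h' => p.run n (h'.setReg x i)) n h) ∧
            ∀ j < k, s'.reg (2 * j + 1) = s.reg (2 * j + 1) := by
        intro c
        induction c with
        | zero => exact fun _ s hs Hs => ⟨s, 1, .whileStop hs, by simp, Hs, fun _ _ => rfl⟩
        | succ c ih =>
          intro hc s hs Hs
          have hsub : s.reg 0 - s.reg (2 * k + 1) = n - (c + 1) := by rw [hs, Hs.size]
          obtain ⟨s₁, t₁, r₁, l₁, H₁, o₁⟩ := ramRuns_compile n p (k + 1) _ _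
            (Hs.setVar x (n - (c + 1)))
          have hk : s₁.reg (2 * k + 1) = c + 1 := by
            rw [o₁ k (by omega), RamState.setReg_reg, if_neg (by omega), hs]
          obtain ⟨s₂, t₂, r₂, l₂, H₂, o₂⟩ := ih (by omega)
            ((s₁.setReg (2 * k + 3) 1).setReg (2 * k + 1) c) (by simp) (by
              have e : n - c = n - (c + 1) + 1 := by omega
              rw [e, loopUpTo]
              exact (H₁.setOdd (k + 1) 1).setOdd k c)
          refine ⟨s₂, 1 + (t₁ + (1 + 1)) + t₂ + 1, .whileStep (by omega)
            (s₂ := (s₁.setReg (2 * k + 3) 1).setReg (2 * k + 1) c)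
            (.seq (.sub _ _ _ _) (.seq (s₂ := s₁) ?_ (.seq (.const _ _ _) ?_))) r₂, ?_, H₂,
            fun j hj => ?_⟩
          · rw [hsub]; exact r₁
          · convert RamRuns.sub (2 * k + 1) (2 * k + 1) (2 * k + 3) _ using 2
            simp [hk]
          · calc 1 + (t₁ + (1 + 1)) + t₂ + 1
                ≤ 1 + (p.cost n + (1 + 1)) + (c * (p.cost n + 4) + 1) + 1 := by gcongr
              _ = (c + 1) * (p.cost n + 4) + 1 := by ring
          · rw [o₂ j hj, RamState.setReg_reg, if_neg (by omega), RamState.setReg_reg,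
              if_neg (by omega), o₁ j (by omega), RamState.setReg_reg, if_neg (by omega)]
      have e : ((s.setReg (2 * k + 1) 0).reg (2 * k + 1) + (s.setReg (2 * k + 1) 0).reg 0) = n := by
        simp [H.size]
      obtain ⟨s', t, r, l, H', o⟩ := loop n le_rfl ((s.setReg (2 * k + 1) 0).setReg (2 * k + 1) n)
        (by simp) (by simpa [loopUpTo] using (H.setOdd k 0).setOdd k n)
      refine ⟨s', 1 + 1 + t, .seq (.seq (.const _ _ _) (.add _ _ _ _)) ?_, ?_, H', fun j hj => ?_⟩
      · rw [e]; exact r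
      · simp only [cost]; omega
      · rw [o j hj, RamState.setReg_reg, if_neg (by omega), RamState.setReg_reg, if_neg (by omega)]

lemma LoopExpr.cost_le (e : LoopExpr) : ∃ C, ∀ n, e.cost n ≤ C * (n + 1) := by
  induction e with
  | size => exact ⟨2, fun n => by simp only [cost]; omega⟩
  | var r => exact ⟨2, fun n => by simp only [cost]; omega⟩
  | const c => exact ⟨1, fun n => by simp only [cost]; omega⟩
  | add a b iha ihb =>
    obtain ⟨A, hA⟩ := iha
    obtain ⟨B, hB⟩ := ihb
    exact ⟨A + B + 1, fun n => by simp only [cost]; nlinarith [hA n, hB n]⟩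
  | sub a b iha ihb =>
    obtain ⟨A, hA⟩ := iha
    obtain ⟨B, hB⟩ := ihb
    exact ⟨A + B + 1, fun n => by simp only [cost]; nlinarith [hA n, hB n]⟩
  | mulSize a iha =>
    obtain ⟨A, hA⟩ := iha
    exact ⟨A + 7, fun n => by simp only [cost]; nlinarith [hA n]⟩
  | load a iha =>
    obtain ⟨A, hA⟩ := iha
    exact ⟨A + 1, fun n => by simp only [cost]; nlinarith [hA n]⟩

lemma LoopProg.cost_le (p : LoopProg) : ∃ C D, ∀ n, p.cost n ≤ C * (n + 1) ^ D := by
  have one (D n : ℕ) : 1 ≤ (n + 1) ^ D := Nat.one_le_pow _ _ (by omega)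
  have mono (D D' n : ℕ) (h : D ≤ D') : (n + 1) ^ D ≤ (n + 1) ^ D' :=
    Nat.pow_le_pow_right (by omega) h
  induction p with
  | skip => exact ⟨1, 0, fun n => by simp [cost]⟩
  | set x e =>
    obtain ⟨A, hA⟩ := e.cost_le
    exact ⟨A + 2, 1, fun n => by simp only [cost]; nlinarith [hA n]⟩
  | store a b =>
    obtain ⟨A, hA⟩ := a.cost_le
    obtain ⟨B, hB⟩ := b.cost_le
    exact ⟨A + B + 1, 1, fun n => by simp only [cost]; nlinarith [hA n, hB n]⟩
  | seq p q ihp ihq =>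
    obtain ⟨A, D, hA⟩ := ihp
    obtain ⟨B, E, hB⟩ := ihq
    refine ⟨A + B, D + E, fun n => ?_⟩
    simp only [cost]
    nlinarith [hA n, hB n, Nat.mul_le_mul_left A (mono D (D + E) n (by omega)),
      Nat.mul_le_mul_left B (mono E (D + E) n (by omega))]
  | ite e p q ihp ihq =>
    obtain ⟨A, D, hA⟩ := ihp
    obtain ⟨B, E, hB⟩ := ihq
    obtain ⟨F, hF⟩ := e.cost_le
    refine ⟨A + B + F + 1, D + E + 1, fun n => ?_⟩
    have h1 := mono 1 (D + E + 1) n (by omega)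
    rw [pow_one] at h1
    simp only [cost]
    nlinarith [hA n, hB n, hF n, Nat.mul_le_mul_left A (mono D (D + E + 1) n (by omega)),
      Nat.mul_le_mul_left B (mono E (D + E + 1) n (by omega)), Nat.mul_le_mul_left F h1,
      one (D + E + 1) n]
  | forN x p ihp =>
    obtain ⟨A, D, hA⟩ := ihp
    refine ⟨A + 7, D + 1, fun n => ?_⟩
    have h1 := Nat.mul_le_mul_left n (hA n)
    have h2 := mono 1 (D + 1) n (by omega)
    rw [pow_one] at h2
    have h3 : (n + 1) ^ (D + 1) = n * (n + 1) ^ D + (n + 1) ^ D := by ring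
    have h4 := one D n
    have h5 : n * (A * (n + 1) ^ D) ≤ A * (n + 1) ^ (D + 1) := by rw [h3]; nlinarith
    simp only [cost]
    nlinarith

/-! ### Reasoning about the loop language -/

/-- `p.writes r` says that the variable `r` may be changed by `p`. -/
def LoopProg.writes : LoopProg → ℕ → Bool
  | skip, _ => false
  | set x _, r => r == x
  | store _ _, _ => false
  | seq p q, r => p.writes r || q.writes r
  | ite _ p q, r => p.writes r || q.writes r
  | forN x p, r => r == x || p.writes r

lemma LoopProg.run_reg {n : ℕ} {r : ℕ} : ∀ {p : LoopProg}, p.writes r = false →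
    ∀ h, (p.run n h).reg r = h.reg r
  | skip, _, h => rfl
  | set x e, hw, h => by
      have : r ≠ x := by simpa [writes] using hw
      simp [run, this]
  | store a b, _, h => rfl
  | seq p q, hw, h => by
      have : p.writes r = false ∧ q.writes r = false := by simpa [writes] using hw
      simp [run, run_reg this.1, run_reg this.2]
  | ite e p q, hw, h => by
      have : p.writes r = false ∧ q.writes r = false := by simpa [writes] using hw
      simp only [run]
      split_ifs
      exacts [run_reg this.1 h, run_reg this.2 h]
  | forN x p, hw, h => by
      have : r ≠ x ∧ p.writes r = false := by simpa [writes] using hw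
      have key : ∀ i, (loopUpTo (fun i h' => p.run n (h'.setReg x i)) i h).reg r = h.reg r := by
        intro i
        induction i with
        | zero => rfl
        | succ i ih => simp only [loopUpTo]; rw [run_reg this.2]; simp [this.1, ih]
      exact key n

/-- The invariant rule for loops. Variables that the loop does not write keep their values, and this
does not have to be part of the invariant. -/
lemma LoopProg.run_forN {n x : ℕ} {p : LoopProg} {h : RamState} (I : ℕ → RamState → Prop)
    (h0 : I 0 h)
    (step : ∀ (i : Fin n) (h' : RamState),
      (∀ r, (forN x p).writes r = false → h'.reg r = h.reg r) → I i h' →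
      I (i + 1) (p.run n (h'.setReg x i))) :
    I n ((forN x p).run n h) := by
  have key : ∀ i ≤ n, I i (loopUpTo (fun i h' => p.run n (h'.setReg x i)) i h) ∧
      ∀ r, (forN x p).writes r = false →
        (loopUpTo (fun i h' => p.run n (h'.setReg x i)) i h).reg r = h.reg r := by
    intro i
    induction i with
    | zero => exact fun _ => ⟨h0, fun _ _ => rfl⟩
    | succ i ih =>
      intro hi
      obtain ⟨h1, h2⟩ := ih (by omega)
      refine ⟨step ⟨i, by omega⟩ _ h2 h1, fun r hr => ?_⟩
      have : r ≠ x ∧ p.writes r = false := by simpa [writes] using hr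
      simp only [loopUpTo]
      rw [run_reg this.2]
      simp [this.1, h2 r hr]
  exact (key n le_rfl).1

/-- A `while`-loop around a compiled program runs as long as its variable `x` is nonzero. -/
lemma LoopProg.ramRuns_while (n x : ℕ) (p : LoopProg) : ∀ (J : ℕ) (s h : RamState),
    Represents n s h → (∃ j ≤ J, ((p.run n)^[j] h).reg x = 0) →
    ∃ s' t j, RamRuns (.while (2 * x + 2) (p.compile 0)) s s' t ∧
      t ≤ J * (p.cost n + 1) + 1 ∧ Represents n s' ((p.run n)^[j] h) ∧
      ((p.run n)^[j] h).reg x = 0 := by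
  intro J
  induction J with
  | zero =>
    rintro s h H ⟨j, hj, h0⟩
    obtain rfl : j = 0 := by omega
    exact ⟨s, 1, 0, .whileStop ((H.var x).trans h0), by simp, H, h0⟩
  | succ J ih =>
    rintro s h H ⟨j, hj, h0⟩
    by_cases hx : h.reg x = 0
    · exact ⟨s, 1, 0, .whileStop ((H.var x).trans hx), by simp, H, hx⟩
    · obtain ⟨s₁, t₁, r₁, l₁, H₁, -⟩ := p.ramRuns_compile n 0 s h H
      cases j with
      | zero => exact absurd h0 hx
      | succ j =>
        obtain ⟨s₂, t₂, i, r₂, l₂, H₂, z₂⟩ := ih s₁ _ H₁ ⟨j, by omega, h0⟩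
        refine ⟨s₂, _, i + 1, .whileStep (by rwa [H.var]) r₁ r₂, ?_, H₂, z₂⟩
        nlinarith

/-! ### Components and the branching depth of a vertex set -/

open Classical in
/-- The vertex `x` together with its neighbours. -/
noncomputable def closedNbhd {V : Type*} [Fintype V] (G : SimpleGraph V) (x : V) : Finset V :=
  {u | u = x ∨ G.Adj x u}

@[simp] lemma mem_closedNbhd {V : Type*} [Fintype V] {G : SimpleGraph V} {x u : V} :
    u ∈ closedNbhd G x ↔ u = x ∨ G.Adj x u := by
  simp [closedNbhd]

open Classical in
/-- The vertices that can be reached from `v` by a path whose vertices after `v` lie in `W`. For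
`v ∈ W` this is the connected component of `v` in the graph induced on `W`. -/
noncomputable def component {V : Type*} [Fintype V] (G : SimpleGraph V) (W : Finset V) (v : V) :
    Finset V :=
  {u | Relation.ReflTransGen (fun a b => G.Adj a b ∧ b ∈ W) v u}

/-- `K` is a union of connected components of the graph induced on `W`. -/
structure IsSeparatedIn {V : Type*} (G : SimpleGraph V) (K W : Finset V) : Prop where
  subset : K ⊆ W
  mem_of_adj : ∀ a ∈ K, ∀ b ∈ W, G.Adj a b → b ∈ K

section component

variable {V : Type*} [Fintype V] {G : SimpleGraph V} {W K : Finset V} {v : V}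

lemma mem_component_self : v ∈ component G W v := by
  simpa [component] using Relation.ReflTransGen.refl

lemma mem_component_of_adj {a b : V} (ha : a ∈ component G W v) (hb : b ∈ W) (h : G.Adj a b) :
    b ∈ component G W v := by
  simp only [component, Finset.mem_filter, Finset.mem_univ, true_and] at ha ⊢
  exact ha.tail ⟨h, hb⟩

/-- Induction over a component along the edges. -/
lemma component_induction {P : V → Prop} (h0 : P v)
    (step : ∀ a b, a ∈ component G W v → P a → b ∈ W → G.Adj a b → P b) :
    ∀ u ∈ component G W v, P u := by
  intro u hu
  simp only [component, Finset.mem_filter, Finset.mem_univ, true_and] at hu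
  induction hu with
  | refl => exact h0
  | tail hab hbc ih => exact step _ _ (by simpa [component] using hab) ih hbc.2 hbc.1

lemma component_subset (hv : v ∈ W) : component G W v ⊆ W :=
  fun u hu => component_induction (P := (· ∈ W)) hv (fun _ _ _ _ hb _ => hb) u hu

lemma component_isSeparatedIn (hv : v ∈ W) : IsSeparatedIn G (component G W v) W :=
  ⟨component_subset hv, fun _ ha _ hb h => mem_component_of_adj ha hb h⟩

lemma IsSeparatedIn.component_subset (hK : IsSeparatedIn G K W) (hv : v ∈ K) :
    component G W v ⊆ K :=
  fun u hu => component_induction (P := (· ∈ K)) hv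
    (fun a b _ ha hb h => hK.mem_of_adj a ha b hb h) u hu

lemma IsSeparatedIn.component_eq (hK : IsSeparatedIn G K W) (hv : v ∈ K) :
    component G K v = component G W v := by
  apply Finset.Subset.antisymm
  · exact fun u hu => component_induction (P := (· ∈ component G W v)) mem_component_self
      (fun a b _ ha hb h => mem_component_of_adj ha (hK.subset hb) h) u hu
  · refine fun u hu => component_induction (P := (· ∈ component G K v)) mem_component_self
      (fun a b ha' ha hb h => mem_component_of_adj ha ?_ h) u hu
    exact hK.mem_of_adj a (hK.component_subset hv ha') b hb h

lemma component_component (hv : v ∈ W) :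
    component G (component G W v) v = component G W v :=
  (component_isSeparatedIn hv).component_eq mem_component_self

end component

/-- `Resolvable G s W` says that a branching of depth `s` determines a maximum independent set of
the graph induced on `W`: in every component there is a vertex `y` such that for all members `x` of
the closed neighbourhood of `y` (one of which belongs to a maximum independent set) the rest of the
component, after the deletion of the closed neighbourhood of `x`, is resolvable with depth
`s - 1`. -/
def Resolvable {V : Type*} [Fintype V] [DecidableEq V] (G : SimpleGraph V) : ℕ → Finset V → Prop
  | 0, W => W = ∅
  | s + 1, W => ∀ v ∈ W, ∃ y ∈ component G W v, ∀ x ∈ component G W v, x ∈ closedNbhd G y →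
      Resolvable G s (component G W v \ closedNbhd G x)

section Resolvable

variable {V : Type*} [Fintype V] [DecidableEq V] {G : SimpleGraph V}

lemma Resolvable.succ : ∀ {s : ℕ} {W : Finset V}, Resolvable G s W → Resolvable G (s + 1) W
  | 0, W, h => by
      have h' : W = ∅ := h
      subst h'
      intro v hv
      simp at hv
  | s + 1, W, h => fun v hv => by
      obtain ⟨y, hy, hxy⟩ := h v hv
      exact ⟨y, hy, fun x hx hx' => (hxy x hx hx').succ⟩

lemma Resolvable.mono {s t : ℕ} {W : Finset V} (h : Resolvable G s W) (hst : s ≤ t) :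
    Resolvable G t W := by
  induction hst with
  | refl => exact h
  | step _ ih => exact ih.succ

/-- Branching along a separator `X`: as long as the component under consideration meets `X`, branch
at a vertex of `X`. The vertices chosen along a branch form an independent set in the closed
neighbourhood of `X`, which lies in `S`; so the separator is used up after `t` steps. -/
lemma resolvable_of_separator {U₀ X S : Finset V} {s : ℕ}
    (hs : ∀ K ⊆ U₀, Disjoint K X → (∃ v ∈ K, component G K v = K) → Resolvable G s K)
    (hS : ∀ y ∈ X, ∀ x ∈ U₀, x ∈ closedNbhd G y → x ∈ S) :
    ∀ (t : ℕ) (U : Finset V), U ⊆ U₀ →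
      (∀ I ⊆ U ∩ S, G.IsIndepSet (I : Set V) → I.card ≤ t) → Resolvable G (s + t) U := by
  have away : ∀ (t : ℕ) (U : Finset V), U ⊆ U₀ → ∀ v ∈ U, Disjoint (component G U v) X →
      ∃ y ∈ component G U v, ∀ x ∈ component G U v, x ∈ closedNbhd G y →
        ∃ r, s + t = r + 1 ∧ Resolvable G r (component G U v \ closedNbhd G x) := by
    intro t U hU v hv hd
    have h := (hs _ ((component_subset hv).trans hU) hd
      ⟨v, mem_component_self, component_component hv⟩).mono (Nat.le_add_right s t)
    cases hst : s + t with
    | zero =>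
      rw [hst] at h
      have h' : component G U v = ∅ := h
      exact absurd (h' ▸ mem_component_self (G := G) (W := U) (v := v)) (by simp)
    | succ r =>
      rw [hst] at h
      obtain ⟨y, hy, hxy⟩ := h v mem_component_self
      rw [component_component hv] at hy hxy
      exact ⟨y, hy, fun x hx hx' => ⟨r, rfl, hxy x hx hx'⟩⟩
  intro t
  induction t with
  | zero =>
    intro U hU hI
    have hd : ∀ v ∈ U, Disjoint (component G U v) X := by
      intro v hv
      rw [Finset.disjoint_left]
      intro y hy hyX
      have hyU := component_subset hv hy
      have := hI {y} (by simpa using ⟨hyU, hS y hyX y (hU hyU) (by simp)⟩) (by simp)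
      simp at this
    cases s with
    | zero =>
      refine Finset.eq_empty_of_forall_notMem fun v hv => ?_
      obtain ⟨y, hy, hxy⟩ := away 0 U hU v hv (hd v hv)
      obtain ⟨r, hr, -⟩ := hxy y hy (by simp)
      omega
    | succ s =>
      intro v hv
      obtain ⟨y, hy, hxy⟩ := away 0 U hU v hv (hd v hv)
      refine ⟨y, hy, fun x hx hx' => ?_⟩
      obtain ⟨r, hr, h⟩ := hxy x hx hx'
      obtain rfl : r = s := by omega
      exact h
  | succ t ih =>
    intro U hU hI v hv
    by_cases hd : Disjoint (component G U v) X
    · obtain ⟨y, hy, hxy⟩ := away (t + 1) U hU v hv hd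
      refine ⟨y, hy, fun x hx hx' => ?_⟩
      obtain ⟨r, hr, h⟩ := hxy x hx hx'
      obtain rfl : r = s + t := by omega
      exact h
    · obtain ⟨y, hy, hyX⟩ := Finset.not_disjoint_iff.1 hd
      have hKU := component_subset (G := G) hv
      refine ⟨y, hy, fun x hx hx' => ih _ ((Finset.sdiff_subset.trans hKU).trans hU) ?_⟩
      intro I hIs hind
      have hxI : x ∉ I := fun h => by
        have := hIs h
        simp at this
      have key := hI (insert x I) ?_ ?_
      · rw [Finset.card_insert_of_notMem hxI] at key
        omega
      · intro z hz
        rcases Finset.mem_insert.1 hz with rfl | hz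
        · exact Finset.mem_inter.2 ⟨hKU hx, hS y hyX z (hU (hKU hx)) hx'⟩
        · have := Finset.mem_inter.1 (hIs hz)
          exact Finset.mem_inter.2 ⟨hKU (Finset.mem_sdiff.1 this.1).1, this.2⟩
      · rw [Finset.coe_insert]
        have hz (z : V) (hz : z ∈ I) : ¬ G.Adj x z := fun h =>
          (Finset.mem_sdiff.1 (Finset.mem_inter.1 (hIs hz)).1).2 (by simp [h])
        exact Set.pairwise_insert.2 ⟨hind, fun z hzI _ => ⟨hz z hzI, fun h => hz z hzI h.symm⟩⟩

lemma resolvable_of_card_le {U : Finset V} {k : ℕ}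
    (h : ∀ I ⊆ U, G.IsIndepSet (I : Set V) → I.card ≤ k) : Resolvable G k U := by
  have := resolvable_of_separator (G := G) (U₀ := U) (X := U) (S := U) (s := 0) ?_
    (fun _ _ x hx _ => hx) k U subset_rfl (by simpa using h)
  · simpa using this
  · rintro K hK hd ⟨v, hv, -⟩
    exact absurd (hK hv) (Finset.disjoint_left.1 hd hv)

end Resolvable

/-! ### Partial solutions of the subproblems -/

/-- `σ` is a correct partial solution for the subproblem on the vertex set `W`: the value `0` marks
the vertices of components that are not solved yet, and on the other components the value `2` marks a
maximum independent set; all other vertices, in particular those outside of `W`, have the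
value `1`. -/
structure IsPartialSolution {V : Type*} [Fintype V] (G : SimpleGraph V) (W : Finset V)
    (σ : V → ℕ) : Prop where
  le_two : ∀ u, σ u ≤ 2
  eq_one : ∀ u ∉ W, σ u = 1
  ne_zero_of_adj : ∀ a ∈ W, ∀ b ∈ W, G.Adj a b → σ a ≠ 0 → σ b ≠ 0
  not_adj : ∀ a b, σ a = 2 → σ b = 2 → ¬ G.Adj a b
  card_le : ∀ I : Finset V, G.IsIndepSet (I : Set V) → (∀ a ∈ I, a ∈ W ∧ σ a ≠ 0) →
    I.card ≤ (Finset.univ.filter fun u => σ u = 2).card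

section IsPartialSolution

variable {V : Type*} [Fintype V] [DecidableEq V] {G : SimpleGraph V} {W K : Finset V} {σ : V → ℕ}

/-- The chosen vertices are optimal on every union of solved components. -/
lemma IsPartialSolution.card_le_on (h : IsPartialSolution G W σ) (hK : IsSeparatedIn G K W)
    (hσ : ∀ u ∈ K, σ u ≠ 0) {I : Finset V} (hI : G.IsIndepSet (I : Set V)) (hIK : I ⊆ K) :
    I.card ≤ (K.filter fun u => σ u = 2).card := by
  set O := Finset.univ.filter fun u => σ u = 2 with hO
  have hOW : ∀ u ∈ O, u ∈ W := fun u hu => by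
    by_contra hu'
    have := h.eq_one u hu'
    simp [hO, this] at hu
  have hind : G.IsIndepSet ((O \ K ∪ I : Finset V) : Set V) := by
    intro a ha b hb hne hab
    simp only [Finset.coe_union, Set.mem_union, Finset.mem_coe, Finset.mem_sdiff] at ha hb
    rcases ha with ha | ha <;> rcases hb with hb | hb
    · exact h.not_adj a b (by simpa [hO] using ha.1) (by simpa [hO] using hb.1) hab
    · exact ha.2 (hK.mem_of_adj b (hIK hb) a (hOW a ha.1) hab.symm)
    · exact hb.2 (hK.mem_of_adj a (hIK ha) b (hOW b hb.1) hab)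
    · exact hI ha hb hne hab
  have h1 := h.card_le _ hind fun a ha => by
    rcases Finset.mem_union.1 ha with ha | ha
    · have : σ a = 2 := by simpa [hO] using (Finset.mem_sdiff.1 ha).1
      exact ⟨hOW a (Finset.mem_sdiff.1 ha).1, by omega⟩
    · exact ⟨hK.subset (hIK ha), hσ a (hIK ha)⟩
  have hd : Disjoint (O \ K) I :=
    Finset.disjoint_left.2 fun a ha ha' => (Finset.mem_sdiff.1 ha).2 (hIK ha')
  have h2 : (O \ K).card + (O ∩ K).card = O.card := Finset.card_sdiff_add_card_inter O K
  have h3 : O ∩ K = K.filter fun u => σ u = 2 := by ext; simp [hO, and_comm]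
  rw [Finset.card_union_of_disjoint hd, ← hO] at h1
  rw [← h3]
  omega

/-- The solution of a union `K` of components from the solutions of the branches at `y`. -/
lemma IsPartialSolution.update (h : IsPartialSolution G W σ) (hK : IsSeparatedIn G K W)
    {τ : V → V → ℕ} (hτ : ∀ x, IsPartialSolution G (W \ closedNbhd G x) (τ x)) {x₀ y : V}
    (hy : y ∈ K) (hx₀ : x₀ ∈ K)
    (hok : ∀ x ∈ K, x ∈ closedNbhd G y → ∀ u ∈ K, τ x u ≠ 0)
    (hx₀y : x₀ ∈ closedNbhd G y)
    (hmax : ∀ x ∈ K, x ∈ closedNbhd G y →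
      (K.filter fun u => τ x u = 2).card ≤ (K.filter fun u => τ x₀ u = 2).card) :
    IsPartialSolution G W
      (fun u => if u ∈ K then (if u = x₀ then 2 else τ x₀ u) else σ u) := by
  set σ' : V → ℕ := fun u => if u ∈ K then (if u = x₀ then 2 else τ x₀ u) else σ u with hσ'
  have out (u : V) (hu : u ∉ K) : σ' u = σ u := by simp [hσ', hu]
  have sel : σ' x₀ = 2 := by simp [hσ', hx₀]
  have ins (u : V) (hu : u ∈ K) (hne : u ≠ x₀) : σ' u = τ x₀ u := by simp [hσ', hu, hne]
  have nz (u : V) (hu : u ∈ K) : σ' u ≠ 0 := by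
    by_cases hne : u = x₀
    · rw [hne, sel]; norm_num
    · rw [ins u hu hne]; exact hok x₀ hx₀ hx₀y u hu
  have memW (u : V) (hu : σ' u = 2) : u ∈ W := by
    by_contra huW
    have huK : u ∉ K := fun hh => huW (hK.subset hh)
    rw [out u huK, h.eq_one u huW] at hu
    omega
  -- A neighbour of `x₀` is not chosen in the branch of `x₀`.
  have nbr (b : V) (hb : τ x₀ b = 2) : ¬ G.Adj x₀ b := fun hab => by
    have := (hτ x₀).eq_one b (by simp [hab])
    omega
  have sepB (x : V) : IsSeparatedIn G (K \ closedNbhd G x) (W \ closedNbhd G x) := by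
    refine ⟨Finset.sdiff_subset_sdiff hK.subset subset_rfl, fun a ha b hb hab => ?_⟩
    rw [Finset.mem_sdiff] at ha hb ⊢
    exact ⟨hK.mem_of_adj a ha.1 b hb.1 hab, hb.2⟩
  refine ⟨fun u => ?_, fun u hu => ?_, fun a ha b hb hab hσa => ?_, ?_, fun I hI hIσ => ?_⟩
  · by_cases hu : u ∈ K
    · by_cases hne : u = x₀
      · rw [hne, sel]
      · rw [ins u hu hne]; exact (hτ x₀).le_two u
    · rw [out u hu]; exact h.le_two u
  · rw [out u fun hh => hu (hK.subset hh)]; exact h.eq_one u hu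
  · by_cases hbK : b ∈ K
    · exact nz b hbK
    · have haK : a ∉ K := fun hh => hbK (hK.mem_of_adj a hh b hb hab)
      rw [out a haK] at hσa
      rw [out b hbK]
      exact h.ne_zero_of_adj a ha b hb hab hσa
  · intro a b ha hb hab
    have haW := memW a ha
    have hbW := memW b hb
    by_cases haK : a ∈ K
    · have hbK := hK.mem_of_adj a haK b hbW hab
      by_cases hax : a = x₀
      · subst hax
        exact nbr b (by rw [← ins b hbK hab.ne', hb]) hab
      · by_cases hbx : b = x₀
        · subst hbx
          exact nbr a (by rw [← ins a haK hax, ha]) hab.symm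
        · rw [ins a haK hax] at ha
          rw [ins b hbK hbx] at hb
          exact (hτ x₀).not_adj a b ha hb hab
    · have hbK : b ∉ K := fun hh => haK (hK.mem_of_adj b hh a haW hab.symm)
      rw [out a haK] at ha
      rw [out b hbK] at hb
      exact h.not_adj a b ha hb hab
  · have subInd {J J' : Finset V} (hJ : G.IsIndepSet (J : Set V)) (hs : J' ⊆ J) :
        G.IsIndepSet (J' : Set V) := Set.Pairwise.mono (Finset.coe_subset.2 hs) hJ
    -- Outside of `K` nothing has changed.
    have h1 : (I \ K).card ≤ ((Finset.univ \ K).filter fun u => σ u = 2).card := by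
      set F := (W \ K).filter fun u => σ u ≠ 0 with hF
      have hsep : IsSeparatedIn G F W := by
        refine ⟨fun u hu => ?_, fun a ha b hb hab => ?_⟩
        · simp only [hF, Finset.mem_filter, Finset.mem_sdiff] at hu
          exact hu.1.1
        · simp only [hF, Finset.mem_filter, Finset.mem_sdiff] at ha ⊢
          exact ⟨⟨hb, fun hh => ha.1.2 (hK.mem_of_adj b hh a ha.1.1 hab.symm)⟩,
            h.ne_zero_of_adj a ha.1.1 b hb hab ha.2⟩
      refine (h.card_le_on hsep (fun u hu => (Finset.mem_filter.1 hu).2)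
        (subInd hI Finset.sdiff_subset) fun u hu => ?_).trans (Finset.card_le_card fun u hu => ?_)
      · rw [Finset.mem_sdiff] at hu
        have := hIσ u hu.1
        rw [out u hu.2] at this
        simp [hF, hu.2, this]
      · simp only [hF, Finset.mem_filter, Finset.mem_sdiff, Finset.mem_univ, true_and] at hu ⊢
        exact ⟨hu.1.1.2, hu.2⟩
    -- An independent set that misses the closed neighbourhood of `y` is no larger than the
    -- selection of the branch of `y`; otherwise it loses one vertex in a branch `x`.
    have h2 : (I ∩ K).card ≤ (K.filter fun u => τ x₀ u = 2).card + 1 := by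
      have branch (x : V) (hx : x ∈ K) (hxy : x ∈ closedNbhd G y) (J : Finset V)
          (hJ : G.IsIndepSet (J : Set V)) (hJK : J ⊆ K \ closedNbhd G x) :
          J.card ≤ (K.filter fun u => τ x₀ u = 2).card := by
        refine (((hτ x).card_le_on (sepB x) (fun u hu => ?_) hJ hJK).trans
          (Finset.card_le_card fun u hu => ?_)).trans (hmax x hx hxy)
        · exact hok x hx hxy u (Finset.mem_sdiff.1 hu).1
        · simp only [Finset.mem_filter, Finset.mem_sdiff] at hu ⊢
          exact ⟨hu.1.1, hu.2⟩
      by_cases hex : ∃ x ∈ I ∩ K, x ∈ closedNbhd G y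
      · obtain ⟨x, hx, hxy⟩ := hex
        have := branch x (Finset.mem_inter.1 hx).2 hxy ((I ∩ K).erase x)
          (subInd hI ((Finset.erase_subset _ _).trans Finset.inter_subset_left)) fun u hu => by
            have hu' := Finset.mem_inter.1 (Finset.mem_of_mem_erase hu)
            have hne := Finset.ne_of_mem_erase hu
            simp only [Finset.mem_sdiff, mem_closedNbhd, not_or]
            exact ⟨hu'.2, hne, hI (Finset.mem_inter.1 hx).1 hu'.1 hne.symm⟩
        rw [Finset.card_erase_of_mem hx] at this
        omega
      · push Not at hex
        have := branch y hy (by simp) (I ∩ K) (subInd hI Finset.inter_subset_left)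
          fun u hu => Finset.mem_sdiff.2 ⟨(Finset.mem_inter.1 hu).2, hex u hu⟩
        omega
    have h3 : (K.filter fun u => τ x₀ u = 2).card + 1 ≤ (K.filter fun u => σ' u = 2).card := by
      have hx : x₀ ∉ K.filter fun u => τ x₀ u = 2 := fun hh => by
        have := (hτ x₀).eq_one x₀ (by simp)
        simp [this] at hh
      rw [← Finset.card_insert_of_notMem hx]
      refine Finset.card_le_card fun u hu => ?_
      rcases Finset.mem_insert.1 hu with rfl | hu
      · simp [hx₀, sel]
      · rw [Finset.mem_filter] at hu ⊢
        refine ⟨hu.1, ?_⟩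
        by_cases hne : u = x₀
        · rw [hne, sel]
        · rw [ins u hu.1 hne, hu.2]
    have h4 : (Finset.univ.filter fun u => σ' u = 2).card =
        (K.filter fun u => σ' u = 2).card +
          ((Finset.univ \ K).filter fun u => σ u = 2).card := by
      rw [← Finset.card_union_of_disjoint]
      · congr 1
        ext u
        by_cases hu : u ∈ K
        · simp [hu]
        · simp [hu, out u hu]
      · refine Finset.disjoint_left.2 fun u hu hu' => ?_
        simp only [Finset.mem_filter, Finset.mem_sdiff] at hu hu'
        exact hu'.1.2 hu.1
    have h5 : (I \ K).card + (I ∩ K).card = I.card := Finset.card_sdiff_add_card_inter I K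
    omega

end IsPartialSolution

/-! ### Separators for graphs with short edges -/

/-- A cube is covered by `m ^ d` cubes that are smaller by the factor `m`. -/
lemma card_filter_dist_le {V : Type*} {d : ℕ} (p : V → Fin d → ℝ) (S : Finset V) {m : ℕ}
    (hm : 0 < m) {R b : ℝ} (hR : 0 < R)
    (hb : ∀ c, ((S.filter fun i => dist (p i) c ≤ R / m).card : ℝ) ≤ b) (c : Fin d → ℝ) :
    ((S.filter fun i => dist (p i) c ≤ R).card : ℝ) ≤ (m : ℝ) ^ d * b := by
  classical
  have hm' : (0 : ℝ) < m := by exact_mod_cast hm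
  set ctr : (Fin d → Fin m) → Fin d → ℝ := fun f j => c j + R * (2 * (f j : ℕ) + 1 - m) / m with hctr
  have hsub : (S.filter fun i => dist (p i) c ≤ R) ⊆
      Finset.univ.biUnion fun f => S.filter fun i => dist (p i) (ctr f) ≤ R / m := by
    intro i hi
    rw [Finset.mem_filter] at hi
    rw [dist_pi_le_iff hR.le] at hi
    have key : ∀ j, ∃ f : Fin m, dist (p i j) (c j + R * (2 * (f : ℕ) + 1 - m) / m) ≤ R / m := by
      intro j
      have h := abs_le.1 (hi.2 j)
      set t : ℝ := (p i j - c j + R) * m / (2 * R) with ht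
      have ht0 : 0 ≤ t := by
        apply div_nonneg (mul_nonneg (by linarith [h.1]) hm'.le) (by positivity)
      have htm : t ≤ m := by
        rw [ht, div_le_iff₀ (by positivity)]
        nlinarith [h.2]
      have hp : p i j = c j - R + 2 * R * t / m := by rw [ht]; field_simp; ring
      obtain ⟨f, hf1, hf2⟩ : ∃ f : Fin m, ((f : ℕ) : ℝ) ≤ t ∧ t ≤ (f : ℕ) + 1 := by
        by_cases hlt : ⌊t⌋₊ < m
        · exact ⟨⟨⌊t⌋₊, hlt⟩, Nat.floor_le ht0, (Nat.lt_floor_add_one t).le⟩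
        · refine ⟨⟨m - 1, by omega⟩, ?_, ?_⟩
          · have h1 : (m : ℝ) ≤ t := (Nat.le_floor_iff ht0).1 (not_lt.1 hlt)
            have h2 : ((m - 1 : ℕ) : ℝ) ≤ m := by exact_mod_cast Nat.sub_le m 1
            exact h2.trans h1
          · have h2 : ((m - 1 : ℕ) : ℝ) + 1 = m := by exact_mod_cast Nat.sub_add_cancel hm
            simpa [h2] using htm
      refine ⟨f, ?_⟩
      have e : p i j - (c j + R * (2 * (f : ℕ) + 1 - m) / m) = R / m * (2 * t - 2 * (f : ℕ) - 1) := by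
        rw [hp]; field_simp; ring
      rw [Real.dist_eq, e, abs_mul, abs_of_pos (by positivity : 0 < R / m)]
      have : |2 * t - 2 * ((f : ℕ) : ℝ) - 1| ≤ 1 := abs_le.2 ⟨by linarith, by linarith⟩
      have hpos : 0 < R / m := by positivity
      nlinarith
    choose f hf using key
    refine Finset.mem_biUnion.2 ⟨f, Finset.mem_univ _, Finset.mem_filter.2 ⟨hi.1, ?_⟩⟩
    rw [dist_pi_le_iff (by positivity)]
    exact hf
  calc ((S.filter fun i => dist (p i) c ≤ R).card : ℝ)
      ≤ ((Finset.univ.biUnion fun f => S.filter fun i => dist (p i) (ctr f) ≤ R / m).card : ℝ) := by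
        exact_mod_cast Finset.card_le_card hsub
    _ ≤ ∑ f : Fin d → Fin m, ((S.filter fun i => dist (p i) (ctr f) ≤ R / m).card : ℝ) := by
        exact_mod_cast Finset.card_biUnion_le
    _ ≤ ∑ _f : Fin d → Fin m, b := Finset.sum_le_sum fun f _ => hb _
    _ = (m : ℝ) ^ d * b := by simp

lemma isIndepSet_union {V : Type*} [DecidableEq V] {G : SimpleGraph V} {I J : Finset V}
    (hI : G.IsIndepSet (I : Set V)) (hJ : G.IsIndepSet (J : Set V))
    (h : ∀ a ∈ I, ∀ b ∈ J, ¬ G.Adj a b) : G.IsIndepSet ((I ∪ J : Finset V) : Set V) := by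
  intro a ha b hb hne hab
  simp only [Finset.coe_union, Set.mem_union, Finset.mem_coe] at ha hb
  rcases ha with ha | ha <;> rcases hb with hb | hb
  · exact hI ha hb hne hab
  · exact h a ha b hb hab
  · exact h b hb a ha hab.symm
  · exact hJ ha hb hne hab

/-- Among many pairwise nonadjacent vertex sets, one has a small independence number. -/
lemma exists_card_le_div {V : Type*} [DecidableEq V] {G : SimpleGraph V} {U : Finset V} {k q : ℕ}
    (hk : ∀ I ⊆ U, G.IsIndepSet (I : Set V) → I.card ≤ k) (hq : 0 < q) (Sh : ℕ → Finset V)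
    (hU : ∀ j, Sh j ⊆ U) (hd : ∀ i j, i < j → Disjoint (Sh i) (Sh j))
    (hadj : ∀ i j, i < j → ∀ a ∈ Sh i, ∀ b ∈ Sh j, ¬ G.Adj a b) :
    ∃ j < q, ∀ I ⊆ Sh j, G.IsIndepSet (I : Set V) → I.card ≤ k / q := by
  by_contra hcon
  push Not at hcon
  have h : ∀ j, ∃ I ⊆ Sh j, G.IsIndepSet (I : Set V) ∧ (j < q → k / q < I.card) := by
    intro j
    by_cases hj : j < q
    · obtain ⟨I, h1, h2, h3⟩ := hcon j hj
      exact ⟨I, h1, h2, fun _ => h3⟩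
    · exact ⟨∅, by simp, by simp, fun hh => absurd hh hj⟩
  choose I hIs hI hIc using h
  have key : ∀ m ≤ q, ∃ J ⊆ U, G.IsIndepSet (J : Set V) ∧ m * (k / q + 1) ≤ J.card ∧
      ∀ a ∈ J, ∃ i < m, a ∈ Sh i := by
    intro m
    induction m with
    | zero => exact fun _ => ⟨∅, by simp, by simp, by simp, by simp⟩
    | succ m ih =>
      intro hm
      obtain ⟨J, hJU, hJ, hJc, hJs⟩ := ih (by omega)
      refine ⟨J ∪ I m, Finset.union_subset hJU ((hIs m).trans (hU m)),
        isIndepSet_union hJ (hI m) fun a ha b hb => ?_, ?_, fun a ha => ?_⟩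
      · obtain ⟨i, hi, hai⟩ := hJs a ha
        exact hadj i m hi a hai b (hIs m hb)
      · rw [Finset.card_union_of_disjoint]
        · have := hIc m (by omega)
          nlinarith
        · refine Finset.disjoint_left.2 fun a ha hb => ?_
          obtain ⟨i, hi, hai⟩ := hJs a ha
          exact Finset.disjoint_left.1 (hd i m hi) hai (hIs m hb)
      · rcases Finset.mem_union.1 ha with ha | ha
        · obtain ⟨i, hi, hai⟩ := hJs a ha
          exact ⟨i, by omega, hai⟩
        · exact ⟨m, by omega, hIs m ha⟩
  obtain ⟨J, hJU, hJ, hJc, -⟩ := key q le_rfl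
  have h1 := hk J hJU hJ
  have h2 := Nat.lt_mul_div_succ k hq
  omega

section separator

variable {V : Type*} {G : SimpleGraph V} {d h : ℕ} {p : V → Fin d → ℝ} {B α : ℝ}

/-- A cube of radius `r` around sufficiently many points of an independent set is large. -/
lemma rpow_le_of_card_le (hd : 1 ≤ d) (hh : 1 ≤ h) (hB : 1 ≤ B) (hα : 1 ≤ α)
    (hdens : ∀ (c : Fin d → ℝ) (I : Finset V), G.IsIndepSet (I : Set V) →
      (∀ i ∈ I, dist (p i) c ≤ 1 / h) → (I.card : ℝ) ≤ B * α ^ d)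
    {S : Finset V} (hS : G.IsIndepSet (S : Set V)) {l k r : ℕ} (hl : 1 ≤ l) (hr : 1 ≤ r)
    {c : Fin d → ℝ} (hk : k ≤ l * (S.filter fun i => dist (p i) c ≤ r).card) :
    (k : ℝ) ^ (1 / (d : ℝ)) ≤ l * h * B * α * r := by
  have hh0 : (0 : ℝ) < h := by exact_mod_cast hh
  have hr0 : (0 : ℝ) < r := by exact_mod_cast hr
  have hl1 : (1 : ℝ) ≤ l := by exact_mod_cast hl
  have h1 : ((S.filter fun i => dist (p i) c ≤ r).card : ℝ) ≤
      ((r * h : ℕ) : ℝ) ^ d * (B * α ^ d) := by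
    refine card_filter_dist_le p S (Nat.mul_pos hr hh) hr0 (fun c => ?_) c
    refine hdens c _ (Set.Pairwise.mono (fun i hi => ?_) hS) fun i hi => ?_
    · exact (Finset.mem_filter.1 hi).1
    · have := (Finset.mem_filter.1 hi).2
      push_cast at this
      rwa [div_mul_cancel_left₀ hr0.ne', ← one_div] at this
  have h2 : (k : ℝ) ≤ (l * h * B * α * r) ^ d := by
    have hk' : (k : ℝ) ≤ l * (S.filter fun i => dist (p i) c ≤ r).card := by exact_mod_cast hk
    refine hk'.trans ?_
    have hld : (l : ℝ) ≤ l ^ d := le_self_pow₀ hl1 (by omega)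
    have hBd : B ≤ B ^ d := le_self_pow₀ hB (by omega)
    calc (l : ℝ) * (S.filter fun i => dist (p i) c ≤ r).card
        ≤ l ^ d * (((r * h : ℕ) : ℝ) ^ d * (B ^ d * α ^ d)) := by gcongr; exact h1.trans (by gcongr)
      _ = (l * h * B * α * r) ^ d := by push_cast; simp only [mul_pow]; ring
  calc (k : ℝ) ^ (1 / (d : ℝ)) ≤ ((l * h * B * α * r) ^ d) ^ (1 / (d : ℝ)) := by gcongr
    _ = l * h * B * α * r := by
      rw [one_div]
      exact Real.pow_rpow_inv_natCast (by positivity) (by omega)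

/-- The separator lemma. If the independence number `k` of `U` is large, then there is a cube such
that the parts of `U` inside and outside of it have an independence number of at most a constant
fraction of `k`, and the vertices near the boundary have one of order `k ^ (1 - 1 / d)`. The cube is
obtained from a smallest cube that holds a constant fraction of a maximum independent set: cubes of
up to three times this size still miss a constant fraction, and one of the boundaries of the
concentric cubes between these sizes is cheap. -/
lemma exists_separator [DecidableEq V] (hd : 1 ≤ d) (hh : 1 ≤ h) (hB : 1 ≤ B) (hα : 1 ≤ α)
    (hadj : ∀ i j, G.Adj i j → dist (p i) (p j) ≤ 1)
    (hdens : ∀ (c : Fin d → ℝ) (I : Finset V), G.IsIndepSet (I : Set V) →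
      (∀ i ∈ I, dist (p i) c ≤ 1 / h) → (I.card : ℝ) ≤ B * α ^ d)
    {U S : Finset V} {k : ℕ} (hk0 : 0 < k)
    (hk : ∀ I ⊆ U, G.IsIndepSet (I : Set V) → I.card ≤ k)
    (hSU : S ⊆ U) (hS : G.IsIndepSet (S : Set V)) (hSk : S.card = k) :
    (k : ℝ) ^ (1 / (d : ℝ)) ≤ 4 * (((3 ^ d + 1 : ℕ) : ℝ) * h * B) * α ∨
    ∃ (c : Fin d → ℝ) (r : ℝ) (t : ℕ),
      (t : ℝ) ≤ 7 * (((3 ^ d + 1 : ℕ) : ℝ) * h * B) * α * (k : ℝ) ^ (1 - 1 / (d : ℝ)) ∧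
      (∀ I ⊆ U, G.IsIndepSet (I : Set V) → (∀ i ∈ I, dist (p i) c < r) →
        (3 ^ d + 1) * I.card ≤ 3 ^ d * k) ∧
      (∀ I ⊆ U, G.IsIndepSet (I : Set V) → (∀ i ∈ I, r + 1 ≤ dist (p i) c) →
        (3 ^ d + 1) * I.card ≤ 3 ^ d * k) ∧
      (∀ I ⊆ U, G.IsIndepSet (I : Set V) →
        (∀ i ∈ I, r - 1 ≤ dist (p i) c ∧ dist (p i) c < r + 2) → I.card ≤ t) := by
  classical
  set l : ℕ := 3 ^ d + 1 with hl
  have hl1 : 1 ≤ l := Nat.le_add_left 1 _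
  have hex : ∃ r : ℕ, ∃ c, k ≤ l * (S.filter fun i => dist (p i) c ≤ r).card := by
    obtain ⟨r, hr⟩ := exists_nat_ge (∑ i ∈ S, dist (p i) 0)
    refine ⟨r, 0, ?_⟩
    rw [Finset.filter_true_of_mem fun i hi =>
      (Finset.single_le_sum (fun _ _ => dist_nonneg) hi).trans hr, hSk]
    exact Nat.le_mul_of_pos_left k hl1
  set r₁ := Nat.find hex with hr₁
  obtain ⟨c, hc⟩ : ∃ c, k ≤ l * (S.filter fun i => dist (p i) c ≤ r₁).card := Nat.find_spec hex
  have hsmall : ∀ r < r₁, ∀ c, l * (S.filter fun i => dist (p i) c ≤ r).card < k := by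
    intro r hr c
    have := Nat.find_min hex hr
    push Not at this
    exact this c
  by_cases h4 : r₁ < 4
  · left
    have hc' : k ≤ l * (S.filter fun i => dist (p i) c ≤ (4 : ℕ)).card := by
      refine hc.trans (Nat.mul_le_mul_left _ (Finset.card_le_card fun i hi => ?_))
      rw [Finset.mem_filter] at hi ⊢
      exact ⟨hi.1, hi.2.trans (by exact_mod_cast h4.le)⟩
    have := rpow_le_of_card_le hd hh hB hα hdens hS hl1 (by norm_num) hc'
    push_cast at this ⊢
    linarith
  right
  have hroot := rpow_le_of_card_le hd hh hB hα hdens hS hl1 (by omega) hc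
  set q := r₁ / 4 with hq
  have hq1 : 0 < q := by omega
  have hq7 : r₁ ≤ 7 * q := by omega
  have hr4 : (4 : ℝ) ≤ r₁ := by exact_mod_cast not_lt.1 h4
  -- A cube of three times the radius `r₁ - 1` misses a constant fraction of `S`.
  have hbig : l * (S.filter fun i => dist (p i) c ≤ 3 * ((r₁ : ℝ) - 1)).card ≤ 3 ^ d * k := by
    have h1 : ((S.filter fun i => dist (p i) c ≤ 3 * ((r₁ : ℝ) - 1)).card : ℝ) ≤
        ((3 : ℕ) : ℝ) ^ d * ((k : ℝ) / l) := by
      refine card_filter_dist_le p S (by norm_num) (by linarith) (fun c => ?_) c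
      rw [le_div_iff₀ (by exact_mod_cast hl1), mul_comm]
      have := hsmall (r₁ - 1) (by omega) c
      have e : (((r₁ - 1 : ℕ)) : ℝ) = 3 * ((r₁ : ℝ) - 1) / (3 : ℕ) := by
        rw [Nat.cast_sub (by omega)]; push_cast; ring
      rw [e] at this
      exact_mod_cast this.le
    rw [mul_div_assoc', le_div_iff₀ (by exact_mod_cast hl1), mul_comm] at h1
    exact_mod_cast h1
  set Sh : ℕ → Finset V := fun j => U.filter fun i =>
    (r₁ : ℝ) + 4 * j ≤ dist (p i) c ∧ dist (p i) c < r₁ + 4 * j + 3 with hSh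
  have hgap : ∀ i j : ℕ, i < j → ∀ a ∈ Sh i, ∀ b ∈ Sh j, 1 < dist (p a) (p b) := by
    intro i j hij a ha b hb
    simp only [hSh, Finset.mem_filter] at ha hb
    have h1 : (i : ℝ) + 1 ≤ j := by exact_mod_cast hij
    have h2 := dist_triangle_left (p b) c (p a)
    linarith [ha.2.2, hb.2.1]
  obtain ⟨j, hj, hjI⟩ := exists_card_le_div hk hq1 Sh (fun j => Finset.filter_subset _ _)
    (fun i j hij => Finset.disjoint_left.2 fun a ha hb => by
      have := hgap i j hij a ha a hb
      rw [dist_self] at this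
      linarith)
    (fun i j hij a ha b hb hab => (hgap i j hij a ha b hb).not_ge (hadj a b hab))
  have hjq : (r₁ : ℝ) + 4 * j + 2 ≤ 3 * ((r₁ : ℝ) - 1) := by
    have : r₁ + 4 * j + 5 ≤ 3 * r₁ := by omega
    have : (r₁ : ℝ) + 4 * j + 5 ≤ 3 * r₁ := by exact_mod_cast this
    linarith
  have hne {a b : V} {r : ℝ} (ha : dist (p a) c < r) (hb : r + 1 ≤ dist (p b) c) :
      ¬ G.Adj a b := fun hab => by
    have h1 := hadj a b hab
    have h2 := dist_triangle_left (p b) c (p a)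
    linarith
  have hsubS (P : V → Prop) [DecidablePred P] : G.IsIndepSet ((S.filter P : Finset V) : Set V) :=
    Set.Pairwise.mono (fun i hi => (Finset.mem_filter.1 hi).1) hS
  refine ⟨c, r₁ + 4 * j + 1, k / q, ?_, ?_, ?_, ?_⟩
  · have h1 : ((k / q : ℕ) : ℝ) * q ≤ k := by exact_mod_cast Nat.div_mul_le_self k q
    have hk' : (0 : ℝ) < k := by exact_mod_cast hk0
    have h2 : (k : ℝ) = (k : ℝ) ^ (1 - 1 / (d : ℝ)) * (k : ℝ) ^ (1 / (d : ℝ)) := by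
      rw [← Real.rpow_add hk']; simp
    have hq' : (0 : ℝ) < q := by exact_mod_cast hq1
    have h3 : (r₁ : ℝ) ≤ 7 * q := by exact_mod_cast hq7
    refine le_of_mul_le_mul_right ((h1.trans_eq h2).trans ?_) hq'
    calc (k : ℝ) ^ (1 - 1 / (d : ℝ)) * (k : ℝ) ^ (1 / (d : ℝ))
        ≤ (k : ℝ) ^ (1 - 1 / (d : ℝ)) * (l * h * B * α * (7 * q)) := by
          gcongr
          exact hroot.trans (by gcongr)
      _ = 7 * (l * h * B) * α * (k : ℝ) ^ (1 - 1 / (d : ℝ)) * q := by ring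
  · intro I hIU hI hin
    set T := S.filter fun i => ((r₁ : ℝ) + 4 * j + 1) + 1 ≤ dist (p i) c with hT
    have hd' : Disjoint I T := Finset.disjoint_left.2 fun a ha hb => by
      have := hin a ha
      have := (Finset.mem_filter.1 hb).2
      linarith
    have h1 := hk (I ∪ T) (Finset.union_subset hIU ((Finset.filter_subset _ _).trans hSU))
      (isIndepSet_union hI (hsubS _) fun a ha b hb =>
        hne (hin a ha) (Finset.mem_filter.1 hb).2)
    rw [Finset.card_union_of_disjoint hd'] at h1
    have h2 : T.card + (S.filter fun i => ¬ ((r₁ : ℝ) + 4 * j + 1) + 1 ≤ dist (p i) c).card =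
        S.card := Finset.card_filter_add_card_filter_not _
    have h3 : (S.filter fun i => ¬ ((r₁ : ℝ) + 4 * j + 1) + 1 ≤ dist (p i) c).card ≤
        (S.filter fun i => dist (p i) c ≤ 3 * ((r₁ : ℝ) - 1)).card := by
      refine Finset.card_le_card fun i hi => ?_
      rw [Finset.mem_filter] at hi ⊢
      exact ⟨hi.1, by linarith [hi.2]⟩
    have h4 : I.card ≤ (S.filter fun i => dist (p i) c ≤ 3 * ((r₁ : ℝ) - 1)).card := by omega
    exact (Nat.mul_le_mul_left l h4).trans hbig
  · intro I hIU hI hout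
    set T := S.filter fun i => dist (p i) c ≤ r₁ with hT
    have hlt : ∀ b ∈ T, dist (p b) c < (r₁ : ℝ) + 4 * j + 1 := fun b hb => by
      have := (Finset.mem_filter.1 hb).2
      have : (0 : ℝ) ≤ j := j.cast_nonneg
      linarith
    have hd' : Disjoint I T := Finset.disjoint_left.2 fun a ha hb => by
      have := hout a ha
      have := hlt a hb
      linarith
    have h1 := hk (I ∪ T) (Finset.union_subset hIU ((Finset.filter_subset _ _).trans hSU))
      (isIndepSet_union hI (hsubS _) fun a ha b hb hab =>
        hne (hlt b hb) (hout a ha) hab.symm)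
    rw [Finset.card_union_of_disjoint hd'] at h1
    have h2 : l * I.card + l * T.card ≤ l * k := by
      rw [← mul_add]; exact Nat.mul_le_mul_left l h1
    have h3 : l * k = 3 ^ d * k + k := by rw [hl]; ring
    omega
  · intro I hIU hI hIr
    refine hjI I (fun i hi => ?_) hI
    have := hIr i hi
    simp only [hSh, Finset.mem_filter]
    exact ⟨hIU hi, by linarith [this.1], by linarith [this.2]⟩

end separator

/-- A graph on points of `ℝ ^ d` with edges of length at most `1` (in the maximum norm) in which
independent sets inside of small cubes are small has small branching depth. -/
theorem resolvable_of_points {V : Type*} [Fintype V] [DecidableEq V] {G : SimpleGraph V} {d h : ℕ}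
    {p : V → Fin d → ℝ} {B α : ℝ} (hd : 2 ≤ d) (hh : 1 ≤ h) (hB : 1 ≤ B) (hα : 1 ≤ α)
    (hadj : ∀ i j, G.Adj i j → dist (p i) (p j) ≤ 1)
    (hdens : ∀ (c : Fin d → ℝ) (I : Finset V), G.IsIndepSet (I : Set V) →
      (∀ i ∈ I, dist (p i) c ≤ 1 / h) → (I.card : ℝ) ≤ B * α ^ d)
    (k : ℕ) : ∀ U : Finset V, (∀ I ⊆ U, G.IsIndepSet (I : Set V) → I.card ≤ k) →
    Resolvable G ⌊14 * ((3 ^ d + 1 : ℕ) : ℝ) * (((3 ^ d + 1 : ℕ) : ℝ) * h * B) * α *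
      (k : ℝ) ^ (1 - 1 / (d : ℝ))⌋₊ U := by
  classical
  set l : ℕ := 3 ^ d + 1 with hl
  set κ : ℝ := (l : ℝ) * h * B with hκ
  set β : ℝ := 1 - 1 / (d : ℝ) with hβ
  have hl0 : 1 ≤ l := Nat.le_add_left 1 _
  have hl1 : (1 : ℝ) ≤ l := by exact_mod_cast hl0
  have hh1 : (1 : ℝ) ≤ h := by exact_mod_cast hh
  have hκ0 : 0 < κ := by positivity
  have hd2 : 1 / (d : ℝ) ≤ 1 / 2 := by
    apply one_div_le_one_div_of_le (by norm_num); exact_mod_cast hd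
  have hd0 : (0 : ℝ) ≤ 1 / (d : ℝ) := by positivity
  have hβ2 : 1 / 2 ≤ β := by linarith
  have hβ1 : β ≤ 1 := by linarith
  induction k using Nat.strong_induction_on with
  | _ k ih =>
  intro U hU
  rcases Nat.eq_zero_or_pos k with rfl | hk0
  · exact (resolvable_of_card_le hU).mono (Nat.zero_le _)
  have hk' : (0 : ℝ) < k := by exact_mod_cast hk0
  have hpow : (k : ℝ) = (k : ℝ) ^ β * (k : ℝ) ^ (1 / (d : ℝ)) := by
    rw [← Real.rpow_add hk']; simp [hβ]
  by_cases hex : ∃ S ⊆ U, G.IsIndepSet (S : Set V) ∧ S.card = k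
  swap
  · have h1 : ∀ I ⊆ U, G.IsIndepSet (I : Set V) → I.card ≤ k - 1 := fun I hIU hI => by
      have h2 := hU I hIU hI
      have h3 : I.card ≠ k := fun h3 => hex ⟨I, hIU, hI, h3⟩
      omega
    refine (ih (k - 1) (by omega) U h1).mono (Nat.floor_le_floor ?_)
    gcongr
    omega
  obtain ⟨S, hSU, hS, hSk⟩ := hex
  rcases exists_separator (by omega) hh hB hα hadj hdens hk0 hU hSU hS hSk with
    hsm | ⟨c, r, t, ht, hin, hout, hbd⟩
  · refine (resolvable_of_card_le hU).mono (Nat.le_floor ?_)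
    calc (k : ℝ) = (k : ℝ) ^ β * (k : ℝ) ^ (1 / (d : ℝ)) := hpow
      _ ≤ (k : ℝ) ^ β * (4 * κ * α) := by gcongr
      _ ≤ 14 * l * κ * α * (k : ℝ) ^ β := by
        have : 0 ≤ (k : ℝ) ^ β * κ * α := by positivity
        nlinarith
  set k₂ := 3 ^ d * k / l with hk₂
  have hk₂k : k₂ < k := by
    rw [hk₂, Nat.div_lt_iff_lt_mul hl0, hl]
    nlinarith
  have hle (n : ℕ) (hn : l * n ≤ 3 ^ d * k) : n ≤ k₂ := by
    rw [hk₂, Nat.le_div_iff_mul_le hl0, mul_comm]; exact hn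
  set X := U.filter fun i => r ≤ dist (p i) c ∧ dist (p i) c < r + 1 with hX
  set Y := U.filter fun i => r - 1 ≤ dist (p i) c ∧ dist (p i) c < r + 2 with hY
  have hres := resolvable_of_separator (G := G) (U₀ := U) (X := X) (S := Y)
    (s := ⌊14 * (l : ℝ) * κ * α * (k₂ : ℝ) ^ β⌋₊) ?_ ?_ t U subset_rfl ?_
  · refine hres.mono (Nat.le_floor ?_)
    push_cast
    have h1 : (⌊14 * (l : ℝ) * κ * α * (k₂ : ℝ) ^ β⌋₊ : ℝ) ≤ 14 * (l : ℝ) * κ * α * (k₂ : ℝ) ^ β :=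
      Nat.floor_le (by positivity)
    have h2 : (k₂ : ℝ) ≤ (1 - 1 / l) * k := by
      have h3 : k₂ * l ≤ 3 ^ d * k := Nat.div_mul_le_self _ _
      have h4 : (k₂ : ℝ) * l ≤ (l - 1) * k := by
        have : ((l : ℝ) - 1) = ((3 ^ d : ℕ) : ℝ) := by rw [hl]; push_cast; ring
        rw [this]; exact_mod_cast h3
      have h5 : (1 - 1 / (l : ℝ)) * k = (l - 1) * k / l := by field_simp
      rw [h5, le_div_iff₀ (by positivity)]
      exact h4
    have hl2 : 1 / (l : ℝ) ≤ 1 := by rw [div_le_one (by positivity)]; exact hl1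
    have hlr : 0 ≤ 1 / (l : ℝ) := by positivity
    have h3 : (k₂ : ℝ) ^ β ≤ (1 - 1 / (2 * l)) * (k : ℝ) ^ β := by
      calc (k₂ : ℝ) ^ β ≤ ((1 - 1 / l) * k) ^ β := by gcongr
        _ = (1 - 1 / l) ^ β * (k : ℝ) ^ β := Real.mul_rpow (by linarith) hk'.le
        _ ≤ (1 - 1 / (2 * l)) * (k : ℝ) ^ β := by
          gcongr
          have h6 := rpow_one_add_le_one_add_mul_self (s := -(1 / (l : ℝ))) (by linarith)
            (by linarith : 0 ≤ β) hβ1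
          have e : (1 : ℝ) / (2 * l) = 1 / 2 * (1 / l) := by field_simp
          rw [e]
          calc (1 - 1 / (l : ℝ)) ^ β = (1 + -(1 / (l : ℝ))) ^ β := by ring_nf
            _ ≤ 1 + β * -(1 / (l : ℝ)) := h6
            _ ≤ 1 - 1 / 2 * (1 / l) := by nlinarith
    have h4 : 14 * (l : ℝ) * κ * α * (k₂ : ℝ) ^ β ≤
        14 * (l : ℝ) * κ * α * ((1 - 1 / (2 * l)) * (k : ℝ) ^ β) := by gcongr
    have h5 : 14 * (l : ℝ) * κ * α * ((1 - 1 / (2 * l)) * (k : ℝ) ^ β) =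
        14 * (l : ℝ) * κ * α * (k : ℝ) ^ β - 7 * κ * α * (k : ℝ) ^ β := by
      field_simp; ring
    linarith
  · rintro K hKU hKX ⟨v, hv, hKv⟩
    have hcase : ∀ i ∈ K, dist (p i) c < r ∨ r + 1 ≤ dist (p i) c := by
      intro i hi
      by_contra hcon
      push Not at hcon
      exact Finset.disjoint_left.1 hKX hi (Finset.mem_filter.2 ⟨hKU hi, hcon⟩)
    have hstep {a b : V} (ha : dist (p a) c < r) (hb : r + 1 ≤ dist (p b) c) : ¬ G.Adj a b :=
      fun hab => by
        have h1 := hadj a b hab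
        have h2 := dist_triangle_left (p b) c (p a)
        linarith
    have hside : (∀ i ∈ K, dist (p i) c < r) ∨ (∀ i ∈ K, r + 1 ≤ dist (p i) c) := by
      rcases hcase v hv with h | h
      · left
        rw [← hKv]
        refine component_induction h fun a b _ ha hb hab => ?_
        exact (hcase b hb).resolve_right fun hb' => hstep ha hb' hab
      · right
        rw [← hKv]
        refine component_induction h fun a b _ ha hb hab => ?_
        exact (hcase b hb).resolve_left fun hb' => hstep hb' ha hab.symm
    refine ih k₂ hk₂k K fun I hIK hI => hle _ ?_
    rcases hside with h | h
    · exact hin I (hIK.trans hKU) hI fun i hi => h i (hIK hi)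
    · exact hout I (hIK.trans hKU) hI fun i hi => h i (hIK hi)
  · intro y hy x hx hxy
    simp only [hX, hY, Finset.mem_filter] at hy ⊢
    refine ⟨hx, ?_⟩
    have hdist : dist (p y) (p x) ≤ 1 := by
      rcases mem_closedNbhd.1 hxy with rfl | hxy
      · simp
      · exact hadj y x hxy
    have h1 := dist_triangle_left (p y) c (p x)
    have h2 := dist_triangle_left (p x) c (p y)
    rw [dist_comm (p x) (p y)] at h1
    exact ⟨by linarith [hy.2.1], by linarith [hy.2.2]⟩
  · intro I hI hind
    rw [Finset.subset_inter_iff] at hI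
    exact hbd I hI.1 hind fun i hi => (Finset.mem_filter.1 (hI.2 hi)).2

/-! ### Intersection graphs of similarly sized stabbed objects -/

/-- If connected sets are cliques, then branching once is enough. -/
lemma resolvable_of_trans {V : Type*} [Fintype V] [DecidableEq V] {G : SimpleGraph V}
    (h : ∀ a b c, G.Adj a b → G.Adj b c → a ≠ c → G.Adj a c) (U : Finset V) :
    Resolvable G 1 U := by
  intro v hv
  refine ⟨v, mem_component_self, fun x hx hxv => Finset.eq_empty_of_forall_notMem fun z hz => ?_⟩
  have key : ∀ u ∈ component G U v, u = v ∨ G.Adj v u := by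
    refine component_induction (Or.inl rfl) fun a b _ ha _ hab => ?_
    by_cases hb : b = v
    · exact Or.inl hb
    · rcases ha with rfl | ha
      · exact Or.inr hab
      · exact Or.inr (h v a b ha hab fun hh => hb hh.symm)
  simp only [Finset.mem_sdiff, mem_closedNbhd, not_or] at hz hxv
  rcases key z hz.1 with rfl | hvz
  · rcases hxv with rfl | hxv
    · exact hz.2.1 rfl
    · exact hz.2.2 hxv.symm
  · rcases hxv with rfl | hxv
    · exact hz.2.2 hvz
    · exact hz.2.2 (h x v z hxv.symm hvz fun hh => hz.2.1 hh.symm)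

/-- Pairwise disjoint objects that are stabbed by `P` are at most as many as the points of `P`. -/
lemma card_le_of_stabbed {ι X : Type*} {o : ι → Set X} {I : Finset ι} {P : Finset X}
    (hI : (intersectionGraph o).IsIndepSet (I : Set ι)) (hP : ∀ i ∈ I, ∃ p ∈ P, p ∈ o i) :
    I.card ≤ P.card := by
  have h : ∀ i : I, ∃ p ∈ P, p ∈ o i := fun i => hP i i.2
  choose f hfP hfo using h
  rw [← Finset.card_attach]
  refine Finset.card_le_card_of_injOn f (fun i _ => hfP i) fun i _ j _ hij => ?_
  by_contra hne
  have hne' : (i : ι) ≠ j := fun hh => hne (Subtype.ext hh)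
  exact hI i.2 j.2 hne' ⟨hne', f i, hfo i, hij ▸ hfo j⟩

/-- Branching solves intersection graphs of similarly sized `α`-stabbed objects with depth
`O(k ^ (1 - 1 / d) * α)`. -/
theorem resolvable_of_isStabbed {d : ℕ} (hd : 2 ≤ d) {ρ : ℝ} (hρ : 1 ≤ ρ) :
    ∃ C : ℝ, 1 ≤ C ∧ ∀ (α : ℝ), 1 ≤ α →
      ∀ (n : ℕ) (o : Fin n → Set (EuclideanSpace ℝ (Fin d))),
        SimilarlySized ρ o → IsStabbed α o →
          Resolvable (intersectionGraph o)
            ⌊C * ((intersectionGraph o).indepNum : ℝ) ^ (1 - 1 / (d : ℝ)) * α⌋₊ Finset.univ := by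
  have hρ2 : 1 ≤ ρ ^ 2 := one_le_pow₀ hρ
  obtain ⟨J, hJ⟩ := pow_unbounded_of_one_lt (ρ ^ 2) (by norm_num : (1 : ℝ) < 3 / 2)
  have hJ1 : 1 ≤ J := by
    rcases Nat.eq_zero_or_pos J with rfl | h
    · rw [pow_zero] at hJ; linarith
    · exact h
  obtain ⟨h, hh⟩ := exists_nat_ge (4 * d * ρ ^ 2)
  have hd' : (2 : ℝ) ≤ d := by exact_mod_cast hd
  have hh0 : (0 : ℝ) < h := lt_of_lt_of_le (by positivity) hh
  have hh1 : 1 ≤ h := by exact_mod_cast hh0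
  have hl1 : (1 : ℝ) ≤ ((3 ^ d + 1 : ℕ) : ℝ) := by exact_mod_cast Nat.le_add_left 1 _
  have hh1' : (1 : ℝ) ≤ h := by exact_mod_cast hh1
  have hJ1' : (1 : ℝ) ≤ J := by exact_mod_cast hJ1
  refine ⟨14 * ((3 ^ d + 1 : ℕ) : ℝ) * (((3 ^ d + 1 : ℕ) : ℝ) * h * J), ?_, ?_⟩
  · have := one_le_mul_of_one_le_of_one_le (one_le_mul_of_one_le_of_one_le hl1 hh1') hJ1'
    nlinarith
  set C : ℝ := 14 * ((3 ^ d + 1 : ℕ) : ℝ) * (((3 ^ d + 1 : ℕ) : ℝ) * h * J) with hC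
  have hC1 : 1 ≤ C := by
    have := one_le_mul_of_one_le_of_one_le (one_le_mul_of_one_le_of_one_le hl1 hh1') hJ1'
    nlinarith
  intro α hα n o ho hst
  set G := intersectionGraph o with hG
  rcases Nat.eq_zero_or_pos n with rfl | hn
  · exact Resolvable.mono (s := 0) (Finset.eq_empty_of_isEmpty _) (Nat.zero_le _)
  set i₀ : Fin n := ⟨0, hn⟩
  set D := Metric.diam (o i₀) with hD
  choose q hq using ho.nonempty
  have hβ : 0 ≤ 1 - 1 / (d : ℝ) := by
    have : 1 / (d : ℝ) ≤ 1 := by rw [div_le_one (by linarith)]; linarith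
    linarith
  rcases (Metric.diam_nonneg (s := o i₀)).eq_or_lt with hD0 | hD0
  · -- All objects are single points, and intersecting objects coincide.
    have hsub : ∀ i, (o i).Subsingleton := fun i => by
      have := ho.diam_le i i₀
      rw [← hD0, mul_zero] at this
      intro a ha b hb
      have h2 := Metric.dist_le_diam_of_mem (ho.bounded i) ha hb
      exact dist_le_zero.1 (h2.trans this)
    refine (resolvable_of_trans ?_ _).mono (Nat.le_floor ?_)
    · rintro a b c ⟨hab, x, hxa, hxb⟩ ⟨hbc, y, hyb, hyc⟩ hac
      refine ⟨hac, x, hxa, ?_⟩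
      rwa [hsub b hxb hyb]
    · have hk : 1 ≤ G.indepNum := by
        have : G.IsIndepSet (({i₀} : Finset (Fin n)) : Set (Fin n)) := by simp
        simpa using this.card_le_indepNum
      have hk' : (1 : ℝ) ≤ (G.indepNum : ℝ) ^ (1 - 1 / (d : ℝ)) :=
        Real.one_le_rpow (by exact_mod_cast hk) hβ
      push_cast
      exact one_le_mul_of_one_le_of_one_le (one_le_mul_of_one_le_of_one_le hC1 hk') hα
  have hD0' : 0 < D := hD0
  -- All diameters lie between `δ` and `ρ ^ 2 * δ`, and all edges are shorter than `L`.
  set δ := D / ρ with hδ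
  have hρ0 : 0 < ρ := by linarith
  have hδ0 : 0 < δ := by positivity
  have hDδ : D = ρ * δ := by rw [hδ]; field_simp
  have hlow : ∀ i, δ ≤ Metric.diam (o i) := fun i => by
    rw [hδ, div_le_iff₀ hρ0, mul_comm]
    exact ho.diam_le i₀ i
  have hupp : ∀ i, Metric.diam (o i) ≤ ρ ^ 2 * δ := fun i => by
    have := ho.diam_le i i₀
    rw [← hD, hDδ] at this
    linarith [this]
  set L := 2 * ρ ^ 2 * δ with hL
  have hL0 : 0 < L := by positivity
  have hpts : ∀ i j, G.Adj i j → dist (q i) (q j) ≤ L := by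
    rintro i j ⟨-, x, hxi, hxj⟩
    have h1 := Metric.dist_le_diam_of_mem (ho.bounded i) (hq i) hxi
    have h2 := Metric.dist_le_diam_of_mem (ho.bounded j) hxj (hq j)
    have h3 := dist_triangle (q i) x (q j)
    linarith [hupp i, hupp j]
  have hres := resolvable_of_points (G := G) (p := fun i j => q i j / L) (B := J) hd hh1 hJ1' hα
    ?_ ?_ G.indepNum Finset.univ fun I _ hI => hI.card_le_indepNum
  · convert hres using 2
    rw [hC]; ring
  · intro i j hij
    rw [dist_pi_le_iff zero_le_one]
    intro b
    rw [Real.dist_eq, ← sub_div, abs_div, abs_of_pos hL0, div_le_one hL0]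
    have h1 := PiLp.norm_apply_le (q i - q j) b
    rw [← dist_eq_norm] at h1
    exact (by simpa using h1 : |q i b - q j b| ≤ dist (q i) (q j)).trans (hpts i j hij)
  · intro c I hI hIc
    set c' : EuclideanSpace ℝ (Fin d) := WithLp.toLp 2 fun j => L * c j with hc'
    have hnear : ∀ i ∈ I, dist (q i) c' ≤ δ / 2 := by
      intro i hi
      have h1 := hIc i hi
      rw [dist_pi_le_iff (by positivity)] at h1
      have h2 : ∀ b, dist (q i b) (c' b) ≤ L / h := by
        intro b
        have h3 := h1 b
        rw [Real.dist_eq] at h3 ⊢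
        have e : q i b - c' b = L * (q i b / L - c b) := by
          rw [hc']; field_simp
        rw [e, abs_mul, abs_of_pos hL0]
        calc L * |q i b / L - c b| ≤ L * (1 / h) := by gcongr
          _ = L / h := by ring
      have h4 : dist (q i) c' ≤ d * (L / h) := by
        rw [EuclideanSpace.dist_eq]
        calc √(∑ b, dist (q i b) (c' b) ^ 2) ≤ √(∑ _b : Fin d, (L / h) ^ 2) := by
              gcongr with b
              exact h2 b
          _ = √(d * (L / h) ^ 2) := by simp
          _ ≤ √((d * (L / h)) ^ 2) := by
              apply Real.sqrt_le_sqrt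
              rw [mul_pow]
              gcongr
              nlinarith
          _ = d * (L / h) := Real.sqrt_sq (by positivity)
      refine h4.trans ?_
      rw [hL, mul_div_assoc', div_le_div_iff₀ hh0 (by norm_num)]
      nlinarith
    -- The objects are distributed over `J` classes of diameters, each of which is stabbed.
    have hclass : ∀ i, ∃ j < J, δ * (3 / 2) ^ j ≤ Metric.diam (o i) ∧
        Metric.diam (o i) < δ * (3 / 2) ^ (j + 1) := by
      intro i
      obtain ⟨j, hj1, hj2⟩ := exists_nat_pow_near
        (by rw [le_div_iff₀ hδ0, one_mul]; exact hlow i : 1 ≤ Metric.diam (o i) / δ)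
        (by norm_num : (1 : ℝ) < 3 / 2)
      refine ⟨j, ?_, ?_, ?_⟩
      · rw [← pow_lt_pow_iff_right₀ (by norm_num : (1 : ℝ) < 3 / 2)]
        refine (hj1.trans ?_).trans_lt hJ
        rw [div_le_iff₀ hδ0]; exact hupp i
      · rwa [le_div_iff₀ hδ0, mul_comm] at hj1
      · rwa [div_lt_iff₀ hδ0, mul_comm] at hj2
    choose f hfJ hf1 hf2 using hclass
    have hcard : I.card = ∑ j ∈ Finset.range J, (I.filter fun i => f i = j).card :=
      Finset.card_eq_sum_card_fiberwise fun i _ => by simpa using hfJ i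
    rw [hcard]
    push_cast
    calc ∑ j ∈ Finset.range J, ((I.filter fun i => f i = j).card : ℝ)
        ≤ ∑ _j ∈ Finset.range J, α ^ d := by
          refine Finset.sum_le_sum fun j _ => ?_
          obtain ⟨P, hPc, hP⟩ := hst (2 * (δ * (3 / 2) ^ j)) c'
          have hpow : δ ≤ δ * (3 / 2) ^ j :=
            le_mul_of_one_le_right hδ0.le (one_le_pow₀ (by norm_num))
          refine le_trans ?_ hPc
          norm_cast
          refine card_le_of_stabbed (o := o)
            (Set.Pairwise.mono (fun i hi => (Finset.mem_filter.1 hi).1) hI) fun i hi => ?_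
          obtain ⟨hiI, rfl⟩ := Finset.mem_filter.1 hi
          have h1 := hf1 i
          have h2 := hf2 i
          rw [pow_succ] at h2
          refine hP i ⟨by linarith, by nlinarith⟩ fun x hx => ?_
          have h3 := Metric.dist_le_diam_of_mem (ho.bounded i) hx (hq i)
          have h4 := dist_triangle x (q i) c'
          have h5 := hnear i hiI
          rw [Metric.mem_ball]
          linarith
      _ = J * α ^ d := by simp

/-! ### The branching algorithm as a program -/

/-- Programs without `store` do not change the memory. -/
def LoopProg.stores : LoopProg → Bool
  | skip => false
  | set _ _ => false
  | store _ _ => true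
  | seq p q => p.stores || q.stores
  | ite _ p q => p.stores || q.stores
  | forN _ p => p.stores

lemma LoopProg.run_mem {n : ℕ} : ∀ {p : LoopProg}, p.stores = false →
    ∀ h, (p.run n h).mem = h.mem
  | skip, _, h => rfl
  | set x e, _, h => rfl
  | store a b, hp, h => by simp [stores] at hp
  | seq p q, hp, h => by
      have : p.stores = false ∧ q.stores = false := by simpa [stores] using hp
      simp [run, run_mem this.1, run_mem this.2]
  | ite e p q, hp, h => by
      have : p.stores = false ∧ q.stores = false := by simpa [stores] using hp
      simp only [run]
      split_ifs
      exacts [run_mem this.1 h, run_mem this.2 h]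
  | forN x p, hp, h => by
      have key : ∀ i, (loopUpTo (fun i h' => p.run n (h'.setReg x i)) i h).mem = h.mem := by
        intro i
        induction i with
        | zero => rfl
        | succ i ih => simp only [loopUpTo]; rw [run_mem (by simpa [stores] using hp)]; simpa using ih
      exact key n

/-- Row `i` of the memory, a vector of length `n`. The input puts the adjacency matrix into the rows
`0, …, n - 1`. -/
def row (n : ℕ) (mem : ℕ → ℕ) (i : ℕ) (j : Fin n) : ℕ := mem (1 + i * n + j)

/-- The memory is changed in row `p` only. -/
def AgreeOffRow (n p : ℕ) (mem mem' : ℕ → ℕ) : Prop := ∀ i, i ≠ p → row n mem' i = row n mem i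

lemma row_address_inj {n i i' : ℕ} {j j' : Fin n} (h : 1 + i' * n + j' = 1 + i * n + j) :
    i' = i ∧ j' = j := by
  have hn : 0 < n := j.pos
  have h1 : (i' * n + j') / n = (i * n + j) / n := by congr 1; omega
  have h2 : (i' * n + j') % n = (i * n + j) % n := by congr 1; omega
  rw [mul_comm i', mul_comm i, Nat.mul_add_div hn, Nat.mul_add_div hn,
    Nat.div_eq_of_lt j.2, Nat.div_eq_of_lt j'.2] at h1
  rw [mul_comm i', mul_comm i, Nat.mul_add_mod, Nat.mul_add_mod, Nat.mod_eq_of_lt j.2,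
    Nat.mod_eq_of_lt j'.2] at h2
  exact ⟨by simpa using h1, Fin.ext h2⟩

lemma row_setMem {n : ℕ} (h : RamState) (i i' v : ℕ) (j j' : Fin n) :
    row n (h.setMem (1 + i * n + j) v).mem i' j' =
      if i' = i ∧ j' = j then v else row n h.mem i' j' := by
  simp only [row, RamState.setMem_mem]
  by_cases hc : 1 + i' * n + (j' : ℕ) = 1 + i * n + j
  · rw [if_pos hc, if_pos (row_address_inj hc)]
  · rw [if_neg hc, if_neg]
    rintro ⟨rfl, rfl⟩
    exact hc rfl

lemma AgreeOffRow.setMem {n p : ℕ} {mem : ℕ → ℕ} {h : RamState} (H : AgreeOffRow n p mem h.mem)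
    (j : Fin n) (v : ℕ) : AgreeOffRow n p mem (h.setMem (1 + p * n + j) v).mem := by
  intro i hi
  rw [← H i hi]
  ext j'
  rw [row_setMem, if_neg fun hh => hi hh.1]

namespace LoopExpr

/-- The entry in column `j` of row `i`. -/
def cell (i j : LoopExpr) : LoopExpr := load (add (add (const 1) (mulSize i)) j)

/-- The row of the `x`-th child of the node with row `p`; nodes are numbered from `0` in the order of
their depth, and node number `c` has row `n + c`. -/
def child (p x : LoopExpr) : LoopExpr :=
  add (mulSize (sub p size)) (add (add size (const 1)) x)

/-- A number that is `1` for `x = y` and `0` otherwise. -/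
def eq (x y : LoopExpr) : LoopExpr := sub (const 1) (add (sub x y) (sub y x))

lemma eval_cell {n : ℕ} {h : RamState} {a b : LoopExpr} {i : ℕ} {j : Fin n}
    (ha : a.eval n h = i) (hb : b.eval n h = j) : (cell a b).eval n h = row n h.mem i j := by
  simp [cell, eval, row, ha, hb]

end LoopExpr

/-- The row of the `x`-th child of node number `c`. -/
def childRow (n c x : ℕ) : ℕ := c * n + (n + 1 + x)

lemma LoopExpr.eval_child {n : ℕ} {h : RamState} {a b : LoopExpr} {c x : ℕ}
    (ha : a.eval n h = n + c) (hb : b.eval n h = x) : (child a b).eval n h = childRow n c x := by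
  simp [child, eval, childRow, ha, hb]

lemma LoopExpr.eval_eq {n : ℕ} {h : RamState} {a b : LoopExpr} {x y : Fin n}
    (ha : a.eval n h = x) (hb : b.eval n h = y) : (eq a b).eval n h = if x = y then 1 else 0 := by
  simp only [eq, eval, ha, hb, Fin.ext_iff]
  split_ifs <;> omega

namespace LoopProg

/-- Write the value of `e` into column `j` of row `i`. -/
def setCell (i j e : LoopExpr) : LoopProg := store (.add (.add (.const 1) (.mulSize i)) j) e

lemma run_setCell {n : ℕ} {h : RamState} {a b e : LoopExpr} {i : ℕ} {j : Fin n}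
    (ha : a.eval n h = i) (hb : b.eval n h = j) :
    (setCell a b e).run n h = h.setMem (1 + i * n + j) (e.eval n h) := by
  simp [setCell, run, LoopExpr.eval, ha, hb]

lemma run_ite_pos {n : ℕ} {h : RamState} {e : LoopExpr} {p q : LoopProg} (he : e.eval n h ≠ 0) :
    (ite e p q).run n h = p.run n h := by simp [run, he]

lemma run_ite_neg {n : ℕ} {h : RamState} {e : LoopExpr} {p q : LoopProg} (he : e.eval n h = 0) :
    (ite e p q).run n h = q.run n h := by simp [run, he]

/-- `if` the entry in row `c`, column `u` is at least `3`, that is, the vertex is marked. -/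
def ifMarked (u : ℕ) (p : LoopProg) : LoopProg :=
  ite (.sub (.cell (.var 1) (.var u)) (.const 2)) p skip

lemma run_ifMarked {n : ℕ} {h : RamState} {u p : ℕ} {j : Fin n} {q : LoopProg}
    (h1 : h.reg 1 = p) (hu : h.reg u = j) :
    (ifMarked u q).run n h = if 2 < row n h.mem p j then q.run n h else h := by
  simp only [ifMarked, run, LoopExpr.eval, LoopExpr.eval_cell (a := .var 1) (b := .var u) h1 hu]
  by_cases hc : 2 < row n h.mem p j
  · rw [if_pos (by omega), if_pos hc]
  · rw [if_neg (by omega), if_neg hc]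

lemma run_ifMarked_iff {n : ℕ} {h : RamState} {u p : ℕ} {j : Fin n} {q : LoopProg} {P : Prop}
    [Decidable P] (h1 : h.reg 1 = p) (hu : h.reg u = j) (hP : P ↔ 2 < row n h.mem p j) :
    (ifMarked u q).run n h = if P then q.run n h else h := by
  rw [run_ifMarked h1 hu]
  simp only [hP]

/-! The variables of the following programs are
`0`: number of the first row that is not expanded, `1`: current row, `2`: vertex whose component is
to be solved, `3`: rounds of the search for the component, `4`, `5`: vertices, `6`: vertex `y` to
branch at, `7`: branch `x`, `8`: whether all branches are solved, `9`: value of the best branch,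
`10`: best branch, `11`: value of the current branch, `12`: whether the root is unsolved. -/

/-- Mark the unsolved neighbours of vertex `4`. -/
def markNeighbours : LoopProg :=
  forN 5 (ite (.cell (.var 4) (.var 5))
    (ite (.cell (.var 1) (.var 5)) skip (setCell (.var 1) (.var 5) (.const 3))) skip)

/-- Extend the marking to a whole component. -/
def markComponent : LoopProg := forN 3 (forN 4 (ifMarked 4 markNeighbours))

/-- Evaluate the branch `7`: the value is `1` plus the number of chosen vertices. -/
def evalBranch : LoopProg :=
  seq (seq (set 11 (.const 1))
    (forN 4 (ifMarked 4 (ite (.cell (.child (.var 1) (.var 7)) (.var 4))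
      (set 11 (.add (.var 11) (.sub (.cell (.child (.var 1) (.var 7)) (.var 4)) (.const 1))))
      (set 8 (.const 0))))))
    (ite (.sub (.var 11) (.var 9)) (seq (set 9 (.var 11)) (set 10 (.var 7))) skip)

/-- Evaluate the branches at vertex `6`. -/
def evalBranches : LoopProg :=
  seq (seq (set 8 (.const 1)) (set 9 (.const 0)))
    (forN 7 (ifMarked 7 (ite (.add (.cell (.var 6) (.var 7)) (.eq (.var 6) (.var 7)))
      evalBranch skip)))

/-- Copy the solution of the best branch and add the vertex of this branch. -/
def copyBest : LoopProg :=
  seq (forN 4 (ifMarked 4 (setCell (.var 1) (.var 4) (.cell (.child (.var 1) (.var 10)) (.var 4)))))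
    (setCell (.var 1) (.var 10) (.const 2))

/-- Look for a vertex of the marked component such that all branches at it are solved. -/
def tryVertices : LoopProg :=
  forN 6 (ifMarked 6 (seq evalBranches (ite (.var 8) copyBest skip)))

/-- Remove the marks. -/
def unmark : LoopProg := forN 4 (ifMarked 4 (setCell (.var 1) (.var 4) (.const 0)))

/-- Try to solve the component of vertex `2` in row `1`. -/
def solveComponent : LoopProg :=
  seq (seq (setCell (.var 1) (.var 2) (.const 3)) markComponent) (seq tryVertices unmark)

/-- Try to solve all components in row `1`. -/
def solveRow : LoopProg := forN 2 (ite (.cell (.var 1) (.var 2)) skip solveComponent)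

/-- Set up the rows of the children of row `0`. -/
def expandRow : LoopProg :=
  forN 7 (forN 4 (ite (.add (.cell (.var 0) (.var 4))
      (.add (.cell (.var 7) (.var 4)) (.eq (.var 4) (.var 7))))
    (setCell (.child (.var 0) (.var 7)) (.var 4) (.const 1)) skip))

/-- Check whether the root is solved. -/
def checkRoot : LoopProg :=
  seq (set 12 (.const 0)) (forN 4 (ite (.cell .size (.var 4)) skip (set 12 (.const 1))))

/-- One step of the algorithm: solve the current row and move on to the previous row, or expand the
next row if all rows have been visited. -/
def solverStep : LoopProg :=
  seq (ite (.sub (.add (.var 1) (.const 1)) .size)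
      (seq solveRow (set 1 (.sub (.var 1) (.const 1))))
      (seq expandRow (seq (set 1 (.var 0)) (set 0 (.add (.var 0) (.const 1))))))
    checkRoot

/-- The first values of the variables. -/
def solverStart : LoopProg :=
  seq (set 0 .size) (seq (set 1 (.sub .size (.const 1))) (set 12 .size))

/-- Write the solution of the root into the first `n` memory cells. -/
def solverOutput : LoopProg := forN 4 (store (.var 4) (.sub (.cell .size (.var 4)) (.const 1)))

end LoopProg

/-- The machine program: read `n`, step until the root is solved, write the output. Register `26` holds
variable `12`. -/
def solver : RamProg :=
  .seq (.load 0 0) (.seq (LoopProg.solverStart.compile 0)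
    (.seq (.while 26 (LoopProg.solverStep.compile 0)) (LoopProg.solverOutput.compile 0)))

/-! ### Finding components -/

open LoopProg

/-- `mem'` arises from `mem` by marking the vertices of `M` in row `p`. -/
structure IsMarked (n p : ℕ) (mem : ℕ → ℕ) (M : Finset (Fin n)) (mem' : ℕ → ℕ) : Prop where
  agree : AgreeOffRow n p mem mem'
  row_eq : ∀ u, row n mem' p u = if u ∈ M then 3 else row n mem p u

/-- The first `n` rows of the memory hold the adjacency matrix of `G`. -/
def HoldsGraph {n : ℕ} (G : SimpleGraph (Fin n)) (mem : ℕ → ℕ) : Prop :=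
  ∀ a b : Fin n, row n mem a b ≠ 0 ↔ G.Adj a b

lemma HoldsGraph.agree {n p : ℕ} {G : SimpleGraph (Fin n)} {mem mem' : ℕ → ℕ}
    (hG : HoldsGraph G mem) (hp : n ≤ p) (h : AgreeOffRow n p mem mem') : HoldsGraph G mem' :=
  fun a b => by rw [h a (by omega)]; exact hG a b

section Mark

variable {n p : ℕ} {G : SimpleGraph (Fin n)} {mem : ℕ → ℕ} {Z : Finset (Fin n)} {v : Fin n}

lemma run_markNeighbours (hp : n ≤ p) (hG : HoldsGraph G mem)
    (hZ : ∀ u, u ∈ Z ↔ row n mem p u = 0) {M : Finset (Fin n)} {u : Fin n} {h : RamState}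
    (h1 : h.reg 1 = p) (h4 : h.reg 4 = u) (hM : IsMarked n p mem M h.mem)
    (hMc : M ⊆ component G Z v) (hu : u ∈ M) :
    ∃ M', M ⊆ M' ∧ M' ⊆ component G Z v ∧ IsMarked n p mem M' (markNeighbours.run n h).mem ∧
      ∀ w ∈ Z, G.Adj u w → w ∈ M' := by
  have key := run_forN (n := n) (x := 5) (h := h)
    (p := ite (.cell (.var 4) (.var 5))
      (ite (.cell (.var 1) (.var 5)) skip (setCell (.var 1) (.var 5) (.const 3))) skip)
    (fun i h' => ∃ M', M ⊆ M' ∧ M' ⊆ component G Z v ∧ IsMarked n p mem M' h'.mem ∧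
      ∀ w ∈ Z, w.val < i → G.Adj u w → w ∈ M')
    ⟨M, subset_rfl, hMc, hM, by simp⟩ ?_
  · obtain ⟨M', h1, h2, h3, h4⟩ := key
    exact ⟨M', h1, h2, h3, fun w hw => h4 w hw w.2⟩
  · rintro w h' hfr ⟨M', hMM, hMc', hM', hw'⟩
    have h1' : (h'.setReg 5 w).reg 1 = p := by simpa using (hfr 1 rfl).trans h1
    have h4' : (h'.setReg 5 w).reg 4 = u := by simpa using (hfr 4 rfl).trans h4
    have h5' : (h'.setReg 5 w).reg 5 = w := by simp
    have e1 : (LoopExpr.cell (.var 4) (.var 5)).eval n (h'.setReg 5 w) = row n h'.mem u w :=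
      LoopExpr.eval_cell h4' h5'
    have e2 : (LoopExpr.cell (.var 1) (.var 5)).eval n (h'.setReg 5 w) = row n h'.mem p w :=
      LoopExpr.eval_cell h1' h5'
    have hA : row n h'.mem u w ≠ 0 ↔ G.Adj u w := hG.agree hp hM'.agree u w
    -- If nothing is stored in this round, then `w` needs no mark.
    have stay (hn : G.Adj u w → w ∈ Z → w ∈ M') : ∃ M'', M ⊆ M'' ∧ M'' ⊆ component G Z v ∧
        IsMarked n p mem M'' (h'.setReg 5 w).mem ∧
        ∀ z ∈ Z, z.val < w.val + 1 → G.Adj u z → z ∈ M'' := by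
      refine ⟨M', hMM, hMc', hM', fun z hz hzw hadj => ?_⟩
      rcases Nat.lt_succ_iff_lt_or_eq.1 hzw with hlt | heq
      · exact hw' z hz hlt hadj
      · obtain rfl := Fin.ext heq
        exact hn hadj hz
    by_cases hadj : G.Adj u w
    swap
    · rw [run_ite_neg (by rw [e1]; by_contra hh; exact hadj (hA.1 hh))]
      exact stay fun hh => absurd hh hadj
    rw [run_ite_pos (by rw [e1]; exact hA.2 hadj)]
    by_cases hz : row n h'.mem p w = 0
    swap
    · rw [run_ite_pos (by rwa [e2])]
      refine stay fun _ hwZ => ?_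
      by_contra hwM
      rw [hM'.row_eq, if_neg hwM] at hz
      exact hz ((hZ w).1 hwZ)
    have hwZ : w ∈ Z := by
      rw [hM'.row_eq] at hz
      split_ifs at hz with hwM
      exact (hZ w).2 hz
    rw [run_ite_neg (by rw [e2, hz]), run_setCell (a := .var 1) (b := .var 5) h1' h5']
    refine ⟨insert w M', hMM.trans (Finset.subset_insert _ _), ?_, ⟨?_, fun z => ?_⟩, ?_⟩
    · exact Finset.insert_subset (mem_component_of_adj (hMc hu) hwZ hadj) hMc'
    · exact AgreeOffRow.setMem (h := h'.setReg 5 w) hM'.agree w _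
    · rw [row_setMem]
      by_cases hzw : z = w
      · simp [hzw, LoopExpr.eval]
      · rw [if_neg fun hh => hzw hh.2]
        simp only [RamState.setReg_mem, Finset.mem_insert, hzw, false_or]
        exact hM'.row_eq z
    · intro z hz hzw hadj'
      rcases Nat.lt_succ_iff_lt_or_eq.1 hzw with hlt | heq
      · exact Finset.mem_insert_of_mem (hw' z hz hlt hadj')
      · obtain rfl := Fin.ext heq
        exact Finset.mem_insert_self _ _

/-- One round of the search marks all unsolved neighbours of the vertices that were marked before. -/
lemma run_markRound (hp : n ≤ p) (hG : HoldsGraph G mem)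
    (hZ : ∀ u, u ∈ Z ↔ row n mem p u = 0) {M : Finset (Fin n)} {h : RamState}
    (h1 : h.reg 1 = p) (hM : IsMarked n p mem M h.mem) (hM3 : ∀ u, row n mem p u ≤ 2)
    (hMc : M ⊆ component G Z v) :
    ∃ M', M ⊆ M' ∧ M' ⊆ component G Z v ∧
      IsMarked n p mem M' ((forN 4 (ifMarked 4 markNeighbours)).run n h).mem ∧
      ∀ u ∈ M, ∀ w ∈ Z, G.Adj u w → w ∈ M' := by
  have key := run_forN (n := n) (x := 4) (h := h) (p := ifMarked 4 markNeighbours)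
    (fun i h' => ∃ M', M ⊆ M' ∧ M' ⊆ component G Z v ∧ IsMarked n p mem M' h'.mem ∧
      ∀ u ∈ M, u.val < i → ∀ w ∈ Z, G.Adj u w → w ∈ M')
    ⟨M, subset_rfl, hMc, hM, by simp⟩ ?_
  · obtain ⟨M', h1, h2, h3, h4⟩ := key
    exact ⟨M', h1, h2, h3, fun u hu => h4 u hu u.2⟩
  · rintro u h' hfr ⟨M', hMM, hMc', hM', hu'⟩
    have h1' : (h'.setReg 4 u).reg 1 = p := by simpa using (hfr 1 rfl).trans h1
    have h4' : (h'.setReg 4 u).reg 4 = u := by simp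
    rw [run_ifMarked h1' h4']
    have hiff : 2 < row n (h'.setReg 4 u).mem p u ↔ u ∈ M' := by
      rw [RamState.setReg_mem, hM'.row_eq]
      have := hM3 u
      split_ifs with hh <;> simp [hh]
      omega
    split_ifs with hc
    · obtain ⟨M'', a1, a2, a3, a4⟩ := run_markNeighbours (v := v) hp hG hZ h1' h4'
        (M := M') hM' hMc' (hiff.1 hc)
      refine ⟨M'', hMM.trans a1, a2, a3, fun z hz hzu w hw hadj => ?_⟩
      rcases Nat.lt_succ_iff_lt_or_eq.1 hzu with hlt | heq
      · exact a1 (hu' z hz hlt w hw hadj)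
      · obtain rfl := Fin.ext heq
        exact a4 w hw hadj
    · refine ⟨M', hMM, hMc', hM', fun z hz hzu => ?_⟩
      rcases Nat.lt_succ_iff_lt_or_eq.1 hzu with hlt | heq
      · exact hu' z hz hlt
      · obtain rfl := Fin.ext heq
        exact absurd (hiff.2 (hMM hz)) hc

/-- In each of the `n` rounds the marking grows or is already complete. -/
lemma run_markComponent (hp : n ≤ p) (hG : HoldsGraph G mem)
    (hZ : ∀ u, u ∈ Z ↔ row n mem p u = 0) (hM3 : ∀ u, row n mem p u ≤ 2)
    {h : RamState} (h1 : h.reg 1 = p) (hM : IsMarked n p mem {v} h.mem) :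
    IsMarked n p mem (component G Z v) (markComponent.run n h).mem := by
  have key := run_forN (n := n) (x := 3) (h := h) (p := forN 4 (ifMarked 4 markNeighbours))
    (fun i h' => ∃ M, v ∈ M ∧ M ⊆ component G Z v ∧ IsMarked n p mem M h'.mem ∧
      (i < M.card ∨ M = component G Z v))
    ⟨{v}, by simp, by simpa using mem_component_self, hM, by simp⟩ ?_
  · obtain ⟨M, -, -, h3, h4⟩ := key
    rcases h4 with h4 | rfl
    · have := Finset.card_le_univ M
      rw [Fintype.card_fin] at this
      omega
    · exact h3
  · rintro i h' hfr ⟨M, hvM, hMc, hM', hcard⟩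
    have h1' : (h'.setReg 3 i).reg 1 = p := by simpa using (hfr 1 rfl).trans h1
    obtain ⟨M', a1, a2, a3, a4⟩ := run_markRound (v := v) hp hG hZ h1' (M := M) hM' hM3 hMc
    refine ⟨M', a1 hvM, a2, a3, ?_⟩
    rcases hcard with hcard | rfl
    · by_cases hMM : M = M'
      · right
        subst hMM
        refine Finset.Subset.antisymm a2 fun u hu => ?_
        exact component_induction (P := (· ∈ M)) hvM (fun a b _ ha hb hab => a4 a ha b hb hab) u hu
      · left
        have := Finset.card_lt_card (Finset.ssubset_iff_subset_ne.2 ⟨a1, hMM⟩)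
        omega
    · exact Or.inr (Finset.Subset.antisymm a2 a1)

end Mark

/-! ### Solving a component -/

section Solve

variable {n c : ℕ} {G : SimpleGraph (Fin n)} {K : Finset (Fin n)}

lemma childRow_ne {n c : ℕ} (x : Fin n) : childRow n c x ≠ n + c := by
  have : c ≤ c * n := Nat.le_mul_of_pos_right c x.pos
  unfold childRow
  omega

/-- The value of a branch with the solution `τ` for the component `K`. -/
def branchValue (K : Finset (Fin n)) (τ : Fin n → ℕ) : ℕ := 1 + ∑ u ∈ K, (τ u - 1)

lemma branchValue_eq {τ : Fin n → ℕ} (hτ : ∀ u, τ u ≤ 2) :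
    branchValue K τ = 1 + (K.filter fun u => τ u = 2).card := by
  rw [branchValue, Finset.card_filter]
  congr 1
  refine Finset.sum_congr rfl fun u _ => ?_
  have := hτ u
  split_ifs <;> omega

lemma sum_filter_lt_succ (f : Fin n → ℕ) (i : Fin n) :
    ∑ u ∈ K.filter (fun u => u.val < i.val + 1), f u =
      (∑ u ∈ K.filter (fun u => u.val < i.val), f u) + if i ∈ K then f i else 0 := by
  split_ifs with hi
  · have : K.filter (fun u => u.val < i.val + 1) =
        insert i (K.filter fun u => u.val < i.val) := by
      ext u
      simp only [Finset.mem_filter, Finset.mem_insert, Nat.lt_succ_iff_lt_or_eq, ← Fin.ext_iff]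
      constructor
      · rintro ⟨h1, h2 | h2⟩
        exacts [Or.inr ⟨h1, h2⟩, Or.inl h2]
      · rintro (rfl | h)
        exacts [⟨hi, Or.inr rfl⟩, ⟨h.1, Or.inl h.2⟩]
    rw [this, Finset.sum_insert (by simp), add_comm]
  · rw [add_zero]
    congr 1
    ext u
    simp only [Finset.mem_filter, Nat.lt_succ_iff_lt_or_eq, ← Fin.ext_iff]
    refine and_congr_right fun hu => ⟨fun h => h.resolve_right ?_, Or.inl⟩
    rintro rfl
    exact hi hu

lemma run_evalBranch {h : RamState} {x : Fin n} (h1 : h.reg 1 = n + c) (h7 : h.reg 7 = x)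
    (hK : ∀ u, u ∈ K ↔ 2 < row n h.mem (n + c) u) :
    ((evalBranch.run n h).reg 8 ≠ 0 ↔
      h.reg 8 ≠ 0 ∧ ∀ u ∈ K, row n h.mem (childRow n c x) u ≠ 0) ∧
    (evalBranch.run n h).reg 9 =
      max (h.reg 9) (branchValue K (row n h.mem (childRow n c x))) ∧
    (evalBranch.run n h).reg 10 =
      if h.reg 9 < branchValue K (row n h.mem (childRow n c x)) then (x : ℕ) else h.reg 10 := by
  set τ := row n h.mem (childRow n c x) with hτ
  set q := forN 4 (ifMarked 4 (ite (.cell (.child (.var 1) (.var 7)) (.var 4))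
      (set 11 (.add (.var 11) (.sub (.cell (.child (.var 1) (.var 7)) (.var 4)) (.const 1))))
      (set 8 (.const 0)))) with hq
  have key : ((q.run n (h.setReg 11 1)).reg 8 ≠ 0 ↔
        h.reg 8 ≠ 0 ∧ ∀ u ∈ K, u.val < n → τ u ≠ 0) ∧
      (q.run n (h.setReg 11 1)).reg 11 = 1 + ∑ u ∈ K.filter (fun u => u.val < n), (τ u - 1) ∧
      (q.run n (h.setReg 11 1)).mem = h.mem := by
    refine run_forN (fun i h' => (h'.reg 8 ≠ 0 ↔ h.reg 8 ≠ 0 ∧ ∀ u ∈ K, u.val < i → τ u ≠ 0) ∧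
      h'.reg 11 = 1 + ∑ u ∈ K.filter (fun u => u.val < i), (τ u - 1) ∧ h'.mem = h.mem)
      (by simp) ?_
    rintro u h' hfr ⟨a1, a2, a3⟩
    have h1' : (h'.setReg 4 u).reg 1 = n + c := by simpa [h1] using hfr 1 rfl
    have h7' : (h'.setReg 4 u).reg 7 = x := by simpa [h7] using hfr 7 rfl
    have h4' : (h'.setReg 4 u).reg 4 = u := by simp
    have e : (LoopExpr.cell (.child (.var 1) (.var 7)) (.var 4)).eval n (h'.setReg 4 u) = τ u := by
      rw [LoopExpr.eval_cell (LoopExpr.eval_child (a := .var 1) (b := .var 7) h1' h7') (b := .var 4) h4', RamState.setReg_mem, a3]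
    have hlt : (∀ z ∈ K, z.val < u.val + 1 → τ z ≠ 0) ↔
        (∀ z ∈ K, z.val < u.val → τ z ≠ 0) ∧ (u ∈ K → τ u ≠ 0) := by
      constructor
      · exact fun hh => ⟨fun z hz hzu => hh z hz (by omega), fun hu => hh u hu (by omega)⟩
      · rintro ⟨hh, hu⟩ z hz hzu
        rcases Nat.lt_succ_iff_lt_or_eq.1 hzu with hlt | heq
        · exact hh z hz hlt
        · obtain rfl := Fin.ext heq
          exact hu hz
    rw [run_ifMarked_iff (P := u ∈ K) h1' h4' (by rw [RamState.setReg_mem, a3, ← hK]),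
      sum_filter_lt_succ, hlt]
    by_cases hu : u ∈ K
    · rw [if_pos hu, if_pos hu]
      by_cases h0 : τ u = 0
      · rw [run_ite_neg (e.trans h0)]
        simp [LoopProg.run, LoopExpr.eval, hu, h0, a2, a3]
      · rw [run_ite_pos (by rwa [e])]
        have a1' : h'.reg 8 = 0 ↔ ¬ (h.reg 8 ≠ 0 ∧ ∀ u_1 ∈ K, u_1.val < u.val → τ u_1 ≠ 0) := by
          rw [← a1, not_not]
        simp only [LoopProg.run, LoopExpr.eval, e]
        simp [hu, h0, a2, a3, a1', add_assoc]
    · rw [if_neg hu, if_neg hu]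
      have a1' : h'.reg 8 = 0 ↔ ¬ (h.reg 8 ≠ 0 ∧ ∀ u_1 ∈ K, u_1.val < u.val → τ u_1 ≠ 0) := by
        rw [← a1, not_not]
      simp [hu, a2, a3, a1']
  have hfr : ∀ r, r ≠ 11 → r ≠ 8 → r ≠ 4 → (q.run n (h.setReg 11 1)).reg r = h.reg r := by
    intro r ha hb hc
    rw [run_reg]
    · simp [ha]
    · simp [hq, writes, ifMarked, ha, hb, hc]
  obtain ⟨k8, k11, kmem⟩ := key
  have hfil : K.filter (fun u => u.val < n) = K := by ext u; simp
  rw [hfil] at k11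
  have hrun : evalBranch.run n h = (ite (.sub (.var 11) (.var 9))
      (seq (set 9 (.var 11)) (set 10 (.var 7))) skip).run n (q.run n (h.setReg 11 1)) := rfl
  have k9 := hfr 9 (by norm_num) (by norm_num) (by norm_num)
  have k10 := hfr 10 (by norm_num) (by norm_num) (by norm_num)
  have k7 := hfr 7 (by norm_num) (by norm_num) (by norm_num)
  have k8' : (q.run n (h.setReg 11 1)).reg 8 ≠ 0 ↔ h.reg 8 ≠ 0 ∧ ∀ u ∈ K, τ u ≠ 0 := by
    rw [k8]; simp
  have k11' : (q.run n (h.setReg 11 1)).reg 11 = branchValue K τ := k11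
  rw [hrun]
  by_cases hc : h.reg 9 < branchValue K τ
  · rw [run_ite_pos (by simp only [LoopExpr.eval, k11', k9]; omega)]
    refine ⟨?_, ?_, ?_⟩
    · rw [← k8']; simp [LoopProg.run]
    · simp [LoopProg.run, LoopExpr.eval, k11', hc.le]
    · simp [LoopProg.run, LoopExpr.eval, k7, h7, hc]
  · rw [run_ite_neg (by simp only [LoopExpr.eval, k11', k9]; omega)]
    refine ⟨k8', ?_, ?_⟩
    · simp [LoopProg.run, k9, not_lt.1 hc]
    · simp [LoopProg.run, k10, hc]

/-- All branches at the vertex `y` of the component `K` of node `c` are solved. -/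
def BranchesSolved (G : SimpleGraph (Fin n)) (c : ℕ) (K : Finset (Fin n)) (mem : ℕ → ℕ)
    (y : Fin n) : Prop :=
  ∀ x ∈ K, x ∈ closedNbhd G y → ∀ u ∈ K, row n mem (childRow n c x) u ≠ 0

/-- The branch `x` at the vertex `y` has the largest value. -/
structure IsBestBranch (G : SimpleGraph (Fin n)) (c : ℕ) (K : Finset (Fin n)) (mem : ℕ → ℕ)
    (y x : Fin n) : Prop where
  mem_component : x ∈ K
  mem_closedNbhd : x ∈ closedNbhd G y
  le : ∀ x' ∈ K, x' ∈ closedNbhd G y →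
    branchValue K (row n mem (childRow n c x')) ≤ branchValue K (row n mem (childRow n c x))

lemma run_evalBranches {h : RamState} {y : Fin n} (hG : HoldsGraph G h.mem)
    (h1 : h.reg 1 = n + c) (h6 : h.reg 6 = y)
    (hK : ∀ u, u ∈ K ↔ 2 < row n h.mem (n + c) u) (hy : y ∈ K) :
    ((evalBranches.run n h).reg 8 ≠ 0 ↔ BranchesSolved G c K h.mem y) ∧
    ∃ x : Fin n, (evalBranches.run n h).reg 10 = x ∧ IsBestBranch G c K h.mem y x := by
  set val : Fin n → ℕ := fun x => branchValue K (row n h.mem (childRow n c x)) with hval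
  set q := forN 7 (ifMarked 7 (ite (.add (.cell (.var 6) (.var 7)) (.eq (.var 6) (.var 7)))
      evalBranch skip)) with hq
  let I : ℕ → RamState → Prop := fun i h' => (h'.reg 8 ≠ 0 ↔ ∀ x ∈ K, x ∈ closedNbhd G y →
        x.val < i → ∀ u ∈ K, row n h.mem (childRow n c x) u ≠ 0) ∧
      (∀ x ∈ K, x ∈ closedNbhd G y → x.val < i → val x ≤ h'.reg 9) ∧
      (h'.reg 9 = 0 ∨ ∃ x ∈ K, x ∈ closedNbhd G y ∧ h'.reg 10 = x ∧ h'.reg 9 = val x) ∧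
      h'.mem = h.mem
  have key : I n (q.run n ((h.setReg 8 1).setReg 9 0)) := by
    refine run_forN I ?_ ?_
    · simp [I]
    rintro x h' hfr ⟨a1, a2, a3, a4⟩
    have h1' : (h'.setReg 7 x).reg 1 = n + c := by simpa [h1] using hfr 1 rfl
    have h6' : (h'.setReg 7 x).reg 6 = y := by simpa [h6] using hfr 6 rfl
    have h7' : (h'.setReg 7 x).reg 7 = x := by simp
    -- If the branch is not evaluated, then it does not belong to the branches at `y`.
    have stay (hn : ¬ (x ∈ K ∧ x ∈ closedNbhd G y)) :
        ((h'.setReg 7 x).reg 8 ≠ 0 ↔ ∀ z ∈ K, z ∈ closedNbhd G y →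
          z.val < x.val + 1 → ∀ u ∈ K, row n h.mem (childRow n c z) u ≠ 0) ∧
        (∀ z ∈ K, z ∈ closedNbhd G y → z.val < x.val + 1 → val z ≤ (h'.setReg 7 x).reg 9) ∧
        ((h'.setReg 7 x).reg 9 = 0 ∨
          ∃ z ∈ K, z ∈ closedNbhd G y ∧ (h'.setReg 7 x).reg 10 = z ∧
            (h'.setReg 7 x).reg 9 = val z) ∧
        (h'.setReg 7 x).mem = h.mem := by
      have hlt (z : Fin n) (hz : z ∈ K) (hz' : z ∈ closedNbhd G y) (hzx : z.val < x.val + 1) :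
          z.val < x.val := by
        rcases Nat.lt_succ_iff_lt_or_eq.1 hzx with hlt | heq
        · exact hlt
        · obtain rfl := Fin.ext heq
          exact absurd ⟨hz, hz'⟩ hn
      refine ⟨?_, fun z hz hz' hzx => ?_, ?_, a4⟩
      · refine Iff.trans (by simp) (a1.trans ⟨fun hh z hz hz' hzx => ?_, fun hh z hz hz' hzx => ?_⟩)
        · exact hh z hz hz' (hlt z hz hz' hzx)
        · exact hh z hz hz' (by omega)
      · simpa using a2 z hz hz' (hlt z hz hz' hzx)
      · simpa using a3
    rw [run_ifMarked_iff (P := x ∈ K) h1' h7' (by rw [RamState.setReg_mem, a4, ← hK])]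
    by_cases hx : x ∈ K
    swap
    · rw [if_neg hx]
      exact stay fun hh => hx hh.1
    rw [if_pos hx]
    have hA := hG y x
    have e : ((LoopExpr.cell (.var 6) (.var 7)).add (.eq (.var 6) (.var 7))).eval n
        (h'.setReg 7 x) = row n h.mem y x + if y = x then 1 else 0 := by
      simp only [LoopExpr.eval]
      rw [LoopExpr.eval_cell (a := .var 6) (b := .var 7) h6' h7',
        LoopExpr.eval_eq (a := .var 6) (b := .var 7) h6' h7', RamState.setReg_mem, a4]
    have hiff : row n h.mem y x + (if y = x then 1 else 0) ≠ 0 ↔ x ∈ closedNbhd G y := by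
      rw [mem_closedNbhd, ← hA]
      by_cases hyx : y = x
      · simp [hyx]
      · simp [hyx, Ne.symm hyx]
    by_cases hxy : x ∈ closedNbhd G y
    swap
    · rw [run_ite_neg (by rw [e]; by_contra hh; exact hxy (hiff.1 hh))]
      exact stay fun hh => hxy hh.2
    rw [run_ite_pos (by rw [e]; exact hiff.2 hxy)]
    obtain ⟨b8, b9, b10⟩ := run_evalBranch (h := h'.setReg 7 x) (K := K) h1' h7'
      (by simpa [a4] using hK)
    rw [RamState.setReg_mem, a4] at b8 b9 b10
    have r9 : (h'.setReg 7 x).reg 9 = h'.reg 9 := by simp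
    have r8 : (h'.setReg 7 x).reg 8 = h'.reg 8 := by simp
    have r10 : (h'.setReg 7 x).reg 10 = h'.reg 10 := by simp
    rw [r9] at b9 b10
    rw [r8, a1] at b8
    rw [r10] at b10
    refine ⟨b8.trans ⟨fun hh z hz hz' hzx => ?_, fun hh => ⟨fun z hz hz' hzx => ?_, ?_⟩⟩, ?_, ?_, ?_⟩
    · rcases Nat.lt_succ_iff_lt_or_eq.1 hzx with hlt | heq
      · exact hh.1 z hz hz' hlt
      · obtain rfl := Fin.ext heq
        exact hh.2
    · exact hh z hz hz' (by omega)
    · exact hh x hx hxy (by omega)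
    · intro z hz hz' hzx
      rw [b9]
      rcases Nat.lt_succ_iff_lt_or_eq.1 hzx with hlt | heq
      · exact (a2 z hz hz' hlt).trans (le_max_left _ _)
      · obtain rfl := Fin.ext heq
        exact le_max_right _ _
    · right
      by_cases hc : h'.reg 9 < val x
      · refine ⟨x, hx, hxy, ?_, ?_⟩
        · rw [b10, if_pos hc]
        · rw [b9, max_eq_right hc.le]
      · have hv : 0 < val x := by simp only [hval, branchValue]; omega
        obtain ⟨z, hz, hz', c10, c9⟩ := a3.resolve_left (by omega)
        refine ⟨z, hz, hz', ?_, ?_⟩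
        · rw [b10, if_neg hc, c10]
        · rw [b9, max_eq_left (not_lt.1 hc), c9]
    · rw [run_mem rfl]; exact a4
  obtain ⟨k8, k9, k10, -⟩ := key
  have hrun : evalBranches.run n h = q.run n ((h.setReg 8 1).setReg 9 0) := rfl
  rw [hrun]
  refine ⟨k8.trans ⟨fun hh x hx hx' => hh x hx hx' x.2, fun hh x hx hx' _ => hh x hx hx'⟩, ?_⟩
  have hpos : val y ≤ _ := k9 y hy (by simp) y.2
  have hv : 0 < val y := by simp only [hval, branchValue]; omega
  obtain ⟨x, hx, hx', c10, c9⟩ := k10.resolve_left (by omega)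
  exact ⟨x, c10, hx, hx', fun z hz hz' => by have := k9 z hz hz' z.2; rwa [c9] at this⟩

lemma run_copyBest {h : RamState} {x : Fin n} (h1 : h.reg 1 = n + c) (h10 : h.reg 10 = x)
    (hx : x ∈ K) (hK : ∀ u, u ∈ K ↔ 2 < row n h.mem (n + c) u) :
    AgreeOffRow n (n + c) h.mem (copyBest.run n h).mem ∧
    row n (copyBest.run n h).mem (n + c) = fun u => if u ∈ K then
      (if u = x then 2 else row n h.mem (childRow n c x) u) else row n h.mem (n + c) u := by
  set q := forN 4 (ifMarked 4
    (setCell (.var 1) (.var 4) (.cell (.child (.var 1) (.var 10)) (.var 4)))) with hq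
  let I : ℕ → RamState → Prop := fun i h' => AgreeOffRow n (n + c) h.mem h'.mem ∧
      ∀ u, row n h'.mem (n + c) u = if u ∈ K ∧ u.val < i then row n h.mem (childRow n c x) u
        else row n h.mem (n + c) u
  have key : I n (q.run n h) := by
    refine run_forN I ?_ ?_
    · exact ⟨fun _ _ => rfl, by simp⟩
    rintro u h' hfr ⟨a1, a2⟩
    have h1' : (h'.setReg 4 u).reg 1 = n + c := by simpa [h1] using hfr 1 rfl
    have h10' : (h'.setReg 4 u).reg 10 = x := by simpa [h10] using hfr 10 rfl
    have h4' : (h'.setReg 4 u).reg 4 = u := by simp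
    have e : (LoopExpr.cell (.child (.var 1) (.var 10)) (.var 4)).eval n (h'.setReg 4 u) =
        row n h.mem (childRow n c x) u := by
      rw [LoopExpr.eval_cell (LoopExpr.eval_child (a := .var 1) (b := .var 10) h1' h10') (b := .var 4) h4', RamState.setReg_mem,
        a1 _ (childRow_ne x)]
    rw [run_ifMarked_iff (P := u ∈ K) h1' h4'
      (by rw [RamState.setReg_mem, a2 u, if_neg (by simp), ← hK])]
    split_ifs with hu
    · rw [run_setCell (a := .var 1) (b := .var 4) h1' h4', e]
      refine ⟨AgreeOffRow.setMem (h := h'.setReg 4 u) a1 u _, fun z => ?_⟩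
      rw [row_setMem]
      by_cases hzu : z = u
      · subst hzu
        simp [hu]
      · have : z.val < u.val + 1 ↔ z.val < u.val := by
          have : z.val ≠ u.val := fun hh => hzu (Fin.ext hh)
          omega
        rw [if_neg fun hh => hzu hh.2]
        simp only [this]
        exact a2 z
    · refine ⟨a1, fun z => ?_⟩
      have : (z ∈ K ∧ z.val < u.val + 1) ↔ (z ∈ K ∧ z.val < u.val) := by
        refine and_congr_right fun hz => ?_
        have : z.val ≠ u.val := fun hh => hu (Fin.ext hh ▸ hz)
        omega
      simp only [this]
      exact a2 z
  obtain ⟨k1, k2⟩ := key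
  have h1' : (q.run n h).reg 1 = n + c := by rw [run_reg rfl, h1]
  have h10' : (q.run n h).reg 10 = x := by rw [run_reg rfl, h10]
  have hrun : copyBest.run n h = (setCell (.var 1) (.var 10) (.const 2)).run n (q.run n h) := rfl
  rw [hrun, run_setCell (a := .var 1) (b := .var 10) h1' h10']
  refine ⟨k1.setMem x _, ?_⟩
  ext u
  rw [row_setMem]
  by_cases hux : u = x
  · subst hux
    simp [hx, LoopExpr.eval]
  · rw [if_neg fun hh => hux hh.2, k2 u]
    simp [hux]

/-- The result of the search for a vertex to branch at: either all vertices fail, or the solution of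
the best branch at some vertex has been copied. -/
lemma run_tryVertices {h : RamState} (hG : HoldsGraph G h.mem) (h1 : h.reg 1 = n + c)
    (hK : ∀ u, u ∈ K ↔ 2 < row n h.mem (n + c) u)
    (hτ : ∀ (x u : Fin n), row n h.mem (childRow n c x) u ≤ 2) :
    AgreeOffRow n (n + c) h.mem (tryVertices.run n h).mem ∧
    ((row n (tryVertices.run n h).mem (n + c) = row n h.mem (n + c) ∧
        ∀ y ∈ K, ¬ BranchesSolved G c K h.mem y) ∨
      ∃ y x, y ∈ K ∧ BranchesSolved G c K h.mem y ∧ IsBestBranch G c K h.mem y x ∧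
        row n (tryVertices.run n h).mem (n + c) = fun u => if u ∈ K then
          (if u = x then 2 else row n h.mem (childRow n c x) u) else row n h.mem (n + c) u) := by
  let I : ℕ → RamState → Prop := fun i h' => AgreeOffRow n (n + c) h.mem h'.mem ∧
    ((row n h'.mem (n + c) = row n h.mem (n + c) ∧
        ∀ y ∈ K, y.val < i → ¬ BranchesSolved G c K h.mem y) ∨
      ∃ y x, y ∈ K ∧ BranchesSolved G c K h.mem y ∧ IsBestBranch G c K h.mem y x ∧
        row n h'.mem (n + c) = fun u => if u ∈ K then
          (if u = x then 2 else row n h.mem (childRow n c x) u) else row n h.mem (n + c) u)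
  have key : I n (tryVertices.run n h) := by
    refine run_forN I ?_ ?_
    · exact ⟨fun _ _ => rfl, by simp⟩
    rintro y h' hfr ⟨a1, a2⟩
    have h1' : (h'.setReg 6 y).reg 1 = n + c := by simpa [h1] using hfr 1 rfl
    have h6' : (h'.setReg 6 y).reg 6 = y := by simp
    have hchild (x : Fin n) : row n h'.mem (childRow n c x) = row n h.mem (childRow n c x) :=
      a1 _ (childRow_ne x)
    rcases a2 with ⟨a2, a3⟩ | ⟨y', x, b1, b2, b3, b4⟩
    · rw [run_ifMarked_iff (P := y ∈ K) h1' h6' (by rw [RamState.setReg_mem, a2, ← hK])]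
      by_cases hy : y ∈ K
      swap
      · rw [if_neg hy]
        refine ⟨a1, Or.inl ⟨a2, fun z hz hzy => ?_⟩⟩
        rcases Nat.lt_succ_iff_lt_or_eq.1 hzy with hlt | heq
        · exact a3 z hz hlt
        · obtain rfl := Fin.ext heq
          exact absurd hz hy
      rw [if_pos hy]
      have hK' : ∀ u, u ∈ K ↔ 2 < row n (h'.setReg 6 y).mem (n + c) u := by
        simpa [a2] using hK
      obtain ⟨c1, x, c2, c3⟩ := run_evalBranches (h := h'.setReg 6 y)
        (hG.agree (by omega) a1) h1' h6' hK' hy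
      have c1' : BranchesSolved G c K (h'.setReg 6 y).mem y ↔ BranchesSolved G c K h.mem y := by
        simp only [BranchesSolved, RamState.setReg_mem, hchild]
      have c3' : IsBestBranch G c K h.mem y x :=
        ⟨c3.mem_component, c3.mem_closedNbhd, by simpa only [RamState.setReg_mem, hchild] using c3.le⟩
      set g := evalBranches.run n (h'.setReg 6 y) with hg
      have hgm : g.mem = h'.mem := run_mem rfl _
      have hrun : (seq evalBranches (ite (.var 8) copyBest skip)).run n (h'.setReg 6 y) =
        (ite (.var 8) copyBest skip).run n g := rfl
      rw [hrun]
      by_cases hs : BranchesSolved G c K h.mem y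
      · rw [run_ite_pos (e := .var 8) (c1.2 (c1'.2 hs))]
        obtain ⟨d1, d2⟩ := run_copyBest (K := K) (h := g) (x := x) (c := c)
          ((run_reg rfl _).trans h1') c2 c3.mem_component (by rw [hgm]; simpa [a2] using hK)
        rw [hgm] at d1 d2
        rw [hchild, a2] at d2
        exact ⟨fun i hi => (d1 i hi).trans (a1 i hi), Or.inr ⟨y, x, hy, hs, c3', d2⟩⟩
      · rw [run_ite_neg (by by_contra hh; exact hs (c1'.1 (c1.1 hh)))]
        refine ⟨by rw [LoopProg.run, hgm]; exact a1,
          Or.inl ⟨by rw [LoopProg.run, hgm]; exact a2, fun z hz hzy => ?_⟩⟩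
        rcases Nat.lt_succ_iff_lt_or_eq.1 hzy with hlt | heq
        · exact a3 z hz hlt
        · obtain rfl := Fin.ext heq
          exact hs
    · -- After the component has been solved there are no marks left.
      have hno : ¬ 2 < row n h'.mem (n + c) y := by
        rw [b4]
        have := hτ x y
        have := hK y
        dsimp only
        split_ifs with e1 e2
        · omega
        · omega
        · rwa [← this]
      rw [run_ifMarked h1' h6', if_neg (by simpa using hno)]
      exact ⟨a1, Or.inr ⟨y', x, b1, b2, b3, b4⟩⟩
  obtain ⟨k1, k2⟩ := key
  refine ⟨k1, k2.imp_left fun k2 => ⟨k2.1, fun y hy => k2.2 y hy y.2⟩⟩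

lemma run_unmark {h : RamState} {p : ℕ} (h1 : h.reg 1 = p) :
    AgreeOffRow n p h.mem (unmark.run n h).mem ∧
    row n (unmark.run n h).mem p = fun u => if 2 < row n h.mem p u then 0 else row n h.mem p u := by
  let I : ℕ → RamState → Prop := fun i h' => AgreeOffRow n p h.mem h'.mem ∧
      ∀ u, row n h'.mem p u = if 2 < row n h.mem p u ∧ u.val < i then 0 else row n h.mem p u
  have key : I n (unmark.run n h) := by
    refine run_forN I ?_ ?_
    · exact ⟨fun _ _ => rfl, by simp⟩
    rintro u h' hfr ⟨a1, a2⟩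
    have h1' : (h'.setReg 4 u).reg 1 = p := by simpa [h1] using hfr 1 rfl
    have h4' : (h'.setReg 4 u).reg 4 = u := by simp
    rw [run_ifMarked_iff (P := 2 < row n h.mem p u) h1' h4'
      (by rw [RamState.setReg_mem, a2 u, if_neg (by simp)])]
    split_ifs with hu
    · rw [run_setCell (a := .var 1) (b := .var 4) h1' h4']
      refine ⟨AgreeOffRow.setMem (h := h'.setReg 4 u) a1 u _, fun z => ?_⟩
      rw [row_setMem]
      by_cases hzu : z = u
      · subst hzu
        simp [hu, LoopExpr.eval]
      · have : z.val < u.val + 1 ↔ z.val < u.val := by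
          have : z.val ≠ u.val := fun hh => hzu (Fin.ext hh)
          omega
        rw [if_neg fun hh => hzu hh.2]
        simp only [this]
        exact a2 z
    · refine ⟨a1, fun z => ?_⟩
      have : (2 < row n h.mem p z ∧ z.val < u.val + 1) ↔
          (2 < row n h.mem p z ∧ z.val < u.val) := by
        refine and_congr_right fun hz => ?_
        have : z.val ≠ u.val := fun hh => hu (Fin.ext hh ▸ hz)
        omega
      simp only [this]
      exact a2 z
  exact ⟨key.1, funext fun u => by simpa using key.2 u⟩

/-- One attempt to solve the component of `v` keeps the partial solution correct, and it succeeds if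
all branches at some vertex of the component are solved. -/
lemma run_solveComponent {h : RamState} {W : Finset (Fin n)} {v : Fin n}
    (hG : HoldsGraph G h.mem) (h1 : h.reg 1 = n + c) (h2 : h.reg 2 = v)
    (hσ : IsPartialSolution G W (row n h.mem (n + c)))
    (hτ : ∀ x : Fin n, IsPartialSolution G (W \ closedNbhd G x) (row n h.mem (childRow n c x)))
    (hv : row n h.mem (n + c) v = 0) :
    AgreeOffRow n (n + c) h.mem (solveComponent.run n h).mem ∧
    IsPartialSolution G W (row n (solveComponent.run n h).mem (n + c)) ∧
    (∀ u, row n h.mem (n + c) u ≠ 0 → row n (solveComponent.run n h).mem (n + c) u ≠ 0) ∧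
    ((∃ y ∈ component G W v, BranchesSolved G c (component G W v) h.mem y) →
      row n (solveComponent.run n h).mem (n + c) v ≠ 0) := by
  set σ := row n h.mem (n + c) with hσ'
  set Z : Finset (Fin n) := Finset.univ.filter fun u => σ u = 0 with hZ
  have memZ : ∀ u, u ∈ Z ↔ σ u = 0 := by simp [hZ]
  -- The unsolved vertices form a union of components of `W`.
  have hZW : IsSeparatedIn G Z W := by
    refine ⟨fun u hu => ?_, fun a ha b hb hab => ?_⟩
    · by_contra hW
      have := hσ.eq_one u hW
      rw [(memZ u).1 hu] at this
      omega
    · have haW : a ∈ W := by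
        by_contra hW
        have := hσ.eq_one a hW
        rw [(memZ a).1 ha] at this
        omega
      rw [memZ]
      by_contra hh
      exact hσ.ne_zero_of_adj b hb a haW hab.symm hh ((memZ a).1 ha)
  have hvZ : v ∈ Z := (memZ v).2 hv
  have hKeq : component G Z v = component G W v := hZW.component_eq hvZ
  set K := component G W v with hK
  have hKZ : K ⊆ Z := hKeq ▸ component_subset hvZ
  have hKW : IsSeparatedIn G K W := component_isSeparatedIn (hZW.subset hvZ)
  set g₁ := (setCell (.var 1) (.var 2) (.const 3)).run n h with hg₁
  have hg₁' : g₁ = h.setMem (1 + (n + c) * n + v) 3 :=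
    run_setCell (a := .var 1) (b := .var 2) h1 h2
  have hm₁ : IsMarked n (n + c) h.mem {v} g₁.mem := by
    rw [hg₁']
    refine ⟨AgreeOffRow.setMem (fun _ _ => rfl) v 3, fun u => ?_⟩
    rw [row_setMem]
    simp
  set g₂ := markComponent.run n g₁ with hg₂
  have hm₂ : IsMarked n (n + c) h.mem K g₂.mem :=
    hKeq ▸ run_markComponent (Nat.le_add_right n c) hG memZ hσ.le_two
      ((run_reg rfl _).trans h1) hm₁
  have hKm : ∀ u, u ∈ K ↔ 2 < row n g₂.mem (n + c) u := by
    intro u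
    rw [hm₂.row_eq]
    have := hσ.le_two u
    split_ifs with hu
    · simp [hu]
    · simp only [hu, false_iff, not_lt]; exact this
  have hchild (x : Fin n) : row n g₂.mem (childRow n c x) = row n h.mem (childRow n c x) :=
    hm₂.agree _ (childRow_ne x)
  have h1₂ : g₂.reg 1 = n + c := (run_reg rfl _).trans ((run_reg rfl _).trans h1)
  obtain ⟨t1, t2⟩ := run_tryVertices (h := g₂) (K := K) (hG.agree (Nat.le_add_right n c) hm₂.agree)
    h1₂ hKm fun x u => by rw [hchild]; exact (hτ x).le_two u
  set g₃ := tryVertices.run n g₂ with hg₃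
  obtain ⟨u1, u2⟩ := run_unmark (n := n) (h := g₃) (p := n + c) ((run_reg rfl _).trans h1₂)
  have hrun : solveComponent.run n h = unmark.run n g₃ := rfl
  rw [hrun]
  have hsolved (y : Fin n) : BranchesSolved G c K g₂.mem y ↔ BranchesSolved G c K h.mem y := by
    simp only [BranchesSolved, hchild]
  refine ⟨fun i hi => (u1 i hi).trans ((t1 i hi).trans (hm₂.agree i hi)), ?_⟩
  rcases t2 with ⟨t2, t3⟩ | ⟨y, x, hy, hs, hb, t2⟩
  · have hfin : row n (unmark.run n g₃).mem (n + c) = σ := by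
      rw [u2, t2]
      ext u
      by_cases hu : u ∈ K
      · rw [if_pos ((hKm u).1 hu)]
        exact ((memZ u).1 (hKZ hu)).symm
      · rw [if_neg fun hh => hu ((hKm u).2 hh), hm₂.row_eq, if_neg hu]
    rw [hfin]
    refine ⟨hσ, fun u hu => hu, ?_⟩
    rintro ⟨y, hy, hs⟩
    exact absurd ((hsolved y).2 hs) (t3 y hy)
  · have hupd := hσ.update hKW (τ := fun x => row n h.mem (childRow n c x)) hτ hy hb.mem_component
      ((hsolved y).1 hs) hb.mem_closedNbhd fun z hz hz' => by
        have := hb.le z hz hz'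
        rw [hchild, hchild, branchValue_eq (hτ z).le_two, branchValue_eq (hτ x).le_two] at this
        omega
    have hfin : row n (unmark.run n g₃).mem (n + c) =
        fun u => if u ∈ K then (if u = x then 2 else row n h.mem (childRow n c x) u) else σ u := by
      have hrow : row n g₃.mem (n + c) =
          fun u => if u ∈ K then (if u = x then 2 else row n h.mem (childRow n c x) u)
            else σ u := by
        rw [t2, hchild]
        ext u
        split_ifs with e1
        · rfl
        · rfl
        · rw [hm₂.row_eq, if_neg e1]
      rw [u2]
      ext u
      rw [if_neg, hrow]
      rw [hrow, not_lt]
      exact hupd.le_two u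
    have hKnz (u : Fin n) (hu : u ∈ K) :
        row n (unmark.run n g₃).mem (n + c) u ≠ 0 := by
      rw [hfin]
      dsimp only
      rw [if_pos hu]
      split_ifs
      · norm_num
      · exact (hsolved y).1 hs x hb.mem_component hb.mem_closedNbhd u hu
    refine ⟨hfin ▸ hupd, fun u hu => ?_, fun _ => hKnz v mem_component_self⟩
    rw [hfin]
    dsimp only
    rw [if_neg]
    · exact hu
    · exact fun hh => hu ((memZ u).1 (hKZ hh))

/-- A pass over the row of node `c` keeps the partial solution correct and solves all components with
a vertex at which all branches are solved. -/
lemma run_solveRow {h : RamState} {W : Finset (Fin n)}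
    (hG : HoldsGraph G h.mem) (h1 : h.reg 1 = n + c)
    (hσ : IsPartialSolution G W (row n h.mem (n + c)))
    (hτ : ∀ x : Fin n, IsPartialSolution G (W \ closedNbhd G x) (row n h.mem (childRow n c x))) :
    AgreeOffRow n (n + c) h.mem (solveRow.run n h).mem ∧
    IsPartialSolution G W (row n (solveRow.run n h).mem (n + c)) ∧
    ∀ v, (∃ y ∈ component G W v, BranchesSolved G c (component G W v) h.mem y) →
      row n (solveRow.run n h).mem (n + c) v ≠ 0 := by
  let I : ℕ → RamState → Prop := fun i h' => AgreeOffRow n (n + c) h.mem h'.mem ∧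
      IsPartialSolution G W (row n h'.mem (n + c)) ∧
      ∀ v : Fin n, v.val < i →
        (∃ y ∈ component G W v, BranchesSolved G c (component G W v) h.mem y) →
        row n h'.mem (n + c) v ≠ 0
  have key : I n (solveRow.run n h) := by
    refine run_forN I ?_ ?_
    · exact ⟨fun _ _ => rfl, hσ, by simp⟩
    rintro v h' hfr ⟨a1, a2, a3⟩
    have h1' : (h'.setReg 2 v).reg 1 = n + c := by simpa [h1] using hfr 1 rfl
    have h2' : (h'.setReg 2 v).reg 2 = v := by simp
    have hchild (x : Fin n) : row n h'.mem (childRow n c x) = row n h.mem (childRow n c x) :=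
      a1 _ (childRow_ne x)
    have e : (LoopExpr.cell (.var 1) (.var 2)).eval n (h'.setReg 2 v) = row n h'.mem (n + c) v :=
      LoopExpr.eval_cell h1' h2'
    by_cases hv : row n h'.mem (n + c) v = 0
    · rw [run_ite_neg (e.trans hv)]
      obtain ⟨b1, b2, b3, b4⟩ := run_solveComponent (h := h'.setReg 2 v)
        (hG.agree (Nat.le_add_right n c) a1) h1' h2' a2
        (fun x => by rw [RamState.setReg_mem, hchild]; exact hτ x) hv
      refine ⟨fun i hi => (b1 i hi).trans (a1 i hi), b2, fun z hzv hz => ?_⟩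
      rcases Nat.lt_succ_iff_lt_or_eq.1 hzv with hlt | heq
      · exact b3 z (a3 z hlt hz)
      · obtain rfl := Fin.ext heq
        refine b4 ?_
        simpa only [BranchesSolved, RamState.setReg_mem, hchild] using hz
    · rw [run_ite_pos (by rwa [e])]
      refine ⟨a1, a2, fun z hzv hz => ?_⟩
      rcases Nat.lt_succ_iff_lt_or_eq.1 hzv with hlt | heq
      · exact a3 z hlt hz
      · obtain rfl := Fin.ext heq
        exact hv
  exact ⟨key.1, key.2.1, fun v => key.2.2 v v.2⟩

end Solve

/-! ### The tree of subproblems -/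

/-- The vertex set of node number `c`: the root is the whole graph, and the `x`-th child of a node
arises by the deletion of the closed neighbourhood of `x`. The children of node `c` have the numbers
`c * n + 1, …, c * n + n`. -/
noncomputable def subproblem {n : ℕ} (G : SimpleGraph (Fin n)) : ℕ → Finset (Fin n)
  | 0 => Finset.univ
  | c + 1 => if h : 0 < n then
      subproblem G (c / n) \ closedNbhd G ⟨c % n, Nat.mod_lt c h⟩ else ∅
  termination_by c => c
  decreasing_by exact Nat.lt_succ_of_le (Nat.div_le_self c n)

section Expand

variable {n : ℕ} {G : SimpleGraph (Fin n)}

lemma subproblem_zero : subproblem G 0 = Finset.univ := by rw [subproblem]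

lemma subproblem_child (c : ℕ) (x : Fin n) :
    subproblem G (c * n + x + 1) = subproblem G c \ closedNbhd G x := by
  have h1 : (c * n + x) / n = c := by
    rw [mul_comm, Nat.mul_add_div x.pos, Nat.div_eq_of_lt x.2, add_zero]
  have h2 : (c * n + x) % n = x := by
    rw [mul_comm, Nat.mul_add_mod, Nat.mod_eq_of_lt x.2]
  rw [subproblem, dif_pos x.pos]
  simp only [h1, h2]

lemma childRow_eq (c x : ℕ) : childRow n c x = n + (c * n + x + 1) := by
  unfold childRow; omega

lemma childRow_inj {c : ℕ} {x y : Fin n} (h : childRow n c x = childRow n c y) : x = y := by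
  unfold childRow at h
  exact Fin.ext (by omega)

lemma run_expandRow {h : RamState} {c : ℕ} (hG : HoldsGraph G h.mem) (h0 : h.reg 0 = n + c) :
    HoldsGraph G (expandRow.run n h).mem ∧
    (∀ i, (∀ x : Fin n, i ≠ childRow n c x) → row n (expandRow.run n h).mem i = row n h.mem i) ∧
    ∀ x u : Fin n, row n (expandRow.run n h).mem (childRow n c x) u =
      if row n h.mem (n + c) u ≠ 0 ∨ u ∈ closedNbhd G x then 1
      else row n h.mem (childRow n c x) u := by
  set q := ite (.add (.cell (.var 0) (.var 4)) (.add (.cell (.var 7) (.var 4))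
      (.eq (.var 4) (.var 7)))) (setCell (.child (.var 0) (.var 7)) (.var 4) (.const 1)) skip with hq
  set P : Fin n → Fin n → Prop := fun x u => row n h.mem (n + c) u ≠ 0 ∨ u ∈ closedNbhd G x with hP
  classical
  -- The rows of the children `x'` have been written for the pairs `(x', u)` in `T`.
  let I : (Fin n → Fin n → Prop) → RamState → Prop := fun T h' =>
    (∀ i, (∀ x : Fin n, i ≠ childRow n c x) → row n h'.mem i = row n h.mem i) ∧
    ∀ x u : Fin n, row n h'.mem (childRow n c x) u =
      if T x u ∧ P x u then 1 else row n h.mem (childRow n c x) u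
  have hrowc : ∀ x : Fin n, n + c ≠ childRow n c x := fun x => (childRow_ne x).symm
  have hrowlt : ∀ a x : Fin n, (a : ℕ) ≠ childRow n c x := fun a x => by
    have := a.2
    unfold childRow
    omega
  have inner (x : Fin n) (h' : RamState) (h0' : h'.reg 0 = n + c) (h7' : h'.reg 7 = x)
      (hI : I (fun z _ => z.val < x.val) h') :
      I (fun z _ => z.val < x.val + 1) ((forN 4 q).run n h') := by
    have key : I (fun z w => z.val < x.val ∨ (z = x ∧ w.val < n)) ((forN 4 q).run n h') := by
      refine run_forN (fun i => I fun z w => z.val < x.val ∨ (z = x ∧ w.val < i)) ?_ ?_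
      · simpa using hI
      · rintro u h'' hfr ⟨a1, a2⟩
        have h0'' : (h''.setReg 4 u).reg 0 = n + c := by simpa [h0'] using hfr 0 rfl
        have h7'' : (h''.setReg 4 u).reg 7 = x := by simpa [h7'] using hfr 7 rfl
        have h4'' : (h''.setReg 4 u).reg 4 = u := by simp
        have e : (LoopExpr.add (.cell (.var 0) (.var 4)) (.add (.cell (.var 7) (.var 4))
            (.eq (.var 4) (.var 7)))).eval n (h''.setReg 4 u) =
            row n h.mem (n + c) u + (row n h.mem x u + if u = x then 1 else 0) := by
          simp only [LoopExpr.eval]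
          rw [LoopExpr.eval_cell (a := .var 0) (b := .var 4) h0'' h4'',
            LoopExpr.eval_cell (a := .var 7) (b := .var 4) h7'' h4'',
            LoopExpr.eval_eq (a := .var 4) (b := .var 7) h4'' h7'', RamState.setReg_mem,
            a1 _ hrowc, a1 _ (hrowlt x)]
        have hiff : row n h.mem (n + c) u + (row n h.mem x u + if u = x then 1 else 0) ≠ 0 ↔
            P x u := by
          have hA := hG x u
          simp only [hP, mem_closedNbhd, ← hA]
          split_ifs with hux
          · simp [hux]
          · simp only [hux, false_or]
            omega
        have hT (z w : Fin n) (hne : ¬ (z = x ∧ w = u)) :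
            (z.val < x.val ∨ (z = x ∧ w.val < u.val + 1)) ↔
              (z.val < x.val ∨ (z = x ∧ w.val < u.val)) := by
          refine or_congr_right (and_congr_right fun hz => ?_)
          have : w.val ≠ u.val := fun hh => hne ⟨hz, Fin.ext hh⟩
          omega
        by_cases hPu : P x u
        · rw [hq, run_ite_pos (by rw [e]; exact hiff.2 hPu), run_setCell
            (LoopExpr.eval_child (a := .var 0) (b := .var 7) h0'' h7'') (b := .var 4) h4'']
          refine ⟨fun i hi => ?_, fun z w => ?_⟩
          · rw [← a1 i hi]
            ext j
            rw [row_setMem, if_neg fun hh => hi x hh.1]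
            rfl
          · rw [row_setMem]
            by_cases hzw : z = x ∧ w = u
            · obtain ⟨rfl, rfl⟩ := hzw
              simp [hPu, LoopExpr.eval]
            · rw [if_neg fun hh => hzw ⟨childRow_inj hh.1, hh.2⟩, RamState.setReg_mem, a2 z w]
              simp only [hT z w hzw]
              congr
        · rw [hq, run_ite_neg (by rw [e]; by_contra hh; exact hPu (hiff.1 hh))]
          refine ⟨a1, fun z w => ?_⟩
          rw [LoopProg.run, RamState.setReg_mem, a2 z w]
          by_cases hzw : z = x ∧ w = u
          · obtain ⟨rfl, rfl⟩ := hzw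
            simp [hPu]
          · simp only [hT z w hzw]
            congr
    refine ⟨key.1, fun z w => ?_⟩
    rw [key.2 z w]
    have : (z.val < x.val ∨ z = x ∧ w.val < n) ↔ z.val < x.val + 1 := by
      rw [Nat.lt_succ_iff_lt_or_eq, Fin.ext_iff]
      simp
    simp only [this]
    congr
  have key : I (fun z _ => z.val < n) (expandRow.run n h) := by
    refine run_forN (fun i => I fun z _ => z.val < i) ?_ ?_
    · exact ⟨fun _ _ => rfl, by simp⟩
    · intro x h' hfr hI
      exact inner x (h'.setReg 7 x) (by simpa [h0] using hfr 0 rfl) (by simp) hI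
  obtain ⟨k1, k2⟩ := key
  refine ⟨fun a b => ?_, k1, fun x u => ?_⟩
  · rw [k1 _ (hrowlt a)]
    exact hG a b
  · rw [k2 x u]
    simp only [x.2, true_and, hP]

lemma run_checkRoot {h : RamState} :
    (checkRoot.run n h).reg 12 ≠ 0 ↔ ∃ u, row n h.mem n u = 0 := by
  let I : ℕ → RamState → Prop := fun i h' => h'.mem = h.mem ∧
    (h'.reg 12 ≠ 0 ↔ ∃ u : Fin n, u.val < i ∧ row n h.mem n u = 0)
  have key : I n ((forN 4 (ite (.cell .size (.var 4)) skip (set 12 (.const 1)))).run n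
      (h.setReg 12 0)) := by
    refine run_forN I ⟨rfl, by simp⟩ ?_
    rintro u h' - ⟨a1, a2⟩
    have e : (LoopExpr.cell .size (.var 4)).eval n (h'.setReg 4 u) = row n h.mem n u := by
      rw [LoopExpr.eval_cell (a := .size) (b := .var 4) (i := n) (j := u) rfl (by simp [LoopExpr.eval]),
        RamState.setReg_mem, a1]
    by_cases hu : row n h.mem n u = 0
    · rw [run_ite_neg (e.trans hu)]
      exact ⟨a1, by simpa [LoopProg.run, LoopExpr.eval] using ⟨u, by omega, hu⟩⟩
    · rw [run_ite_pos (by rwa [e])]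
      refine ⟨a1, ?_⟩
      have : (h'.setReg 4 u).reg 12 = h'.reg 12 := by simp
      rw [LoopProg.run, this, a2]
      refine exists_congr fun z => and_congr_left fun hz => ?_
      have : z.val ≠ u.val := fun hh => hu (Fin.ext hh ▸ hz)
      omega
  refine key.2.trans (exists_congr fun u => ?_)
  simp

end Expand

/-! ### The invariant of the algorithm -/

/-- The invariant: `e` nodes have been expanded, and the pass over the expanded nodes still has to
visit the nodes `0, …, i - 1`. On the visited nodes, everything is solved that can be solved by
branchings whose nodes are among the first `e` nodes; here `(c + 1) * (n + 1) ^ s` bounds the numbers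
of the nodes in the branchings of depth `s` from node `c`. -/
structure SolverInvariant {n : ℕ} (G : SimpleGraph (Fin n)) (h : RamState) (e i : ℕ) : Prop where
  reg_zero : h.reg 0 = n + e
  reg_one : h.reg 1 = n - 1 + i
  le : i ≤ e
  holdsGraph : HoldsGraph G h.mem
  flag : h.reg 12 ≠ 0 ↔ ∃ u, row n h.mem n u = 0
  partialSolution : ∀ c ≤ e * n, IsPartialSolution G (subproblem G c) (row n h.mem (n + c))
  unexpanded : ∀ c, e ≤ c → c ≤ e * n → ∀ u ∈ subproblem G c, row n h.mem (n + c) u = 0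
  unused : ∀ c, e * n < c → ∀ u, row n h.mem (n + c) u = 0
  solved : ∀ c, i ≤ c → ∀ (s : ℕ) (K : Finset (Fin n)), IsSeparatedIn G K (subproblem G c) →
    Resolvable G s K → (c + 1) * (n + 1) ^ s ≤ e → ∀ v ∈ K, row n h.mem (n + c) v ≠ 0

section Invariant

variable {n : ℕ} {G : SimpleGraph (Fin n)}

lemma isPartialSolution_of_unsolved {W : Finset (Fin n)} {σ : Fin n → ℕ}
    (h0 : ∀ u ∈ W, σ u = 0) (h1 : ∀ u ∉ W, σ u = 1) : IsPartialSolution G W σ := by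
  have h (u : Fin n) : σ u ≤ 1 := by
    by_cases hu : u ∈ W
    · rw [h0 u hu]; omega
    · rw [h1 u hu]
  refine ⟨fun u => (h u).trans (by norm_num), h1, fun a ha b _ _ hσ => absurd (h0 a ha) hσ,
    fun a b ha => ?_, fun I _ hI => ?_⟩
  · have := h a
    omega
  · rw [Finset.eq_empty_of_forall_notMem fun a ha => (hI a ha).2 (h0 a (hI a ha).1)]
    simp

lemma SolverInvariant.solve {h : RamState} {e i : ℕ} (hn : 0 < n)
    (H : SolverInvariant G h e (i + 1)) : SolverInvariant G (solverStep.run n h) e i := by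
  have hie : i < e := H.le
  have h1 : h.reg 1 = n + i := by rw [H.reg_one]; omega
  set g₁ := solveRow.run n h with hg₁
  set g₂ := g₁.setReg 1 (n - 1 + i) with hg₂
  have r1 : g₁.reg 1 = n + i := (run_reg rfl _).trans h1
  have hrun : solverStep.run n h = checkRoot.run n g₂ := by
    have e1 : (LoopExpr.sub (.add (.var 1) (.const 1)) .size).eval n h ≠ 0 := by
      simp only [LoopExpr.eval, h1]; omega
    change checkRoot.run n ((ite _ _ _).run n h) = _
    rw [run_ite_pos e1]
    congr 1
    change g₁.setReg 1 (g₁.reg 1 - 1) = _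
    rw [hg₂, r1]
    congr 1
    omega
  have hmem : (solverStep.run n h).mem = g₁.mem := by rw [hrun, run_mem rfl, hg₂]; rfl
  have hpos (c : ℕ) (hc : c < e) (x : Fin n) : c * n + x + 1 ≤ e * n := by
    have : (c + 1) * n ≤ e * n := Nat.mul_le_mul_right n hc
    have := x.2
    nlinarith
  have hle : i ≤ e * n := hie.le.trans (Nat.le_mul_of_pos_right e hn)
  obtain ⟨s1, s2, s3⟩ := run_solveRow (h := h) (c := i) H.holdsGraph h1 (H.partialSolution i hle)
    fun x => by
      rw [← subproblem_child, childRow_eq]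
      exact H.partialSolution _ (hpos i hie x)
  rw [← hg₁] at s1 s2 s3
  have hother (c : ℕ) (hc : c ≠ i) : row n g₁.mem (n + c) = row n h.mem (n + c) :=
    s1 _ (by omega)
  refine ⟨?_, ?_, hie.le, ?_, ?_, fun c hc => ?_, fun c hc hc' => ?_, fun c hc => ?_,
    fun c hc s K hK hres hs v hv => ?_⟩
  · rw [hrun, run_reg rfl]
    simp only [hg₂, RamState.setReg_reg]
    rw [if_neg (by norm_num), hg₁, run_reg rfl, H.reg_zero]
  · rw [hrun, run_reg rfl]
    simp [hg₂]
  · rw [hmem]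
    exact H.holdsGraph.agree (Nat.le_add_right n i) s1
  · rw [hmem, hrun, run_checkRoot, hg₂, RamState.setReg_mem]
  · rw [hmem]
    by_cases hci : c = i
    · rw [hci]; exact s2
    · rw [hother c hci]; exact H.partialSolution c hc
  · rw [hmem, hother c (by omega)]
    exact H.unexpanded c hc hc'
  · rw [hmem, hother c (by omega)]
    exact H.unused c hc
  · rw [hmem]
    by_cases hci : c = i
    swap
    · rw [hother c hci]
      exact H.solved c (by omega) s K hK hres hs v hv
    subst hci
    cases s with
    | zero =>
      have hK0 : K = ∅ := hres
      rw [hK0] at hv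
      simp at hv
    | succ s =>
      obtain ⟨y, hy, hxy⟩ := hres v hv
      rw [hK.component_eq hv] at hy hxy
      refine s3 v ⟨y, hy, fun x hx hx' u hu => ?_⟩
      rw [childRow_eq]
      by_cases hux : u ∈ closedNbhd G x
      · have := (H.partialSolution (c * n + x + 1) (hpos c hie x)).eq_one u (by
          rw [subproblem_child]
          simp only [Finset.mem_sdiff, not_and, not_not]
          exact fun _ => hux)
        omega
      · refine H.solved (c * n + x + 1) ?_ s (component G (subproblem G c) v \ closedNbhd G x) ?_
          (hxy x hx hx') ?_ u (Finset.mem_sdiff.2 ⟨hu, hux⟩)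
        · have := Nat.le_mul_of_pos_right c hn
          omega
        · rw [subproblem_child]
          have hsep := component_isSeparatedIn (G := G) (hK.subset hv)
          refine ⟨Finset.sdiff_subset_sdiff hsep.subset subset_rfl, fun a ha b hb hab => ?_⟩
          rw [Finset.mem_sdiff] at ha hb ⊢
          exact ⟨hsep.mem_of_adj a ha.1 b hb.1 hab, hb.2⟩
        · refine le_trans ?_ hs
          rw [pow_succ', ← mul_assoc]
          refine Nat.mul_le_mul_right _ ?_
          have := x.2
          nlinarith

lemma SolverInvariant.expand {h : RamState} {e : ℕ} (hn : 0 < n) (H : SolverInvariant G h e 0) :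
    SolverInvariant G (solverStep.run n h) (e + 1) (e + 1) := by
  have h1 : h.reg 1 = n - 1 := H.reg_one
  set g₁ := expandRow.run n h with hg₁
  set g₂ := (g₁.setReg 1 (n + e)).setReg 0 (n + (e + 1)) with hg₂
  have r0 : g₁.reg 0 = n + e := (run_reg rfl _).trans H.reg_zero
  have hrun : solverStep.run n h = checkRoot.run n g₂ := by
    have e1 : (LoopExpr.sub (.add (.var 1) (.const 1)) .size).eval n h = 0 := by
      simp only [LoopExpr.eval, h1]; omega
    change checkRoot.run n ((ite _ _ _).run n h) = _
    rw [run_ite_neg e1]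
    congr 1
    change (g₁.setReg 1 (g₁.reg 0)).setReg 0 ((g₁.setReg 1 (g₁.reg 0)).reg 0 + 1) = _
    rw [hg₂, r0]
    congr 1
    rw [RamState.setReg_reg, if_neg (by norm_num), r0]
    omega
  have hmem : (solverStep.run n h).mem = g₁.mem := by rw [hrun, run_mem rfl, hg₂]; rfl
  obtain ⟨s1, s2, s3⟩ := run_expandRow (h := h) (c := e) H.holdsGraph H.reg_zero
  rw [← hg₁] at s1 s2 s3
  have hee : e ≤ e * n := Nat.le_mul_of_pos_right e hn
  have hsucc : (e + 1) * n = e * n + n := by ring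
  have hother (c : ℕ) (hc : c ≤ e * n ∨ (e + 1) * n < c) :
      row n g₁.mem (n + c) = row n h.mem (n + c) := s2 _ fun x hx => by
    rw [childRow_eq] at hx
    have := x.2
    omega
  have hnew (c : ℕ) (hc : e * n < c) (hc' : c ≤ (e + 1) * n) :
      (∀ u ∈ subproblem G c, row n g₁.mem (n + c) u = 0) ∧
      (∀ u ∉ subproblem G c, row n g₁.mem (n + c) u = 1) := by
    obtain ⟨x, rfl⟩ : ∃ x : Fin n, c = e * n + x + 1 :=
      ⟨⟨c - e * n - 1, by omega⟩, by simp only; omega⟩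
    have hval (u : Fin n) : row n g₁.mem (n + (e * n + x + 1)) u =
        if row n h.mem (n + e) u ≠ 0 ∨ u ∈ closedNbhd G x then 1 else 0 := by
      rw [← childRow_eq, s3 x u, childRow_eq, H.unused _ hc]
    rw [subproblem_child]
    refine ⟨fun u hu => ?_, fun u hu => ?_⟩
    · rw [Finset.mem_sdiff] at hu
      rw [hval, if_neg]
      rintro (hh | hh)
      · exact hh (H.unexpanded e le_rfl hee u hu.1)
      · exact hu.2 hh
    · rw [hval, if_pos]
      by_contra hh
      push Not at hh
      refine hu (Finset.mem_sdiff.2 ⟨?_, hh.2⟩)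
      by_contra hu'
      have := (H.partialSolution e hee).eq_one u hu'
      omega
  refine ⟨?_, ?_, le_rfl, ?_, ?_, fun c hc => ?_, fun c hc hc' => ?_, fun c hc => ?_,
    fun c hc s K hK hres hs v hv => ?_⟩
  · rw [hrun, run_reg rfl]
    simp [hg₂]
  · rw [hrun, run_reg rfl]
    simp only [hg₂, RamState.setReg_reg]
    rw [if_neg (by norm_num), if_pos trivial]
    omega
  · rw [hmem]; exact s1
  · rw [hmem, hrun, run_checkRoot, hg₂, RamState.setReg_mem, RamState.setReg_mem]
  · rw [hmem]
    by_cases hce : c ≤ e * n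
    · rw [hother c (Or.inl hce)]; exact H.partialSolution c hce
    · obtain ⟨a0, a1⟩ := hnew c (by omega) hc
      exact isPartialSolution_of_unsolved a0 a1
  · rw [hmem]
    by_cases hce : c ≤ e * n
    · rw [hother c (Or.inl hce)]; exact H.unexpanded c (by omega) hce
    · exact (hnew c (by omega) hc').1
  · rw [hmem, hother c (Or.inr hc)]
    exact H.unused c (by omega)
  · have h2 : 1 ≤ (n + 1) ^ s := Nat.one_le_pow _ _ (by omega)
    have h3 : c + 1 ≤ (c + 1) * (n + 1) ^ s := Nat.le_mul_of_pos_right _ h2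
    omega

lemma SolverInvariant.step {h : RamState} {e i : ℕ} (hn : 0 < n) (H : SolverInvariant G h e i) :
    ∃ e' i', SolverInvariant G (solverStep.run n h) e' i' := by
  cases i with
  | zero => exact ⟨_, _, H.expand hn⟩
  | succ i => exact ⟨_, _, H.solve hn⟩

/-- A pass over all expanded nodes. -/
lemma SolverInvariant.pass {e : ℕ} (hn : 0 < n) : ∀ {i : ℕ} {h : RamState},
    SolverInvariant G h e i → SolverInvariant G ((solverStep.run n)^[i] h) e 0
  | 0, _, H => H
  | i + 1, h, H => by
      rw [Function.iterate_succ_apply]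
      exact (H.solve hn).pass hn

/-- After at most quadratically many steps, `e` nodes have been expanded and visited. -/
lemma SolverInvariant.exists_iterate {h : RamState} (hn : 0 < n) (H : SolverInvariant G h 0 0) :
    ∀ e, ∃ j ≤ (e + 1) ^ 2, SolverInvariant G ((solverStep.run n)^[j] h) e 0
  | 0 => ⟨0, by simp, H⟩
  | e + 1 => by
      obtain ⟨j, hj, Hj⟩ := H.exists_iterate hn e
      refine ⟨(e + 1) + (j + 1), by nlinarith, ?_⟩
      rw [Function.iterate_add_apply, Function.iterate_succ_apply' _ j]
      exact (Hj.expand hn).pass hn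

lemma SolverInvariant.flag_eq_zero {h : RamState} {s : ℕ} {e : ℕ} (H : SolverInvariant G h e 0)
    (hres : Resolvable G s Finset.univ) (he : (n + 1) ^ s ≤ e) : h.reg 12 = 0 := by
  by_contra hh
  obtain ⟨u, hu⟩ := H.flag.1 hh
  refine H.solved 0 le_rfl s Finset.univ ?_ hres (by simpa using he) u (Finset.mem_univ u) hu
  rw [subproblem_zero]
  exact ⟨subset_rfl, fun _ _ _ _ _ => Finset.mem_univ _⟩

lemma SolverInvariant.isMaximumIndepSet {h : RamState} {e i : ℕ} (H : SolverInvariant G h e i)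
    (h0 : h.reg 12 = 0) :
    G.IsMaximumIndepSet (Finset.univ.filter fun u => row n h.mem n u = 2) := by
  have hp := H.partialSolution 0 (Nat.zero_le _)
  rw [subproblem_zero, add_zero] at hp
  refine ⟨fun a ha b hb _ => ?_, fun I hI => hp.card_le I hI fun a _ => ⟨Finset.mem_univ a, ?_⟩⟩
  · exact hp.not_adj a b (by simpa using ha) (by simpa using hb)
  · exact fun ha => H.flag.2 ⟨a, ha⟩ h0

lemma run_solverOutput {h : RamState} (u : Fin n) :
    (solverOutput.run n h).mem u = row n h.mem n u - 1 := by
  let I : ℕ → RamState → Prop := fun i h' => row n h'.mem n = row n h.mem n ∧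
    ∀ z : Fin n, z.val < i → h'.mem z = row n h.mem n z - 1
  have key : I n (solverOutput.run n h) := by
    refine run_forN I ⟨rfl, by simp⟩ ?_
    rintro z h' - ⟨a1, a2⟩
    have e : (LoopExpr.cell .size (.var 4)).eval n (h'.setReg 4 z) = row n h.mem n z := by
      rw [LoopExpr.eval_cell (a := .size) (b := .var 4) (i := n) (j := z) rfl (by simp [LoopExpr.eval]),
        RamState.setReg_mem, a1]
    have hrun : (store (.var 4) (.sub (.cell .size (.var 4)) (.const 1))).run n (h'.setReg 4 z) =
        (h'.setReg 4 z).setMem z (row n h.mem n z - 1) := by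
      change (h'.setReg 4 z).setMem ((h'.setReg 4 z).reg 4)
        ((LoopExpr.cell .size (.var 4)).eval n (h'.setReg 4 z) - 1) = _
      rw [e, RamState.setReg_reg, if_pos rfl]
    rw [hrun]
    refine ⟨?_, fun w hw => ?_⟩
    · rw [← a1]
      ext j
      simp only [row, RamState.setMem_mem, RamState.setReg_mem]
      rw [if_neg]
      -- The output does not reach the row of the root.
      have := Nat.le_mul_of_pos_right n j.pos
      have := z.2
      omega
    · rw [RamState.setMem_mem]
      split_ifs with hwz
      · rw [Fin.ext hwz]
      · exact a2 w (by omega)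
  exact key.2 u u.2

end Invariant

/-! ### Correctness and running time of the machine program -/

open Classical in
lemma holdsGraph_ramInput {n : ℕ} (G : SimpleGraph (Fin n)) : HoldsGraph G (ramInput G).mem := by
  intro a b
  have h : (ramInput G).mem (1 + a * n + b) =
      if ∃ i j : Fin n, G.Adj i j ∧ 1 + a * n + b = 1 + i.val * n + j.val then 1 else 0 := by
    simp only [ramInput]
    rw [if_neg (by omega)]
  rw [row, h]
  constructor
  · intro hh
    split_ifs at hh with hex
    · obtain ⟨i, j, hij, he⟩ := hex
      obtain ⟨h1, rfl⟩ := row_address_inj he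
      obtain rfl := Fin.ext h1
      exact hij
    · exact absurd rfl hh
  · intro hab
    rw [if_pos ⟨a, b, hab, rfl⟩]
    norm_num

lemma row_ramInput {n : ℕ} (G : SimpleGraph (Fin n)) (c : ℕ) (u : Fin n) :
    row n (ramInput G).mem (n + c) u = 0 := by
  simp only [row, ramInput]
  rw [if_neg (by omega), if_neg]
  rintro ⟨i, j, -, he⟩
  have := (row_address_inj he).1
  have := i.2
  omega

lemma solverInvariant_start {n : ℕ} (G : SimpleGraph (Fin n)) :
    SolverInvariant G (solverStart.run n (ramInput G)) 0 0 := by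
  have hmem : (solverStart.run n (ramInput G)).mem = (ramInput G).mem := run_mem rfl _
  refine ⟨rfl, rfl, le_rfl, ?_, ?_, fun c hc => ?_, fun c _ _ => ?_, fun c _ => ?_,
    fun c _ s K _ _ hs => ?_⟩
  · rw [hmem]; exact holdsGraph_ramInput G
  · have h12 : (solverStart.run n (ramInput G)).reg 12 = n := rfl
    rw [h12, hmem]
    constructor
    · exact fun hn => ⟨⟨0, by omega⟩, row_ramInput G 0 _⟩
    · rintro ⟨u, -⟩
      exact u.pos.ne'
  · have hc0 : c = 0 := by omega
    subst hc0
    rw [hmem, subproblem_zero]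
    exact isPartialSolution_of_unsolved (fun u _ => row_ramInput G 0 u)
      fun u hu => absurd (Finset.mem_univ u) hu
  · rw [hmem]; exact fun u _ => row_ramInput G c u
  · rw [hmem]; exact row_ramInput G c
  · have h2 : 0 < (c + 1) * (n + 1) ^ s := by positivity
    omega

/-- The program finds a maximum independent set, and its running time is bounded in terms of the
branching depth. -/
theorem solver_correct : ∃ A D : ℕ, ∀ (n : ℕ) (G : SimpleGraph (Fin n)) (s : ℕ),
    Resolvable G s Finset.univ → ∃ (f : RamState) (t : ℕ), RamRuns solver (ramInput G) f t ∧
      G.IsMaximumIndepSet (ramOutput n f) ∧ t ≤ A * (n + 1) ^ (D + 2 * s) := by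
  obtain ⟨A₁, D₁, h₁⟩ := solverStart.cost_le
  obtain ⟨A₂, D₂, h₂⟩ := solverStep.cost_le
  obtain ⟨A₃, D₃, h₃⟩ := solverOutput.cost_le
  refine ⟨A₁ + 4 * (A₂ + 1) + A₃ + 2, D₁ + D₂ + D₃, fun n G s hres => ?_⟩
  set h₀ := solverStart.run n (ramInput G) with hh₀
  have H₀ : SolverInvariant G h₀ 0 0 := solverInvariant_start G
  have hinv : 0 < n → ∀ j, ∃ e i, SolverInvariant G ((solverStep.run n)^[j] h₀) e i := by
    intro hn j
    induction j with
    | zero => exact ⟨0, 0, H₀⟩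
    | succ j ih =>
      obtain ⟨e, i, H⟩ := ih
      rw [Function.iterate_succ_apply']
      exact H.step hn
  set J := ((n + 1) ^ s + 1) ^ 2 with hJ
  have hhalt : ∃ j ≤ J, ((solverStep.run n)^[j] h₀).reg 12 = 0 := by
    rcases Nat.eq_zero_or_pos n with hn | hn
    · exact ⟨0, Nat.zero_le _, hn⟩
    · obtain ⟨j, hj, H⟩ := H₀.exists_iterate hn ((n + 1) ^ s)
      exact ⟨j, hj, H.flag_eq_zero hres le_rfl⟩
  have R₀ : Represents n ((ramInput G).setReg 0 n) (ramInput G) :=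
    ⟨by simp, fun r => by simp [ramInput], rfl⟩
  obtain ⟨f₁, t₁, r₁, l₁, R₁, -⟩ := solverStart.ramRuns_compile n 0 _ _ R₀
  obtain ⟨f₂, t₂, j, r₂, l₂, R₂, z₂⟩ := ramRuns_while n 12 solverStep J f₁ h₀ R₁ hhalt
  obtain ⟨f₃, t₃, r₃, l₃, R₃, -⟩ := solverOutput.ramRuns_compile n 0 _ _ R₂
  refine ⟨f₃, 1 + (t₁ + (t₂ + t₃)), .seq ?_ (.seq r₁ (.seq r₂ r₃)), ?_, ?_⟩
  · have := RamRuns.load 0 0 (ramInput G)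
    simpa [ramInput] using this
  · have hout : ramOutput n f₃ = Finset.univ.filter
        fun u => row n ((solverStep.run n)^[j] h₀).mem n u - 1 ≠ 0 := by
      unfold ramOutput
      rw [R₃.mem]
      simp only [run_solverOutput]
    rcases Nat.eq_zero_or_pos n with hn | hn
    · subst hn
      exact ⟨fun a => a.elim0, fun I _ => by simp [Finset.eq_empty_of_isEmpty I]⟩
    · obtain ⟨e, i, H⟩ := hinv hn j
      convert H.isMaximumIndepSet z₂ using 1
      rw [hout]
      refine Finset.filter_congr fun u _ => ?_
      have := (H.partialSolution 0 (Nat.zero_le _)).le_two u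
      rw [add_zero] at this
      omega
  · have one (k : ℕ) : 1 ≤ (n + 1) ^ k := Nat.one_le_pow _ _ (by omega)
    have mono {k l : ℕ} (h : k ≤ l) : (n + 1) ^ k ≤ (n + 1) ^ l :=
      Nat.pow_le_pow_right (by omega) h
    set E := (n + 1) ^ (D₁ + D₂ + D₃ + 2 * s) with hE
    have hJ4 : J ≤ 4 * (n + 1) ^ (2 * s) := by
      have := one s
      rw [hJ, mul_comm 2 s, pow_mul]
      nlinarith
    have hJE : J * (solverStep.cost n + 1) ≤ 4 * (A₂ + 1) * E := by
      calc J * (solverStep.cost n + 1)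
          ≤ (4 * (n + 1) ^ (2 * s)) * ((A₂ + 1) * (n + 1) ^ D₂) := by
            refine Nat.mul_le_mul hJ4 ?_
            have := h₂ n
            have := one D₂
            nlinarith
        _ = 4 * (A₂ + 1) * (n + 1) ^ (D₂ + 2 * s) := by rw [pow_add]; ring
        _ ≤ 4 * (A₂ + 1) * E := Nat.mul_le_mul_left _ (mono (by omega))
    have a₁ : t₁ ≤ A₁ * E := l₁.trans ((h₁ n).trans (Nat.mul_le_mul_left _ (mono (by omega))))
    have a₃ : t₃ ≤ A₃ * E := l₃.trans ((h₃ n).trans (Nat.mul_le_mul_left _ (mono (by omega))))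
    have aE : 1 ≤ E := one _
    calc 1 + (t₁ + (t₂ + t₃)) ≤ 1 + (A₁ * E + ((4 * (A₂ + 1) * E + 1) + A₃ * E)) := by
          gcongr
          omega
      _ ≤ (A₁ + 4 * (A₂ + 1) + A₃ + 2) * E := by nlinarith

/-! ### The running time in terms of the independence number -/

/-- A running time `A * (n + 1) ^ (D + 2 * s)` in terms of the branching depth `s` is of the form
`C * n ^ (C * x)` when `s` is at most proportional to `x`. -/
lemma time_le_rpow {A D n t : ℕ} {C C₀ x : ℝ} (hC₀ : 1 ≤ C₀) (hn : 2 ≤ n) (hx : 1 ≤ x)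
    (hA : (A : ℝ) ≤ C) (hC : 2 * (D : ℝ) + 4 * C₀ ≤ C)
    (ht : t ≤ A * (n + 1) ^ (D + 2 * ⌊C₀ * x⌋₊)) : (t : ℝ) ≤ C * (n : ℝ) ^ (C * x) := by
  have h1 : (1 : ℝ) ≤ n := by exact_mod_cast (by omega : 1 ≤ n)
  set s := ⌊C₀ * x⌋₊ with hs
  have h2 : t ≤ A * n ^ (2 * (D + 2 * s)) := by
    refine ht.trans (Nat.mul_le_mul_left _ ?_)
    rw [pow_mul]
    exact Nat.pow_le_pow_left (by nlinarith) _
  have h3 : (s : ℝ) ≤ C₀ * x := Nat.floor_le (by positivity)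
  calc (t : ℝ) ≤ A * (n : ℝ) ^ (2 * (D + 2 * s)) := by exact_mod_cast h2
    _ = A * (n : ℝ) ^ ((2 * (D + 2 * s) : ℕ) : ℝ) := by rw [Real.rpow_natCast]
    _ ≤ C * (n : ℝ) ^ (C * x) := by
      refine mul_le_mul hA (Real.rpow_le_rpow_of_exponent_le h1 ?_) (by positivity)
        ((Nat.cast_nonneg A).trans hA)
      push_cast
      have hD0 : (0 : ℝ) ≤ D := Nat.cast_nonneg D
      nlinarith

lemma one_le_indepNum {n : ℕ} (G : SimpleGraph (Fin n)) (hn : 0 < n) : 1 ≤ G.indepNum := by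
  have h : G.IsIndepSet (({⟨0, hn⟩} : Finset (Fin n)) : Set (Fin n)) := by
    simp [SimpleGraph.IsIndepSet]
  simpa using h.card_le_indepNum

theorem theorem3 (d : ℕ) (hd : 2 ≤ d) (ρ : ℝ) (hρ : 1 ≤ ρ) :
    ∃ (C : ℝ) (A : RamProg), 0 < C ∧
      ∀ (α : ℝ), 1 ≤ α →
        ∀ (n : ℕ) (o : Fin n → Set (EuclideanSpace ℝ (Fin d))),
          SimilarlySized ρ o → IsStabbed α o →
            ∃ (s : RamState) (t : ℕ),
              RamRuns A (ramInput (intersectionGraph o)) s t ∧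
              (intersectionGraph o).IsMaximumIndepSet (ramOutput n s) ∧
              (t : ℝ) ≤ C * (n : ℝ) ^
                (C * ((intersectionGraph o).indepNum : ℝ) ^ (1 - 1 / (d : ℝ)) * α) := by
  obtain ⟨C₀, hC₀, hres⟩ := resolvable_of_isStabbed hd hρ
  obtain ⟨A, D, hsolver⟩ := solver_correct
  have hβ : 0 < 1 - 1 / (d : ℝ) := by
    have : (2 : ℝ) ≤ d := by exact_mod_cast hd
    rw [sub_pos, div_lt_one (by linarith)]
    linarith
  have hA0 : (0 : ℝ) ≤ A := Nat.cast_nonneg A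
  have hD0 : (0 : ℝ) ≤ D := Nat.cast_nonneg D
  have hpow : (1 : ℝ) ≤ 2 ^ (D + 2) := one_le_pow₀ one_le_two
  refine ⟨A * 2 ^ (D + 2) + 2 * D + 4 * C₀, solver, by positivity, fun α hα n o hs ho => ?_⟩
  set C : ℝ := A * 2 ^ (D + 2) + 2 * D + 4 * C₀ with hC
  set k := (intersectionGraph o).indepNum with hk
  rcases Nat.lt_or_ge 1 n with hn | hn
  · obtain ⟨f, t, hrun, hmax, ht⟩ := hsolver n _ _ (hres α hα n o hs ho)
    refine ⟨f, t, hrun, hmax, ?_⟩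
    have hk1 : (1 : ℝ) ≤ k := by exact_mod_cast one_le_indepNum (intersectionGraph o) (by omega)
    rw [mul_assoc] at ht ⊢
    refine time_le_rpow hC₀ hn (one_le_mul_of_one_le_of_one_le (Real.one_le_rpow hk1 hβ.le) hα)
      ?_ ?_ ht
    · nlinarith
    · nlinarith
  · -- For at most one object the power of `n` equals `1`: if `n = 0`, then its exponent vanishes.
    have hkn : k ≤ n := by
      obtain ⟨I, hI⟩ := (intersectionGraph o).exists_isNIndepSet_indepNum
      rw [hk, ← hI.card_eq]
      simpa using I.card_le_univ
    obtain ⟨f, t, hrun, hmax, ht⟩ := hsolver n (intersectionGraph o) k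
      (resolvable_of_card_le fun I _ hI => hI.card_le_indepNum)
    refine ⟨f, t, hrun, hmax, ?_⟩
    have h1 : (n : ℝ) ^ (C * (k : ℝ) ^ (1 - 1 / (d : ℝ)) * α) = 1 := by
      rcases Nat.le_one_iff_eq_zero_or_eq_one.1 hn with h | h
      · have hk0 : k = 0 := by omega
        rw [hk0, Nat.cast_zero, Real.zero_rpow hβ.ne', mul_zero, zero_mul, Real.rpow_zero]
      · rw [h, Nat.cast_one, Real.one_rpow]
    have h2 : t ≤ A * 2 ^ (D + 2) := by
      refine ht.trans (Nat.mul_le_mul_left _ ?_)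
      exact (Nat.pow_le_pow_left (by omega) _).trans (Nat.pow_le_pow_right (by norm_num) (by omega))
    have h3 : (t : ℝ) ≤ A * 2 ^ (D + 2) := by exact_mod_cast h2
    rw [h1, mul_one, hC]
    linarith
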